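/- Let $k$ be a commutative ring, $\beta\in k$ and $m\ge 1$. A \emph{reduced affine partition $m$-diagram} is a set partition of the vertices $\mathbb{Z}\times\{0,1\}$ of an infinite horizontal strip ($0$ = bottom, $1$ = top) that is invariant under horizontal translation by $\pm m$. The free $k$-module on these diagrams is a $k$-algebra with $D\cdot D'=\beta^{N(D,D')}\,D\circ D'$, where $D\circ D'$ is obtained by stacking $D$ on top of $D'$ and deleting the components contained in the middle row, and $N(D,D')$ is the number of these components on the cylinder, i.e. up to translation (contractible or not). The reduced affine Brauer algebra $aBr_m(\beta)$ is the subalgebra generated by the diagrams all of whose components have size $2$. In $aBr_m(\beta)$ consider the following diagrams. Number the strands $1,\dots,m$; strand $i$ consists of the vertices congruent to $i$ modulo $m$. For $1\le i\le m-1$, $s_i$ is the crossing of the strands $i$ and $i+1$, and $e_i$ is the diagram with a cup and a cap joining the strands $i,i+1$ and vertical lines elsewhere. For $1\le i\le m$, $t_i$ joins the bottom vertex $x$ to the top vertex $x+m$ if $x\equiv i \pmod m$ and to the top vertex $x$ otherwise; $\tau$ joins every bottom vertex $x$ to the top vertex $x+1$. The diagrams $t_i$ and $\tau$ are invertible. \textbf{Proposition.}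 The algebra $aBr_m(\beta)$ is generated by $\tau^{\pm1}$, $e_i,s_i$ $(1\le i\le m-1)$ and $t_i^{\pm 1}$ $(1\le i\le m)$, and the following is a list of defining relations (all indices in the ranges where the terms make sense): \begin{enumerate} \item $s_i^2=1$; $s_is_j=s_js_i$ for $|i-j|>1$; $s_is_{i+1}s_i=s_{i+1}s_is_{i+1}$; \item $e_i^2=\beta e_i$; $e_ie_{i\pm1}e_i=e_i$; \item $e_ie_j=e_je_i$ and $s_ie_j=e_js_i$ for $|i-j|>1$; \item $s_is_{i\pm1}e_i=e_{i\pm1}e_i$; $e_is_{i\pm1}s_i=e_ie_{i\pm1}$; $s_ie_i=e_is_i=e_i$; \item $t_it_i^{-1}=t_i^{-1}t_i=1$; $\tau\tau^{-1}=\tau^{-1}\tau=1$; $\tau=t_1s_1s_2\cdots s_{m-1}$; \item $s_it_j=t_js_i$ for $|i-j|>1$; \item $e_it_j=t_je_i$ for $|i-j|>1$; \item $t_it_j=t_jt_i$; \item $s_it_i=t_{i+1}s_i$; \item $e_it_it_{i+1}=e_i=t_it_{i+1}e_i$; \item $e_it_i^ae_i=\beta e_i$ for all $a\in\mathbb{Z}$.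 \end{enumerate} That is, the $k$-algebra presented by these generators and relations is isomorphic to $aBr_m(\beta)$ by the homomorphism that sends each generator to the diagram of the same name. -/

import Mathlib

namespace AffineDiagram

/-! ## Stacking of set partitions

A set partition of `X × Bool` is a partition diagram whose bottom vertices are `(x, false)` and whose
top vertices are `(x, true)`.  Stacking uses three rows: `0` bottom, `1` middle, `2` top. -/

section Stack

variable {X : Type}

/-- The upper diagram of a stack occupies the rows `1` and `2`. -/
def upper (p : X × Bool) : X × Fin 3 := (p.1, if p.2 then 2 else 1)

/-- The lower diagram of a stack occupies the rows `0` and `1`. -/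
def lower (p : X × Bool) : X × Fin 3 := (p.1, if p.2 then 1 else 0)

/-- The outer rows `0` and `2` of a stack. -/
def outer (p : X × Bool) : X × Fin 3 := (p.1, if p.2 then 2 else 0)

/-- Copy a relation along a map. -/
def place {U V : Type} (R : U → U → Prop) (f : U → V) (p q : V) : Prop :=
  ∃ x y, R x y ∧ f x = p ∧ f y = q

/-- The set partition into connected components of `R` stacked on top of `R'`. -/
def stack (R R' : Setoid (X × Bool)) : Setoid (X × Fin 3) :=
  Relation.EqvGen.setoid fun p q => place R upper p q ∨ place R' lower p q

/-- The partition of the outer vertices obtained by stacking `R` on top of `R'`. -/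
def comp (R R' : Setoid (X × Bool)) : Setoid (X × Bool) := (stack R R').comap outer

/-- The closed components of `R` stacked on `R'`: those which lie in the middle row. -/
def closedComponents (R R' : Setoid (X × Bool)) : Set (Set (X × Fin 3)) :=
  {c | c ∈ (stack R R').classes ∧ ∀ p ∈ c, p.2 = 1}

/-! Associativity of stacking, and additivity of the number of closed components. -/

/-- The classes of `T` which do not meet `O`. -/
def avoiding {V : Type} (T : Setoid V) (O : Set V) : Set (Set V) :=
  {c | c ∈ T.classes ∧ ∀ p ∈ c, p ∉ O}

lemma glue_iff {U V : Type} {f : U → V} {S E : V → V → Prop}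
    {Q Q' : U → U → Prop} (hSe : Equivalence S)
    (hE : ∀ x y, E x y → ∃ a b, Q' a b ∧ f a = x ∧ f b = y)
    (hE' : ∀ a b, Q' a b → E (f a) (f b))
    (hS : ∀ a b, S (f a) (f b) → Relation.EqvGen Q a b)
    (hS' : ∀ a b, Q a b → S (f a) (f b)) (a b : U) :
    Relation.EqvGen (fun p q => S p q ∨ E p q) (f a) (f b) ↔
      Relation.EqvGen (fun p q => Q p q ∨ Q' p q) a b := by
  have monoQ : ∀ a b, Relation.EqvGen Q a b → Relation.EqvGen (fun p q => Q p q ∨ Q' p q) a b :=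
    fun a b h => Relation.EqvGen.mono (fun _ _ h => Or.inl h) _ _ h
  constructor
  · have key : ∀ x y, Relation.EqvGen (fun p q => S p q ∨ E p q) x y →
        (∀ c, (∃ a, Relation.EqvGen (fun p q => Q p q ∨ Q' p q) c a ∧ S (f a) x) ↔
          (∃ a, Relation.EqvGen (fun p q => Q p q ∨ Q' p q) c a ∧ S (f a) y)) := by
      intro x y h
      induction h with
      | rel x y h =>
        rcases h with h | h
        · intro c
          constructor
          · rintro ⟨a, h1, h2⟩; exact ⟨a, h1, hSe.trans h2 h⟩
          · rintro ⟨a, h1, h2⟩; exact ⟨a, h1, hSe.trans h2 (hSe.symm h)⟩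
        · obtain ⟨u, v, huv, rfl, rfl⟩ := hE x y h
          intro c
          constructor
          · rintro ⟨a, h1, h2⟩
            exact ⟨v, (h1.trans _ _ _ (monoQ _ _ (hS _ _ h2))).trans _ _ _
              (Relation.EqvGen.rel _ _ (Or.inr huv)), hSe.refl _⟩
          · rintro ⟨a, h1, h2⟩
            exact ⟨u, (h1.trans _ _ _ (monoQ _ _ (hS _ _ h2))).trans _ _ _
              (Relation.EqvGen.symm _ _ (Relation.EqvGen.rel _ _ (Or.inr huv))), hSe.refl _⟩
      | refl x => intro c; rfl
      | symm x y _ ih => intro c; exact (ih c).symm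
      | trans x y z _ _ ih1 ih2 => intro c; exact (ih1 c).trans (ih2 c)
    intro h
    obtain ⟨d, h1, h2⟩ := (key _ _ h a).1 ⟨a, Relation.EqvGen.refl _, hSe.refl _⟩
    exact h1.trans _ _ _ (monoQ _ _ (hS _ _ h2))
  · intro h
    induction h with
    | rel x y h =>
      exact Relation.EqvGen.rel _ _ (h.imp (hS' _ _) (hE' _ _))
    | refl x => exact Relation.EqvGen.refl _
    | symm x y _ ih => exact Relation.EqvGen.symm _ _ ih
    | trans x y z _ _ ih1 ih2 => exact Relation.EqvGen.trans _ _ _ ih1 ih2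

lemma avoiding_glue {V : Type} (S T : Setoid V) (E : V → V → Prop) (A : Set V)
    (hT : ∀ p q, T p q ↔ Relation.EqvGen (fun p q => S p q ∨ E p q) p q)
    (hE : ∀ x y, E x y → x ∈ A ∧ y ∈ A) : avoiding T A = avoiding S A := by
  have key : ∀ x y, Relation.EqvGen (fun p q => S p q ∨ E p q) x y →
      (((∀ z, S z x → z ∉ A) ∨ (∀ z, S z y → z ∉ A)) → S x y) := by
    have : ∀ x y, S x y → (∀ z, S z x → z ∉ A) → (∀ z, S z y → z ∉ A) :=
      fun x y h h' z hz => h' z (S.trans' hz (S.symm' h))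
    intro x y h
    induction h with
    | rel x y h =>
      rcases h with h | h
      · exact fun _ => h
      · rintro (h' | h')
        · exact absurd (hE _ _ h).1 (h' _ (S.refl' _))
        · exact absurd (hE _ _ h).2 (h' _ (S.refl' _))
    | refl x => exact fun _ => S.refl' _
    | symm x y _ ih => exact fun h => S.symm' (ih h.symm)
    | trans x y z _ _ ih1 ih2 =>
      rintro (h | h)
      · have h1 := ih1 (Or.inl h)
        exact S.trans' h1 (ih2 (Or.inl (this _ _ h1 h)))
      · have h2 := ih2 (Or.inr h)
        exact S.trans' (ih1 (Or.inr (this _ _ (S.symm' h2) h))) h2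
  have sub : ∀ x y, S x y → T x y := fun x y h => (hT _ _).2 (Relation.EqvGen.rel _ _ (Or.inl h))
  ext c
  constructor
  · rintro ⟨⟨y, rfl⟩, hc⟩
    refine ⟨⟨y, ?_⟩, hc⟩
    have hy : ∀ z, S z y → z ∉ A := fun z hz => hc z (sub _ _ hz)
    ext x
    exact ⟨fun h => key _ _ ((hT _ _).1 h) (Or.inr hy), fun h => sub _ _ h⟩
  · rintro ⟨⟨y, rfl⟩, hc⟩
    have e : {x | S x y} = {x | T x y} := by
      ext x
      exact ⟨fun h => sub _ _ h, fun h => key _ _ ((hT _ _).1 h) (Or.inr hc)⟩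
    exact ⟨⟨y, e⟩, hc⟩

lemma encard_avoiding_image {U V : Type} {f : U → V} (hf : Function.Injective f) (Q : Setoid U)
    (S : Setoid V) (hS : ∀ p q, S p q ↔ p = q ∨ place Q f p q) (A : Set V)
    (hA : ∀ p, p ∉ A → p ∈ Set.range f) :
    (avoiding S A).encard = (avoiding Q (f ⁻¹' A)).encard := by
  have e : avoiding S A = Set.image f '' avoiding Q (f ⁻¹' A) := by
    have im : ∀ u, f '' {x | Q x u} = {x | S x (f u)} := by
      intro u
      ext x
      constructor
      · rintro ⟨a, ha, rfl⟩
        exact (hS _ _).2 (Or.inr ⟨a, u, ha, rfl, rfl⟩)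
      · intro h
        rcases (hS _ _).1 h with h | ⟨a, b, h', rfl, hb⟩
        · exact ⟨u, Q.refl' _, h.symm⟩
        · exact ⟨a, hf hb ▸ h', rfl⟩
    ext c
    constructor
    · rintro ⟨⟨y, rfl⟩, hc⟩
      obtain ⟨u, rfl⟩ := hA y (hc y (S.refl' _))
      refine ⟨{x | Q x u}, ⟨⟨u, rfl⟩, fun p hp => ?_⟩, im u⟩
      exact hc (f p) ((hS _ _).2 (Or.inr ⟨p, u, hp, rfl, rfl⟩))
    · rintro ⟨d, ⟨⟨u, rfl⟩, hd⟩, rfl⟩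
      refine ⟨⟨f u, im u⟩, ?_⟩
      rintro _ ⟨a, ha, rfl⟩
      exact hd a ha
  rw [e, hf.image_injective.encard_image]

lemma encard_avoiding_split {U V : Type} (f : U → V) (T : Setoid V) (O : Set V)
    (hO : O ⊆ Set.range f) :
    (avoiding T O).encard =
      (avoiding T (Set.range f)).encard + (avoiding (T.comap f) (f ⁻¹' O)).encard := by
  have e : avoiding T O = avoiding T (Set.range f) ∪
      {c | c ∈ avoiding T O ∧ ∃ u, f u ∈ c} := by
    ext c
    constructor
    · intro hc
      by_cases h : ∃ u, f u ∈ c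
      · exact Or.inr ⟨hc, h⟩
      · refine Or.inl ⟨hc.1, ?_⟩
        rintro _ hp ⟨u, rfl⟩
        exact h ⟨u, hp⟩
    · rintro (hc | hc)
      · exact ⟨hc.1, fun p hp hpO => hc.2 p hp (hO hpO)⟩
      · exact hc.1
  have hdisj : Disjoint (avoiding T (Set.range f)) {c | c ∈ avoiding T O ∧ ∃ u, f u ∈ c} := by
    rw [Set.disjoint_left]
    rintro c hc ⟨_, u, hu⟩
    exact hc.2 _ hu ⟨u, rfl⟩
  have im : avoiding (T.comap f) (f ⁻¹' O) =
      Set.preimage f '' {c | c ∈ avoiding T O ∧ ∃ u, f u ∈ c} := by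
    ext d
    constructor
    · rintro ⟨⟨u, rfl⟩, hd⟩
      refine ⟨{x | T x (f u)}, ⟨⟨⟨f u, rfl⟩, ?_⟩, u, T.refl' _⟩, rfl⟩
      intro p hp hpO
      obtain ⟨w, rfl⟩ := hO hpO
      exact hd w hp hpO
    · rintro ⟨c, ⟨⟨⟨y, rfl⟩, hc⟩, u, hu⟩, rfl⟩
      refine ⟨⟨u, ?_⟩, fun p hp hpO => hc _ hp hpO⟩
      ext x
      exact ⟨fun h => T.trans' h (T.symm' hu), fun h => T.trans' h hu⟩
  have inj : Set.InjOn (Set.preimage f) {c | c ∈ avoiding T O ∧ ∃ u, f u ∈ c} := by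
    rintro c ⟨⟨⟨y, rfl⟩, _⟩, u, hu⟩ c' ⟨⟨⟨y', rfl⟩, _⟩, u', hu'⟩ h
    have h1 : u ∈ f ⁻¹' {x | T x y'} := by rw [← h]; exact hu
    have h2 : T y y' := T.trans' (T.symm' hu) h1
    ext x
    exact ⟨fun h => T.trans' h h2, fun h => T.trans' h (T.symm' h2)⟩
  rw [e, Set.encard_union_eq hdisj, im, inj.encard_image]

/-- The diagram placed in rows `a` (bottom) and `b` (top) of a strip with four rows. -/
def rows (a b : Fin 4) (p : X × Bool) : X × Fin 4 := (p.1, if p.2 then b else a)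

/-- Three diagrams stacked on top of each other. -/
def stackThree (R R' R'' : Setoid (X × Bool)) : Setoid (X × Fin 4) :=
  Relation.EqvGen.setoid fun p q =>
    place R (rows 2 3) p q ∨ place R' (rows 1 2) p q ∨ place R'' (rows 0 1) p q

lemma eqvGen_place {V : Type} {g : X × Fin 3 → V} (hg : Function.Injective g)
    (R R' : Setoid (X × Bool)) (p q : V) :
    Relation.EqvGen (fun p q => place R (g ∘ upper) p q ∨ place R' (g ∘ lower) p q) p q ↔
      p = q ∨ place (stack R R') g p q := by
  constructor
  · intro h
    induction h with
    | rel p q h =>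
      right
      rcases h with ⟨x, y, h, rfl, rfl⟩ | ⟨x, y, h, rfl, rfl⟩
      · exact ⟨_, _, Relation.EqvGen.rel _ _ (Or.inl ⟨x, y, h, rfl, rfl⟩), rfl, rfl⟩
      · exact ⟨_, _, Relation.EqvGen.rel _ _ (Or.inr ⟨x, y, h, rfl, rfl⟩), rfl, rfl⟩
    | refl p => exact Or.inl rfl
    | symm p q _ ih =>
      rcases ih with rfl | ⟨x, y, h, rfl, rfl⟩
      · exact Or.inl rfl
      · exact Or.inr ⟨y, x, (stack R R').symm' h, rfl, rfl⟩
    | trans p q r _ _ ih1 ih2 =>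
      rcases ih1 with rfl | ⟨x, y, h, rfl, rfl⟩
      · exact ih2
      · rcases ih2 with rfl | ⟨x', y', h', hx, rfl⟩
        · exact Or.inr ⟨x, y, h, rfl, rfl⟩
        · exact Or.inr ⟨x, y', (stack R R').trans' h (hg hx ▸ h'), rfl, rfl⟩
  · rintro (rfl | ⟨x, y, h, rfl, rfl⟩)
    · exact Relation.EqvGen.refl _
    · replace h : Relation.EqvGen _ x y := h
      induction h with
      | rel p q h =>
        refine Relation.EqvGen.rel _ _ ?_
        rcases h with ⟨x, y, h, rfl, rfl⟩ | ⟨x, y, h, rfl, rfl⟩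
        · exact Or.inl ⟨x, y, h, rfl, rfl⟩
        · exact Or.inr ⟨x, y, h, rfl, rfl⟩
      | refl p => exact Relation.EqvGen.refl _
      | symm p q _ ih => exact Relation.EqvGen.symm _ _ ih
      | trans p q r _ _ ih1 ih2 => exact Relation.EqvGen.trans _ _ _ ih1 ih2

lemma eqvGen_eqvGen_or {V : Type} (P Q : V → V → Prop) (p q : V) :
    Relation.EqvGen (fun p q => P p q ∨ Q p q) p q ↔
      Relation.EqvGen (fun p q => Relation.EqvGen P p q ∨ Q p q) p q := by
  constructor
  · intro h
    exact Relation.EqvGen.mono (fun _ _ h => h.imp_left (Relation.EqvGen.rel _ _)) _ _ h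
  · intro h
    induction h with
    | rel p q h =>
      rcases h with h | h
      · exact Relation.EqvGen.mono (fun _ _ h => Or.inl h) _ _ h
      · exact Relation.EqvGen.rel _ _ (Or.inr h)
    | refl p => exact Relation.EqvGen.refl _
    | symm p q _ ih => exact Relation.EqvGen.symm _ _ ih
    | trans p q r _ _ ih1 ih2 => exact Relation.EqvGen.trans _ _ _ ih1 ih2

/-- The rows `0, 1, 3` of a strip with four rows. -/
def skipTwo (p : X × Fin 3) : X × Fin 4 := (p.1, Fin.succAbove 2 p.2)

/-- The rows `0, 2, 3` of a strip with four rows. -/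
def skipOne (p : X × Fin 3) : X × Fin 4 := (p.1, Fin.succAbove 1 p.2)

/-- The rows `1, 2, 3` of a strip with four rows. -/
def skipBottom (p : X × Fin 3) : X × Fin 4 := (p.1, p.2.succ)

/-- The rows `0, 1, 2` of a strip with four rows. -/
def skipTop (p : X × Fin 3) : X × Fin 4 := (p.1, p.2.castSucc)

lemma skipTwo_injective : Function.Injective (skipTwo (X := X)) := by
  rintro ⟨x, i⟩ ⟨y, j⟩ h
  obtain ⟨rfl, h⟩ := Prod.mk.inj h
  exact Prod.ext rfl (Fin.succAbove_right_injective h)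

lemma skipOne_injective : Function.Injective (skipOne (X := X)) := by
  rintro ⟨x, i⟩ ⟨y, j⟩ h
  obtain ⟨rfl, h⟩ := Prod.mk.inj h
  exact Prod.ext rfl (Fin.succAbove_right_injective h)

lemma skipBottom_injective : Function.Injective (skipBottom (X := X)) := by
  rintro ⟨x, i⟩ ⟨y, j⟩ h
  obtain ⟨rfl, h⟩ := Prod.mk.inj h
  exact Prod.ext rfl (Fin.succ_injective _ h)

lemma skipTop_injective : Function.Injective (skipTop (X := X)) := by
  rintro ⟨x, i⟩ ⟨y, j⟩ h
  obtain ⟨rfl, h⟩ := Prod.mk.inj h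
  exact Prod.ext rfl (Fin.castSucc_injective _ h)

lemma mem_range_skipTwo (p : X × Fin 4) : p ∈ Set.range (skipTwo (X := X)) ↔ p.2 ≠ 2 := by
  obtain ⟨x, i⟩ := p
  constructor
  · rintro ⟨⟨y, j⟩, h⟩
    rw [← h]
    exact Fin.succAbove_ne _ _
  · intro h
    obtain ⟨j, hj⟩ := Fin.exists_succAbove_eq h
    exact ⟨(x, j), Prod.ext rfl hj⟩

lemma mem_range_skipOne (p : X × Fin 4) : p ∈ Set.range (skipOne (X := X)) ↔ p.2 ≠ 1 := by
  obtain ⟨x, i⟩ := p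
  constructor
  · rintro ⟨⟨y, j⟩, h⟩
    rw [← h]
    exact Fin.succAbove_ne _ _
  · intro h
    obtain ⟨j, hj⟩ := Fin.exists_succAbove_eq h
    exact ⟨(x, j), Prod.ext rfl hj⟩

lemma skipBottom_upper : (skipBottom ∘ upper : X × Bool → _) = rows 2 3 := by
  funext ⟨x, b⟩; cases b <;> rfl

lemma skipBottom_lower : (skipBottom ∘ lower : X × Bool → _) = rows 1 2 := by
  funext ⟨x, b⟩; cases b <;> rfl

lemma skipTop_upper : (skipTop ∘ upper : X × Bool → _) = rows 1 2 := by
  funext ⟨x, b⟩; cases b <;> rfl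

lemma skipTop_lower : (skipTop ∘ lower : X × Bool → _) = rows 0 1 := by
  funext ⟨x, b⟩; cases b <;> rfl

/-- The stack of `R` on `R'` in the rows `1, 2, 3`. -/
def upperPart (R R' : Setoid (X × Bool)) : Setoid (X × Fin 4) :=
  Relation.EqvGen.setoid fun p q => place R (rows 2 3) p q ∨ place R' (rows 1 2) p q

/-- The stack of `R'` on `R''` in the rows `0, 1, 2`. -/
def lowerPart (R' R'' : Setoid (X × Bool)) : Setoid (X × Fin 4) :=
  Relation.EqvGen.setoid fun p q => place R' (rows 1 2) p q ∨ place R'' (rows 0 1) p q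

lemma upperPart_iff (R R' : Setoid (X × Bool)) (p q : X × Fin 4) :
    upperPart R R' p q ↔ p = q ∨ place (stack R R') skipBottom p q := by
  rw [← eqvGen_place skipBottom_injective, skipBottom_upper, skipBottom_lower]
  rfl

lemma lowerPart_iff (R' R'' : Setoid (X × Bool)) (p q : X × Fin 4) :
    lowerPart R' R'' p q ↔ p = q ∨ place (stack R' R'') skipTop p q := by
  rw [← eqvGen_place skipTop_injective, skipTop_upper, skipTop_lower]
  rfl

lemma stackThree_upper (R R' R'' : Setoid (X × Bool)) (p q : X × Fin 4) :
    stackThree R R' R'' p q ↔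
      Relation.EqvGen (fun p q => upperPart R R' p q ∨ place R'' (rows 0 1) p q) p q := by
  refine Iff.trans ?_ (eqvGen_eqvGen_or _ _ p q)
  simp only [or_assoc]
  rfl

lemma stackThree_lower (R R' R'' : Setoid (X × Bool)) (p q : X × Fin 4) :
    stackThree R R' R'' p q ↔
      Relation.EqvGen (fun p q => lowerPart R' R'' p q ∨ place R (rows 2 3) p q) p q := by
  refine Iff.trans ?_ (eqvGen_eqvGen_or _ _ p q)
  have e : ∀ a b c : Prop, (a ∨ b ∨ c) ↔ ((b ∨ c) ∨ a) := by tauto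
  simp only [← e]
  rfl

lemma comap_skipTwo (R R' R'' : Setoid (X × Bool)) :
    (stackThree R R' R'').comap skipTwo = stack (comp R R') R'' := by
  ext a b
  refine (stackThree_upper _ _ _ _ _).trans (glue_iff (f := skipTwo)
    (Q := place (comp R R') upper) (Q' := place R'' lower) (upperPart R R').iseqv ?_ ?_ ?_ ?_ a b)
  · rintro x y ⟨u, v, h, rfl, rfl⟩
    refine ⟨lower u, lower v, ⟨u, v, h, rfl, rfl⟩, ?_, ?_⟩
    · rcases u with ⟨u, _ | _⟩ <;> rfl
    · rcases v with ⟨u, _ | _⟩ <;> rfl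
  · rintro _ _ ⟨u, v, h, rfl, rfl⟩
    refine ⟨u, v, h, ?_, ?_⟩
    · rcases u with ⟨u, _ | _⟩ <;> rfl
    · rcases v with ⟨u, _ | _⟩ <;> rfl
  · intro a b h
    rcases (upperPart_iff _ _ _ _).1 h with h | ⟨u, v, h, hu, hv⟩
    · rw [skipTwo_injective h]
      exact Relation.EqvGen.refl _
    · clear * - h hu hv
      have aux : ∀ (u a : X × Fin 3), skipBottom u = skipTwo a →
          ∃ w : X × Bool, outer w = u ∧ upper w = a := by
        rintro ⟨x, i⟩ ⟨y, j⟩ h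
        obtain ⟨h1, h2⟩ := Prod.mk.inj h
        have h1 : x = y := h1
        have h2 : Fin.succ i = Fin.succAbove 2 j := h2
        subst h1
        have key : ∀ i j : Fin 3, Fin.succ i = Fin.succAbove 2 j →
            (i = 0 ∧ j = 1) ∨ (i = 2 ∧ j = 2) := by decide
        rcases key i j h2 with ⟨rfl, rfl⟩ | ⟨rfl, rfl⟩
        · exact ⟨(x, false), rfl, rfl⟩
        · exact ⟨(x, true), rfl, rfl⟩
      obtain ⟨w, rfl, rfl⟩ := aux u a hu
      obtain ⟨z, rfl, rfl⟩ := aux v b hv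
      exact Relation.EqvGen.rel _ _ ⟨w, z, h, rfl, rfl⟩
  · rintro _ _ ⟨u, v, h, rfl, rfl⟩
    refine (upperPart_iff _ _ _ _).2 (Or.inr ⟨outer u, outer v, h, ?_, ?_⟩)
    · rcases u with ⟨u, _ | _⟩ <;> rfl
    · rcases v with ⟨u, _ | _⟩ <;> rfl

lemma comap_skipOne (R R' R'' : Setoid (X × Bool)) :
    (stackThree R R' R'').comap skipOne = stack R (comp R' R'') := by
  ext a b
  refine ((stackThree_lower _ _ _ _ _).trans (glue_iff (f := skipOne)
    (Q := place (comp R' R'') lower) (Q' := place R upper)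
    (lowerPart R' R'').iseqv ?_ ?_ ?_ ?_ a b)).trans ?_
  · rintro x y ⟨u, v, h, rfl, rfl⟩
    refine ⟨upper u, upper v, ⟨u, v, h, rfl, rfl⟩, ?_, ?_⟩
    · rcases u with ⟨u, _ | _⟩ <;> rfl
    · rcases v with ⟨u, _ | _⟩ <;> rfl
  · rintro _ _ ⟨u, v, h, rfl, rfl⟩
    refine ⟨u, v, h, ?_, ?_⟩
    · rcases u with ⟨u, _ | _⟩ <;> rfl
    · rcases v with ⟨u, _ | _⟩ <;> rfl
  · intro a b h
    rcases (lowerPart_iff _ _ _ _).1 h with h | ⟨u, v, h, hu, hv⟩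
    · rw [skipOne_injective h]
      exact Relation.EqvGen.refl _
    · clear * - h hu hv
      have aux : ∀ (u a : X × Fin 3), skipTop u = skipOne a →
          ∃ w : X × Bool, outer w = u ∧ lower w = a := by
        rintro ⟨x, i⟩ ⟨y, j⟩ h
        obtain ⟨h1, h2⟩ := Prod.mk.inj h
        have h1 : x = y := h1
        have h2 : Fin.castSucc i = Fin.succAbove 1 j := h2
        subst h1
        have key : ∀ i j : Fin 3, Fin.castSucc i = Fin.succAbove 1 j →
            (i = 0 ∧ j = 0) ∨ (i = 2 ∧ j = 1) := by decide
        rcases key i j h2 with ⟨rfl, rfl⟩ | ⟨rfl, rfl⟩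
        · exact ⟨(x, false), rfl, rfl⟩
        · exact ⟨(x, true), rfl, rfl⟩
      obtain ⟨w, rfl, rfl⟩ := aux u a hu
      obtain ⟨z, rfl, rfl⟩ := aux v b hv
      exact Relation.EqvGen.rel _ _ ⟨w, z, h, rfl, rfl⟩
  · rintro _ _ ⟨u, v, h, rfl, rfl⟩
    refine (lowerPart_iff _ _ _ _).2 (Or.inr ⟨outer u, outer v, h, ?_, ?_⟩)
    · rcases u with ⟨u, _ | _⟩ <;> rfl
    · rcases v with ⟨u, _ | _⟩ <;> rfl
  · rw [show (fun p q => place (comp R' R'') lower p q ∨ place R upper p q) =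
      fun p q => place R upper p q ∨ place (comp R' R'') lower p q from
        funext fun p => funext fun q => propext or_comm]
    rfl

lemma comp_assoc (R R' R'' : Setoid (X × Bool)) :
    comp (comp R R') R'' = comp R (comp R' R'') := by
  have e : (skipTwo ∘ outer : X × Bool → _) = skipOne ∘ outer := by
    funext ⟨x, b⟩; cases b <;> rfl
  calc comp (comp R R') R'' = ((stackThree R R' R'').comap skipTwo).comap outer := by
        rw [comap_skipTwo]; rfl
    _ = (stackThree R R' R'').comap (skipTwo ∘ outer) := rfl
    _ = ((stackThree R R' R'').comap skipOne).comap outer := by rw [e]; rfl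
    _ = comp R (comp R' R'') := by rw [comap_skipOne]; rfl

lemma closedComponents_eq (R R' : Setoid (X × Bool)) :
    closedComponents R R' = avoiding (stack R R') {p | p.2 ≠ 1} := by
  ext c
  simp [closedComponents, avoiding]

lemma encard_upper (R R' R'' : Setoid (X × Bool)) :
    (avoiding (stackThree R R' R'') {p | p.2 = 0 ∨ p.2 = 3}).encard =
      (closedComponents R R').encard + (closedComponents (comp R R') R'').encard := by
  rw [encard_avoiding_split skipTwo, comap_skipTwo, closedComponents_eq, closedComponents_eq,
    avoiding_glue (upperPart R R') _ _ _ (stackThree_upper _ _ _),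
    encard_avoiding_image skipBottom_injective _ _ (upperPart_iff _ _)]
  · congr 3
    · ext ⟨x, i⟩
      simp only [Set.mem_preimage, mem_range_skipTwo, skipBottom, Set.mem_ofPred_eq]
      fin_cases i <;> decide
    · ext ⟨x, i⟩
      simp only [Set.mem_preimage, skipTwo, Set.mem_ofPred_eq]
      fin_cases i <;> decide
  · rintro ⟨x, i⟩ h
    rw [mem_range_skipTwo, not_not] at h
    exact ⟨(x, 1), Prod.ext rfl h.symm⟩
  · rintro _ _ ⟨⟨u, b⟩, ⟨v, c⟩, h, rfl, rfl⟩
    simp only [mem_range_skipTwo, rows]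
    cases b <;> cases c <;> simp
  · rintro ⟨x, i⟩ h
    rw [mem_range_skipTwo]
    rintro rfl
    simp at h

lemma encard_lower (R R' R'' : Setoid (X × Bool)) :
    (avoiding (stackThree R R' R'') {p | p.2 = 0 ∨ p.2 = 3}).encard =
      (closedComponents R' R'').encard + (closedComponents R (comp R' R'')).encard := by
  rw [encard_avoiding_split skipOne, comap_skipOne, closedComponents_eq, closedComponents_eq,
    avoiding_glue (lowerPart R' R'') _ _ _ (stackThree_lower _ _ _),
    encard_avoiding_image skipTop_injective _ _ (lowerPart_iff _ _)]
  · congr 3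
    · ext ⟨x, i⟩
      simp only [Set.mem_preimage, mem_range_skipOne, skipTop, Set.mem_ofPred_eq]
      fin_cases i <;> decide
    · ext ⟨x, i⟩
      simp only [Set.mem_preimage, skipOne, Set.mem_ofPred_eq]
      fin_cases i <;> decide
  · rintro ⟨x, i⟩ h
    rw [mem_range_skipOne, not_not] at h
    exact ⟨(x, 1), Prod.ext rfl h.symm⟩
  · rintro _ _ ⟨⟨u, b⟩, ⟨v, c⟩, h, rfl, rfl⟩
    simp only [mem_range_skipOne, rows]
    cases b <;> cases c <;> simp
  · rintro ⟨x, i⟩ h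
    rw [mem_range_skipOne]
    rintro rfl
    simp at h

lemma encard_closedComponents_assoc (R R' R'' : Setoid (X × Bool)) :
    (closedComponents R R').encard + (closedComponents (comp R R') R'').encard =
      (closedComponents R' R'').encard + (closedComponents R (comp R' R'')).encard := by
  rw [← encard_upper, encard_lower]

/-- The identity diagram: every vertex is joined to the one above it. -/
def idPart : Setoid (X × Bool) := Setoid.ker Prod.fst

lemma id_comp (R : Setoid (X × Bool)) : comp idPart R = R := by
  have key : ∀ p q : X × Fin 3, stack idPart R p q →
      R (p.1, decide (p.2 ≠ 0)) (q.1, decide (q.2 ≠ 0)) := by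
    intro p q h
    replace h : Relation.EqvGen _ p q := h
    induction h with
    | rel p q h =>
      rcases h with ⟨⟨x, b⟩, ⟨y, c⟩, h, rfl, rfl⟩ | ⟨⟨x, b⟩, ⟨y, c⟩, h, rfl, rfl⟩
      · have h : x = y := h
        subst h
        cases b <;> cases c <;> exact R.refl' _
      · cases b <;> cases c <;> exact h
    | refl p => exact R.refl' _
    | symm p q _ ih => exact R.symm' ih
    | trans p q r _ _ ih1 ih2 => exact R.trans' ih1 ih2
  have up : ∀ (x : X) (b : Bool), stack idPart R (outer (x, b)) (lower (x, b)) := by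
    intro x b
    cases b
    · exact Relation.EqvGen.refl _
    · exact Relation.EqvGen.rel _ _ (Or.inl ⟨(x, true), (x, false), rfl, rfl, rfl⟩)
  ext ⟨x, b⟩ ⟨y, c⟩
  constructor
  · intro h
    have := key _ _ h
    cases b <;> cases c <;> exact this
  · intro h
    exact Setoid.trans' (stack _ _) (up x b) (Setoid.trans' _
      (Relation.EqvGen.rel _ _ (Or.inr ⟨_, _, h, rfl, rfl⟩)) (Setoid.symm' _ (up y c)))

lemma comp_id (R : Setoid (X × Bool)) : comp R idPart = R := by
  have key : ∀ p q : X × Fin 3, stack R idPart p q →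
      R (p.1, decide (p.2 = 2)) (q.1, decide (q.2 = 2)) := by
    intro p q h
    replace h : Relation.EqvGen _ p q := h
    induction h with
    | rel p q h =>
      rcases h with ⟨⟨x, b⟩, ⟨y, c⟩, h, rfl, rfl⟩ | ⟨⟨x, b⟩, ⟨y, c⟩, h, rfl, rfl⟩
      · cases b <;> cases c <;> exact h
      · have h : x = y := h
        subst h
        cases b <;> cases c <;> exact R.refl' _
    | refl p => exact R.refl' _
    | symm p q _ ih => exact R.symm' ih
    | trans p q r _ _ ih1 ih2 => exact R.trans' ih1 ih2
  have up : ∀ (x : X) (b : Bool), stack R idPart (outer (x, b)) (upper (x, b)) := by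
    intro x b
    cases b
    · exact Relation.EqvGen.rel _ _ (Or.inr ⟨(x, false), (x, true), rfl, rfl, rfl⟩)
    · exact Relation.EqvGen.refl _
  ext ⟨x, b⟩ ⟨y, c⟩
  constructor
  · intro h
    have := key _ _ h
    cases b <;> cases c <;> exact this
  · intro h
    exact Setoid.trans' (stack _ _) (up x b) (Setoid.trans' _
      (Relation.EqvGen.rel _ _ (Or.inl ⟨_, _, h, rfl, rfl⟩)) (Setoid.symm' _ (up y c)))

lemma closedComponents_id_left (R R' : Setoid (X × Bool)) (h : idPart ≤ R) :
    closedComponents R R' = ∅ := by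
  rw [Set.eq_empty_iff_forall_notMem]
  rintro _ ⟨⟨⟨x, i⟩, rfl⟩, hc⟩
  have h1 : i = 1 := hc (x, i) (Setoid.refl' (stack R R') _)
  subst h1
  have h2 : stack R R' (upper (x, true)) (upper (x, false)) :=
    Relation.EqvGen.rel _ _ (Or.inl ⟨(x, true), (x, false), h rfl, rfl, rfl⟩)
  have h3 : (2 : Fin 3) = 1 := hc (x, 2) h2
  exact absurd h3 (by decide)

lemma closedComponents_id_right (R R' : Setoid (X × Bool)) (h : idPart ≤ R') :
    closedComponents R R' = ∅ := by
  rw [Set.eq_empty_iff_forall_notMem]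
  rintro _ ⟨⟨⟨x, i⟩, rfl⟩, hc⟩
  have h1 : i = 1 := hc (x, i) (Setoid.refl' (stack R R') _)
  subst h1
  have h2 : stack R R' (lower (x, false)) (lower (x, true)) :=
    Relation.EqvGen.rel _ _ (Or.inr ⟨(x, false), (x, true), h rfl, rfl, rfl⟩)
  have h3 : (0 : Fin 3) = 1 := hc (x, 0) h2
  exact absurd h3 (by decide)

end Stack

/-! ## Affine partition diagrams -/

section Diagrams

/-- Horizontal translation by `n`. -/
def translate {R : Type} (n : ℤ) (p : ℤ × R) : ℤ × R := (p.1 + n, p.2)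

/-- A reduced affine partition `m`-diagram, i.e. one without non-contractible loops: a set partition
of the vertices `ℤ × {0, 1}` of the infinite strip (`false` is the bottom and `true` the top row)
which is invariant under left and right translation by `m`. -/
@[ext]
structure Diagram (m : ℕ) where
  part : Setoid (ℤ × Bool)
  invariant : ∀ p q, part (translate m p) (translate m q) ↔ part p q

variable {m : ℕ}

lemma translate_translate {R : Type} (a b : ℤ) (p : ℤ × R) :
    translate a (translate b p) = translate (b + a) p := by
  simp [translate, add_assoc]

lemma translate_zero {R : Type} (p : ℤ × R) : translate 0 p = p := by
  simp [translate]

lemma translate_iff {R : Type} {S : ℤ × R → ℤ × R → Prop}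
    (h : ∀ p q, S (translate m p) (translate m q) ↔ S p q) (n : ℤ) (p q : ℤ × R) :
    S (translate (n * m) p) (translate (n * m) q) ↔ S p q := by
  have key : ∀ (k : ℕ) (p q : ℤ × R),
      S (translate (k * m) p) (translate (k * m) q) ↔ S p q := by
    intro k
    induction k with
    | zero => intro p q; simp [translate_zero]
    | succ k ih =>
      intro p q
      rw [← ih p q, ← h (translate (k * m) p) (translate (k * m) q), translate_translate,
        translate_translate]
      push_cast
      rw [add_mul, one_mul]
  obtain ⟨k, rfl | rfl⟩ := n.eq_nat_or_neg
  · exact key k p q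
  · rw [← key k, translate_translate, translate_translate]
    simp [translate_zero]

/-- The partition which a diagram induces on the cylinder, where a vertex is identified with all its
translates. -/
def Diagram.onCylinder (D : Diagram m) : Setoid (ℤ × Bool) where
  r p q := ∃ n : ℤ, D.part p (translate (n * m) q)
  iseqv :=
    { refl := fun p => ⟨0, by simp [translate_zero]⟩
      symm := by
        rintro p q ⟨n, h⟩
        refine ⟨-n, D.part.symm' ?_⟩
        rw [← translate_iff D.invariant n, translate_translate]
        simpa [translate_zero] using h
      trans := by
        rintro p q r ⟨n, h⟩ ⟨k, h'⟩
        refine ⟨k + n, D.part.trans' h ?_⟩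
        rw [← translate_iff D.invariant n, translate_translate] at h'
        rwa [add_mul] }

lemma translate_place {f : ℤ × Bool → ℤ × Fin 3} (hf : ∀ n p, f (translate n p) = translate n (f p))
    {R : ℤ × Bool → ℤ × Bool → Prop} (n : ℤ)
    (hR : ∀ p q, R p q → R (translate n p) (translate n q)) {p q : ℤ × Fin 3} (h : place R f p q) :
    place R f (translate n p) (translate n q) := by
  obtain ⟨x, y, h, rfl, rfl⟩ := h
  exact ⟨_, _, hR _ _ h, hf _ _, hf _ _⟩

lemma stack_translate (D D' : Diagram m) (n : ℤ) (p q : ℤ × Fin 3)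
    (h : stack D.part D'.part p q) :
    stack D.part D'.part (translate (n * m) p) (translate (n * m) q) := by
  replace h : Relation.EqvGen _ p q := h
  induction h with
  | rel p q h =>
    refine Relation.EqvGen.rel _ _ (h.imp ?_ ?_)
    · exact translate_place (fun _ _ => rfl) _ fun p q h => (translate_iff D.invariant n p q).2 h
    · exact translate_place (fun _ _ => rfl) _ fun p q h => (translate_iff D'.invariant n p q).2 h
  | refl p => exact Setoid.refl' _ _
  | symm p q _ ih => exact Setoid.symm' _ ih
  | trans p q r _ _ ih1 ih2 => exact Setoid.trans' _ ih1 ih2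

/-- The diagram obtained by stacking `D` on top of `D'` and removing all closed components. -/
def Diagram.comp (D D' : Diagram m) : Diagram m where
  part := AffineDiagram.comp D.part D'.part
  invariant p q := by
    constructor
    · intro h
      have := stack_translate D D' (-1) _ _ h
      change stack D.part D'.part (translate _ (translate _ (outer p)))
        (translate _ (translate _ (outer q))) at this
      rw [translate_translate, translate_translate] at this
      simp only [neg_mul, one_mul, add_neg_cancel, translate_zero] at this
      exact this
    · intro h
      have := stack_translate D D' 1 _ _ h
      rw [one_mul] at this
      exact this

/-- The number of components removed when `D` is stacked on top of `D'`: the closed components on the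
cylinder, contractible or not. -/
noncomputable def Diagram.loops (D D' : Diagram m) : ℕ :=
  (closedComponents D.onCylinder D'.onCylinder).ncard

/-- The identity diagram. -/
def Diagram.id (m : ℕ) : Diagram m where
  part := idPart
  invariant p q := by
    change p.1 + _ = q.1 + _ ↔ p.1 = q.1
    exact add_left_inj _

lemma Diagram.comp_assoc (D D' D'' : Diagram m) :
    (D.comp D').comp D'' = D.comp (D'.comp D'') :=
  Diagram.ext (AffineDiagram.comp_assoc _ _ _)

lemma Diagram.id_comp (D : Diagram m) : (Diagram.id m).comp D = D :=
  Diagram.ext (AffineDiagram.id_comp _)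

lemma Diagram.comp_id (D : Diagram m) : D.comp (Diagram.id m) = D :=
  Diagram.ext (AffineDiagram.comp_id _)

lemma Diagram.part_le_onCylinder (D : Diagram m) : D.part ≤ D.onCylinder := by
  intro p q h
  exact ⟨0, by simpa [translate_zero] using h⟩

lemma Diagram.onCylinder_translate (D : Diagram m) (n : ℤ) (p : ℤ × Bool) :
    D.onCylinder (translate (n * m) p) p := ⟨n, D.part.refl' _⟩

lemma Diagram.loops_id_left (D : Diagram m) : (Diagram.id m).loops D = 0 := by
  rw [Diagram.loops, closedComponents_id_left _ _ (Diagram.part_le_onCylinder (Diagram.id m)),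
    Set.ncard_empty]

lemma Diagram.loops_id_right (D : Diagram m) : D.loops (Diagram.id m) = 0 := by
  rw [Diagram.loops, closedComponents_id_right _ _ (Diagram.part_le_onCylinder (Diagram.id m)),
    Set.ncard_empty]

lemma stack_onCylinder_translate (D D' : Diagram m) (n : ℤ) (p : ℤ × Fin 3) :
    stack D.onCylinder D'.onCylinder (translate (n * m) p) p := by
  obtain ⟨x, i⟩ := p
  have key : ∀ i : Fin 3, i = 0 ∨ i = 1 ∨ i = 2 := by decide
  rcases key i with rfl | rfl | rfl
  · exact Relation.EqvGen.rel _ _ (Or.inr ⟨_, (x, false), D'.onCylinder_translate n _, rfl, rfl⟩)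
  · exact Relation.EqvGen.rel _ _ (Or.inr ⟨_, (x, true), D'.onCylinder_translate n _, rfl, rfl⟩)
  · exact Relation.EqvGen.rel _ _ (Or.inl ⟨_, (x, true), D.onCylinder_translate n _, rfl, rfl⟩)

lemma stack_onCylinder (D D' : Diagram m) (p q : ℤ × Fin 3) :
    stack D.onCylinder D'.onCylinder p q ↔
      ∃ n : ℤ, stack D.part D'.part p (translate (n * m) q) := by
  constructor
  · intro h
    replace h : Relation.EqvGen _ p q := h
    induction h with
    | rel p q h =>
      rcases h with ⟨x, y, ⟨n, h⟩, rfl, rfl⟩ | ⟨x, y, ⟨n, h⟩, rfl, rfl⟩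
      · exact ⟨n, Relation.EqvGen.rel _ _ (Or.inl ⟨x, _, h, rfl, rfl⟩)⟩
      · exact ⟨n, Relation.EqvGen.rel _ _ (Or.inr ⟨x, _, h, rfl, rfl⟩)⟩
    | refl p => exact ⟨0, by simp [translate_zero]⟩
    | symm p q _ ih =>
      obtain ⟨n, h⟩ := ih
      refine ⟨-n, ?_⟩
      have := stack_translate D D' (-n) _ _ (Setoid.symm' _ h)
      rw [translate_translate] at this
      simpa [translate_zero] using this
    | trans p q r _ _ ih1 ih2 =>
      obtain ⟨n, h⟩ := ih1
      obtain ⟨k, h'⟩ := ih2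
      refine ⟨k + n, Setoid.trans' _ h ?_⟩
      have := stack_translate D D' n _ _ h'
      rwa [translate_translate, ← add_mul] at this
  · rintro ⟨n, h⟩
    refine Setoid.trans' _ ?_ (stack_onCylinder_translate D D' n q)
    refine Relation.EqvGen.mono (fun a b h => h.imp ?_ ?_) _ _ h
    · rintro ⟨x, y, h, hx, hy⟩
      exact ⟨x, y, D.part_le_onCylinder h, hx, hy⟩
    · rintro ⟨x, y, h, hx, hy⟩
      exact ⟨x, y, D'.part_le_onCylinder h, hx, hy⟩

lemma Diagram.onCylinder_comp (D D' : Diagram m) :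
    (D.comp D').onCylinder = AffineDiagram.comp D.onCylinder D'.onCylinder := by
  ext p q
  exact (stack_onCylinder D D' (outer p) (outer q)).symm

lemma Diagram.finite_closedComponents [NeZero m] (D D' : Diagram m) :
    (closedComponents D.onCylinder D'.onCylinder).Finite := by
  have hm : (0 : ℤ) < m := by exact_mod_cast Nat.pos_of_ne_zero (NeZero.ne m)
  refine (Set.finite_range fun i : Fin m =>
    {x | stack D.onCylinder D'.onCylinder x ((i : ℤ), 1)}).subset ?_
  rintro _ ⟨⟨⟨x, r⟩, rfl⟩, hc⟩
  have h1 : r = 1 := hc (x, r) (Setoid.refl' (stack D.onCylinder D'.onCylinder) _)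
  subst h1
  have hlt := Int.emod_lt_of_pos x hm
  have hnn := Int.emod_nonneg x hm.ne'
  refine ⟨⟨(x % m).toNat, by omega⟩, ?_⟩
  have h2 := stack_onCylinder_translate D D' (x / m) (x % m, 1)
  have h3 : translate (x / m * m) (x % m, (1 : Fin 3)) = (x, 1) := by
    simp [translate, Int.emod_add_ediv_mul]
  rw [h3] at h2
  ext y
  simp only [Int.toNat_of_nonneg hnn]
  exact ⟨fun h => Setoid.trans' _ h (Setoid.symm' _ h2), fun h => Setoid.trans' _ h h2⟩

lemma Diagram.loops_assoc [NeZero m] (D D' D'' : Diagram m) :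
    D.loops D' + (D.comp D').loops D'' = D'.loops D'' + D.loops (D'.comp D'') := by
  have h := encard_closedComponents_assoc D.onCylinder D'.onCylinder D''.onCylinder
  rw [← Diagram.onCylinder_comp, ← Diagram.onCylinder_comp,
    ← (Diagram.finite_closedComponents D D').cast_ncard_eq,
    ← (Diagram.finite_closedComponents (D.comp D') D'').cast_ncard_eq,
    ← (Diagram.finite_closedComponents D' D'').cast_ncard_eq,
    ← (Diagram.finite_closedComponents D (D'.comp D'')).cast_ncard_eq] at h
  exact_mod_cast h

end Diagrams

/-! ## The reduced affine partition and Brauer algebras -/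

section Algebras

/-- The reduced affine partition algebra, where closed components and non-contractible loops are both
removed with the factor `β`: the free module on the diagrams. -/
def PartitionAlgebra (k : Type*) [CommRing k] (m : ℕ) (_β : k) : Type _ := Diagram m →₀ k

variable {k : Type*} [CommRing k] {m : ℕ} {β : k}

noncomputable instance : AddCommGroup (PartitionAlgebra k m β) :=
  inferInstanceAs (AddCommGroup (Diagram m →₀ k))

noncomputable instance : Module k (PartitionAlgebra k m β) :=
  inferInstanceAs (Module k (Diagram m →₀ k))

/-- A diagram as a basis element of the algebra. -/
noncomputable def ofDiagram (β : k) (D : Diagram m) : PartitionAlgebra k m β := Finsupp.single D 1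

/-- The linear extension of a function on diagrams. -/
noncomputable def extend (β : k) {M : Type*} [AddCommGroup M] [Module k M] (f : Diagram m → M) :
    PartitionAlgebra k m β →ₗ[k] M :=
  Finsupp.lift M k (Diagram m) f

lemma extend_ofDiagram {M : Type*} [AddCommGroup M] [Module k M] (f : Diagram m → M)
    (D : Diagram m) : extend β f (ofDiagram β D) = f D := by
  change (Finsupp.lift M k (Diagram m) f) (Finsupp.single D 1) = f D
  simp

/-- The multiplication `D * D' = β ^ loops D D' • (D stacked on D')`, as a bilinear map. -/
noncomputable def mulMap (β : k) :
    PartitionAlgebra k m β →ₗ[k] PartitionAlgebra k m β →ₗ[k] PartitionAlgebra k m β :=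
  extend β fun D => extend β fun D' => β ^ D.loops D' • ofDiagram β (D.comp D')

lemma mulMap_ofDiagram (D D' : Diagram m) :
    mulMap β (ofDiagram β D) (ofDiagram β D') = β ^ D.loops D' • ofDiagram β (D.comp D') := by
  rw [mulMap, extend_ofDiagram, extend_ofDiagram]

lemma hom_ext {M : Type*} [AddCommGroup M] [Module k M] {f g : PartitionAlgebra k m β →ₗ[k] M}
    (h : ∀ D, f (ofDiagram β D) = g (ofDiagram β D)) : f = g :=
  Finsupp.lhom_ext' fun D => LinearMap.ext_ring (h D)

lemma mulMap_assoc [NeZero m] (x y z : PartitionAlgebra k m β) :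
    mulMap β (mulMap β x y) z = mulMap β x (mulMap β y z) := by
  have hz : ∀ D D' (z : PartitionAlgebra k m β),
      mulMap β (mulMap β (ofDiagram β D) (ofDiagram β D')) z =
        mulMap β (ofDiagram β D) (mulMap β (ofDiagram β D') z) := by
    intro D D' z
    refine LinearMap.congr_fun (f := mulMap β (mulMap β (ofDiagram β D) (ofDiagram β D')))
      (g := (mulMap β (ofDiagram β D)).comp (mulMap β (ofDiagram β D'))) (hom_ext fun D'' => ?_) z
    simp only [LinearMap.comp_apply, mulMap_ofDiagram, map_smul, LinearMap.smul_apply, smul_smul,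
      ← pow_add, Diagram.comp_assoc, Diagram.loops_assoc]
  have hy : ∀ D (y z : PartitionAlgebra k m β),
      mulMap β (mulMap β (ofDiagram β D) y) z = mulMap β (ofDiagram β D) (mulMap β y z) := by
    intro D y z
    refine LinearMap.congr_fun (f := ((mulMap β).flip z).comp (mulMap β (ofDiagram β D)))
      (g := (mulMap β (ofDiagram β D)).comp ((mulMap β).flip z)) (hom_ext fun D' => ?_) y
    exact hz D D' z
  refine LinearMap.congr_fun (f := ((mulMap β).flip z).comp ((mulMap β).flip y))
    (g := (mulMap β).flip (mulMap β y z)) (hom_ext fun D => ?_) x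
  exact hy D y z

lemma mulMap_id_left (x : PartitionAlgebra k m β) :
    mulMap β (ofDiagram β (Diagram.id m)) x = x := by
  refine LinearMap.congr_fun (g := LinearMap.id) (hom_ext fun D => ?_) x
  simp [mulMap_ofDiagram, Diagram.id_comp, Diagram.loops_id_left]

lemma mulMap_id_right (x : PartitionAlgebra k m β) :
    mulMap β x (ofDiagram β (Diagram.id m)) = x := by
  refine LinearMap.congr_fun (f := (mulMap β).flip (ofDiagram β (Diagram.id m)))
    (g := LinearMap.id) (hom_ext fun D => ?_) x
  simp [mulMap_ofDiagram, Diagram.comp_id, Diagram.loops_id_right]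

noncomputable instance [NeZero m] : Ring (PartitionAlgebra k m β) :=
  { (inferInstance : AddCommGroup (PartitionAlgebra k m β)) with
    mul := fun x y => mulMap β x y
    one := ofDiagram β (Diagram.id m)
    left_distrib := fun x y z => map_add (mulMap β x) y z
    right_distrib := fun x y z => LinearMap.map_add₂ (mulMap β) x y z
    zero_mul := fun x => LinearMap.map_zero₂ (mulMap β) x
    mul_zero := fun x => map_zero (mulMap β x)
    mul_assoc := mulMap_assoc
    one_mul := mulMap_id_left
    mul_one := mulMap_id_right }

noncomputable instance [NeZero m] : Algebra k (PartitionAlgebra k m β) :=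
  Algebra.ofModule (fun r x y => LinearMap.map_smul₂ (mulMap β) r x y)
    (fun r x y => map_smul (mulMap β x) r y)

lemma ofDiagram_mul_ofDiagram [NeZero m] (D D' : Diagram m) :
    ofDiagram β D * ofDiagram β D' = β ^ D.loops D' • ofDiagram β (D.comp D') :=
  mulMap_ofDiagram D D'

/-- All components have size two. -/
def Diagram.IsBrauer (D : Diagram m) : Prop := ∀ p, {q | D.part q p}.ncard = 2

variable (k m β) in
/-- The reduced affine Brauer algebra: the subalgebra generated by the diagrams all of whose
components have size two. -/
noncomputable def brauerAlgebra [NeZero m] : Subalgebra k (PartitionAlgebra k m β) :=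
  Algebra.adjoin k {x | ∃ D : Diagram m, D.IsBrauer ∧ x = ofDiagram β D}

end Algebras

/-! ## Generating diagrams and the presentation

The strands are numbered by `Fin m`; strand `i` consists of the vertices congruent to `i` modulo `m`.
The index of `s` and `e` runs over `Fin (m - 1)`, and `i : Fin (m - 1)` refers to the neighbouring
strands `lo i` and `hi i`. -/

section Presentation

variable {m : ℕ}

/-- The strand `i`. -/
def lo (i : Fin (m - 1)) : Fin m := ⟨i, by omega⟩

/-- The strand `i + 1`. -/
def hi (i : Fin (m - 1)) : Fin m := ⟨i + 1, by omega⟩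

/-- The diagram of a translation invariant bijection `f` of the integers: the bottom vertex `x` is
joined to the top vertex `f x`. -/
def strands (f : ℤ → ℤ) (hf : ∀ x, f (x + m) = f x + m) : Diagram m where
  part := Setoid.ker fun p : ℤ × Bool => if p.2 then p.1 else f p.1
  invariant := by
    rintro ⟨x, _ | _⟩ ⟨y, _ | _⟩ <;> simp [translate, Setoid.ker_def, hf]

/-- The crossing of the strands `lo i` and `hi i`. -/
def crossing (i : Fin (m - 1)) : Diagram m :=
  strands (fun x => if x % m = i then x + 1 else if x % m = i + 1 then x - 1 else x) (by
    intro x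
    simp only [Int.add_emod_right]
    split_ifs <;> ring)

/-- The diagram with a cup and a cap joining the strands `lo i` and `hi i`, and vertical lines
elsewhere. -/
def cupCap (i : Fin (m - 1)) : Diagram m where
  part := Setoid.ker fun p : ℤ × Bool =>
    if p.1 % m = i then (p.1, some p.2)
    else if p.1 % m = i + 1 then (p.1 - 1, some p.2)
    else (p.1, none)
  invariant := by
    rintro ⟨x, b⟩ ⟨y, c⟩
    simp only [translate, Setoid.ker_def, Int.add_emod_right]
    split_ifs <;> simp only [Prod.mk.injEq] <;> refine and_congr_left fun _ => ?_ <;> omega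

/-- The identity diagram except that the strand `i` winds `a` times. -/
def winding (a : ℤ) (i : Fin m) : Diagram m :=
  strands (fun x => if x % m = i then x + a * m else x) (by
    intro x
    simp only [Int.add_emod_right]
    split_ifs <;> ring)

/-- The `a`-th power of the global twist: the bottom vertex `x` is joined to the top vertex
`x + a`. -/
def twist (m : ℕ) (a : ℤ) : Diagram m := strands (fun x => x + a) (by intro x; ring)

/-- The generators: `τ`, `τ⁻¹`, `e i`, `s i`, `t i` and `(t i)⁻¹`. -/
inductive Gen (m : ℕ) : Type
  | tau : Gen m
  | tauInv : Gen m
  | e (i : Fin (m - 1)) : Gen m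
  | s (i : Fin (m - 1)) : Gen m
  | t (i : Fin m) : Gen m
  | tInv (i : Fin m) : Gen m

/-- The diagram represented by a generator. -/
def Gen.diagram : Gen m → Diagram m
  | .tau => twist m 1
  | .tauInv => twist m (-1)
  | .e i => cupCap i
  | .s i => crossing i
  | .t i => winding 1 i
  | .tInv i => winding (-1) i

variable (k : Type*) [CommRing k]

/-- A generator as an element of the free algebra. -/
abbrev gen (g : Gen m) : FreeAlgebra k (Gen m) := FreeAlgebra.ι k g

/-- The element `t i ^ a` of the free algebra, for an integer `a`. -/
def tPow (i : Fin m) : ℤ → FreeAlgebra k (Gen m)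
  | .ofNat n => gen k (.t i) ^ n
  | .negSucc n => gen k (.tInv i) ^ (n + 1)

variable {k}

/-- The defining relations.  For indices in `Fin (m - 1)` the condition `i + 1 < j ∨ j + 1 < i` says
`|i - j| > 1`. -/
inductive Rel (β : k) : FreeAlgebra k (Gen m) → FreeAlgebra k (Gen m) → Prop
  -- the Brauer algebra
  | s_sq (i : Fin (m - 1)) : Rel β (gen k (.s i) * gen k (.s i)) 1
  | s_comm (i j : Fin (m - 1)) (h : (i : ℕ) + 1 < j ∨ (j : ℕ) + 1 < i) :
      Rel β (gen k (.s i) * gen k (.s j)) (gen k (.s j) * gen k (.s i))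
  | braid (i j : Fin (m - 1)) (h : (j : ℕ) = i + 1) :
      Rel β (gen k (.s i) * gen k (.s j) * gen k (.s i)) (gen k (.s j) * gen k (.s i) * gen k (.s j))
  | e_sq (i : Fin (m - 1)) : Rel β (gen k (.e i) * gen k (.e i)) (β • gen k (.e i))
  | e_e_e (i j : Fin (m - 1)) (h : (j : ℕ) = i + 1 ∨ (i : ℕ) = j + 1) :
      Rel β (gen k (.e i) * gen k (.e j) * gen k (.e i)) (gen k (.e i))
  | e_comm (i j : Fin (m - 1)) (h : (i : ℕ) + 1 < j ∨ (j : ℕ) + 1 < i) :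
      Rel β (gen k (.e i) * gen k (.e j)) (gen k (.e j) * gen k (.e i))
  | s_e_comm (i j : Fin (m - 1)) (h : (i : ℕ) + 1 < j ∨ (j : ℕ) + 1 < i) :
      Rel β (gen k (.s i) * gen k (.e j)) (gen k (.e j) * gen k (.s i))
  | s_s_e (i j : Fin (m - 1)) (h : (j : ℕ) = i + 1 ∨ (i : ℕ) = j + 1) :
      Rel β (gen k (.s i) * gen k (.s j) * gen k (.e i)) (gen k (.e j) * gen k (.e i))
  | e_s_s (i j : Fin (m - 1)) (h : (j : ℕ) = i + 1 ∨ (i : ℕ) = j + 1) :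
      Rel β (gen k (.e i) * gen k (.s j) * gen k (.s i)) (gen k (.e i) * gen k (.e j))
  | s_e (i : Fin (m - 1)) : Rel β (gen k (.s i) * gen k (.e i)) (gen k (.e i))
  | e_s (i : Fin (m - 1)) : Rel β (gen k (.e i) * gen k (.s i)) (gen k (.e i))
  -- windings and twist
  | t_inv (i : Fin m) : Rel β (gen k (.t i) * gen k (.tInv i)) 1
  | inv_t (i : Fin m) : Rel β (gen k (.tInv i) * gen k (.t i)) 1
  | tau_inv : Rel β (gen k .tau * gen k .tauInv) 1
  | inv_tau : Rel β (gen k .tauInv * gen k .tau) 1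
  | tau_eq (j : Fin m) (h : (j : ℕ) = 0) :
      Rel β (gen k .tau) (gen k (.t j) * (List.ofFn fun i : Fin (m - 1) => gen k (.s i)).prod)
  | s_t_comm (i : Fin (m - 1)) (j : Fin m) (h : (i : ℕ) + 1 < j ∨ (j : ℕ) + 1 < i) :
      Rel β (gen k (.s i) * gen k (.t j)) (gen k (.t j) * gen k (.s i))
  | e_t_comm (i : Fin (m - 1)) (j : Fin m) (h : (i : ℕ) + 1 < j ∨ (j : ℕ) + 1 < i) :
      Rel β (gen k (.e i) * gen k (.t j)) (gen k (.t j) * gen k (.e i))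
  | t_comm (i j : Fin m) : Rel β (gen k (.t i) * gen k (.t j)) (gen k (.t j) * gen k (.t i))
  | s_t (i : Fin (m - 1)) :
      Rel β (gen k (.s i) * gen k (.t (lo i))) (gen k (.t (hi i)) * gen k (.s i))
  | e_t_t (i : Fin (m - 1)) :
      Rel β (gen k (.e i) * gen k (.t (lo i)) * gen k (.t (hi i))) (gen k (.e i))
  | t_t_e (i : Fin (m - 1)) :
      Rel β (gen k (.t (lo i)) * gen k (.t (hi i)) * gen k (.e i)) (gen k (.e i))
  | e_t_e (i : Fin (m - 1)) (a : ℤ) :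
      Rel β (gen k (.e i) * tPow k (lo i) a * gen k (.e i)) (β • gen k (.e i))

/-- The algebra given by the generators and the defining relations. -/
abbrev Presented (m : ℕ) (β : k) : Type _ := RingQuot (Rel (m := m) β)

end Presentation

end AffineDiagram

/-!
Write `G` for the group of affine permutations, the bijections of `ℤ` which commute with the
translation by `m`, and call the class of `e i` a cup-cap. The proof finds a normal form in the
presented algebra and shows that it can be read off from the diagram.

*The group.* The relations which involve only the `s i` and the `t i` present `G`: every element of
the subgroup `N k` generated by the `s i` and `t i` with `k ≤ i` is the product of one of the
representatives `t (k + d) ^ a * s (k + d - 1) * ⋯ * s k` and an element of `N (k + 1)`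
(`AffineRelations.exists_of_mem_tail`), and the representative can be recovered from the image of
`k`. Applied to the graph of the homomorphism to be constructed, this gives a homomorphism `ρ` from
`G` to the units of the presented algebra (`AffineRelations.lift`), and shows that the stabilizer
of the first two strands is generated by the `s i` and `t i` which commute with the first cup-cap
`e`.

*Arcs.* Hence the conjugate of `e` by `ρ g` depends only on the pair `(g • 0, g • 1)`, and every
pair of vertices `x`, `y` in distinct classes modulo `m` has a cup-cap `arc ρ e x y`. Since `G`
acts transitively on tuples of vertices in distinct classes, the relations between arcs follow from
those between the first four strands (`CupCapRelations`).

*Normal forms.* A normal form is a product `a` of cup-caps along the arcs of an involution `w` in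
`G`, which is written `ArcProduct ρ e w a`, times some `ρ g`. Multiplying a normal form by an arc
gives a multiple of a normal form, so the normal forms span (`normalSpan_eq_top`). The element `a`
depends only on `w`, and it absorbs every `ρ u` for which `u` permutes the arcs of `w` and fixes the
other vertices (`ArcProduct.mul_map_eq`): such `u` are composed of windings along an arc,
reflections in an arc, and exchanges of two arcs.

*Diagrams.* The diagrams satisfy the relations (`genMap_rel`), and the diagram `normalDiagram w g`
of `a * ρ g` determines `w`, and `g` up to the elements `u` above (`eq_of_normalDiagram_eq`). So
distinct normal forms have distinct diagrams, and the homomorphism from the presented algebra is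
injective. Conversely every Brauer diagram is the diagram of a normal form
(`Diagram.IsBrauer.exists_eq_normalDiagram`): if it has a top arc then it also has a bottom arc,
and cutting both and joining their ends in pairs leaves a diagram with fewer arcs.
-/

namespace AffineDiagram

/-! ### Affine permutations -/

/-- The group of the bijections of the integers which commute with the translation by `m`.  It acts
on `ℤ` by evaluation. -/
def AffinePerm (m : ℕ) : Subgroup (Equiv.Perm ℤ) where
  carrier := {f | ∀ x, f (x + m) = f x + m}
  mul_mem' := fun {f g} hf hg x => by
    rw [Equiv.Perm.mul_apply, Equiv.Perm.mul_apply, hg x, hf (g x)]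
  one_mem' := fun x => rfl
  inv_mem' := fun {f} hf x => by
    rw [Equiv.Perm.inv_eq_iff_eq, hf]
    exact congrArg (· + (m : ℤ)) (f.apply_symm_apply x).symm

section AffinePerm

variable {m : ℕ}

lemma modEq_iff_exists_add_mul {x y : ℤ} : x ≡ y [ZMOD m] ↔ ∃ n : ℤ, y = x + n * m := by
  rw [Int.modEq_iff_add_fac]
  simp only [mul_comm]

lemma modEq_add_mul (x n : ℤ) : x ≡ x + n * m [ZMOD m] :=
  modEq_iff_exists_add_mul.2 ⟨n, rfl⟩

lemma add_mul_modEq (x n : ℤ) : x + n * m ≡ x [ZMOD m] := (modEq_add_mul x n).symm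

lemma modEq_iff_eq {x y : ℤ} (hx : 0 ≤ x) (hxm : x < m) (hy : 0 ≤ y) (hym : y < m) :
    x ≡ y [ZMOD m] ↔ x = y := by
  rw [Int.ModEq, Int.emod_eq_of_lt hx hxm, Int.emod_eq_of_lt hy hym]

namespace AffinePerm

@[ext]
lemma ext {g h : AffinePerm m} (H : ∀ x : ℤ, g • x = h • x) : g = h :=
  Subtype.ext (Equiv.ext H)

lemma smul_add_mul (g : AffinePerm m) (x n : ℤ) : g • (x + n * m) = g • x + n * m := by
  have key : ∀ (k : ℕ) (x : ℤ), g • (x + k * m) = g • x + k * m := by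
    intro k
    induction k with
    | zero => intro x; simp
    | succ k ih =>
      intro x
      have h : g • (x + k * m + m) = g • (x + k * m) + m := g.2 (x + k * m)
      push_cast
      rw [add_mul, one_mul, ← add_assoc, h, ih, add_assoc]
  obtain ⟨k, rfl | rfl⟩ := n.eq_nat_or_neg
  · exact key k x
  · have h := key k (x + -k * m)
    rw [neg_mul, neg_add_cancel_right] at h
    rw [neg_mul, h, add_neg_cancel_right]

lemma smul_modEq_smul (g : AffinePerm m) {x y : ℤ} :
    g • x ≡ g • y [ZMOD m] ↔ x ≡ y [ZMOD m] := by
  simp only [modEq_iff_exists_add_mul, ← smul_add_mul, smul_left_cancel_iff]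

/-- An affine permutation of finite order moves no integer within its residue class; the case of
order two. -/
lemma eq_of_smul_modEq {g : AffinePerm m} (hg : g * g = 1) {x : ℤ} (h : g • x ≡ x [ZMOD m]) :
    g • x = x := by
  obtain ⟨n, hn⟩ := modEq_iff_exists_add_mul.1 h.symm
  have h2 : g • g • x = x := by rw [smul_smul, hg, one_smul]
  rw [hn, smul_add_mul, hn] at h2
  linarith

open Classical in
/-- The underlying function of a reflection. -/
noncomputable def reflFun (m : ℕ) (x y v : ℤ) : ℤ :=
  if x ≡ y [ZMOD m] then v
  else if v ≡ x [ZMOD m] then v - x + y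
  else if v ≡ y [ZMOD m] then v - y + x
  else v

lemma reflFun_left {x y : ℤ} (h : ¬ x ≡ y [ZMOD m]) (n : ℤ) :
    reflFun m x y (x + n * m) = y + n * m := by
  rw [reflFun, if_neg h, if_pos (add_mul_modEq x n)]
  ring

lemma reflFun_right {x y : ℤ} (h : ¬ x ≡ y [ZMOD m]) (n : ℤ) :
    reflFun m x y (y + n * m) = x + n * m := by
  rw [reflFun, if_neg h, if_neg fun h' => h (h'.symm.trans (add_mul_modEq y n)),
    if_pos (add_mul_modEq y n)]
  ring

lemma reflFun_of_not {x y v : ℤ} (hx : ¬ v ≡ x [ZMOD m]) (hy : ¬ v ≡ y [ZMOD m]) :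
    reflFun m x y v = v := by
  rw [reflFun, if_neg hx, if_neg hy, ite_self]

/-- A vertex lies in the class of `x`, in the class of `y`, or in neither. -/
lemma modEq_cases (m : ℕ) (x y v : ℤ) : (∃ n : ℤ, v = x + n * m) ∨ (∃ n : ℤ, v = y + n * m) ∨
    (¬ v ≡ x [ZMOD m] ∧ ¬ v ≡ y [ZMOD m]) := by
  by_cases hx : v ≡ x [ZMOD m]
  · exact Or.inl (modEq_iff_exists_add_mul.1 hx.symm)
  · by_cases hy : v ≡ y [ZMOD m]
    · exact Or.inr (Or.inl (modEq_iff_exists_add_mul.1 hy.symm))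
    · exact Or.inr (Or.inr ⟨hx, hy⟩)

lemma reflFun_involutive (m : ℕ) (x y : ℤ) : Function.Involutive (reflFun m x y) := by
  intro v
  by_cases h : x ≡ y [ZMOD m]
  · simp [reflFun, h]
  rcases modEq_cases m x y v with ⟨n, rfl⟩ | ⟨n, rfl⟩ | ⟨hx, hy⟩
  · rw [reflFun_left h, reflFun_right h]
  · rw [reflFun_right h, reflFun_left h]
  · rw [reflFun_of_not hx hy, reflFun_of_not hx hy]

/-- The affine reflection which exchanges `x + n * m` and `y + n * m` for every integer `n`.  If `x`
and `y` are congruent modulo `m` it is the identity. -/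
noncomputable def refl (x y : ℤ) : AffinePerm m :=
  ⟨(reflFun_involutive m x y).toPerm, by
    intro v
    change reflFun m x y (v + m) = reflFun m x y v + m
    have e : ∀ z, v + m ≡ z [ZMOD m] ↔ v ≡ z [ZMOD m] := fun z => by simp [Int.ModEq]
    simp only [reflFun, e]
    split_ifs <;> ring⟩

lemma refl_smul_left_add {x y : ℤ} (h : ¬ x ≡ y [ZMOD m]) (n : ℤ) :
    (refl x y : AffinePerm m) • (x + n * m) = y + n * m := reflFun_left h n

lemma refl_smul_right_add {x y : ℤ} (h : ¬ x ≡ y [ZMOD m]) (n : ℤ) :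
    (refl x y : AffinePerm m) • (y + n * m) = x + n * m := reflFun_right h n

lemma refl_smul_left {x y : ℤ} (h : ¬ x ≡ y [ZMOD m]) : (refl x y : AffinePerm m) • x = y := by
  simpa using refl_smul_left_add h 0

lemma refl_smul_right {x y : ℤ} (h : ¬ x ≡ y [ZMOD m]) : (refl x y : AffinePerm m) • y = x := by
  simpa using refl_smul_right_add h 0

lemma refl_smul_of_not {x y v : ℤ} (hx : ¬ v ≡ x [ZMOD m]) (hy : ¬ v ≡ y [ZMOD m]) :
    (refl x y : AffinePerm m) • v = v := reflFun_of_not hx hy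

lemma refl_mul_self (x y : ℤ) : (refl x y : AffinePerm m) * refl x y = 1 :=
  ext fun v => reflFun_involutive m x y v

lemma refl_inv (x y : ℤ) : (refl x y : AffinePerm m)⁻¹ = refl x y :=
  inv_eq_of_mul_eq_one_right (refl_mul_self x y)

lemma refl_of_modEq {x y : ℤ} (h : x ≡ y [ZMOD m]) : (refl x y : AffinePerm m) = 1 :=
  ext fun _ => if_pos h

lemma mul_refl (g : AffinePerm m) (x y : ℤ) : g * refl x y = refl (g • x) (g • y) * g := by
  by_cases h : x ≡ y [ZMOD m]
  · rw [refl_of_modEq h, refl_of_modEq ((smul_modEq_smul g).2 h), mul_one, one_mul]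
  have h' := mt (smul_modEq_smul g).1 h
  ext v
  rw [mul_smul, mul_smul]
  rcases modEq_cases m x y v with ⟨n, rfl⟩ | ⟨n, rfl⟩ | ⟨hx, hy⟩
  · rw [refl_smul_left_add h, smul_add_mul, smul_add_mul, refl_smul_left_add h']
  · rw [refl_smul_right_add h, smul_add_mul, smul_add_mul, refl_smul_right_add h']
  · rw [refl_smul_of_not hx hy, refl_smul_of_not (mt (smul_modEq_smul g).1 hx)
      (mt (smul_modEq_smul g).1 hy)]

lemma refl_comm (x y : ℤ) : (refl x y : AffinePerm m) = refl y x := by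
  by_cases h : x ≡ y [ZMOD m]
  · rw [refl_of_modEq h, refl_of_modEq h.symm]
  have e := mul_refl (refl x y : AffinePerm m) x y
  rw [refl_smul_left h, refl_smul_right h, refl_mul_self] at e
  exact (inv_eq_of_mul_eq_one_left e.symm ▸ refl_inv x y).symm

lemma refl_add_mul (x y n : ℤ) :
    (refl (x + n * m) (y + n * m) : AffinePerm m) = refl x y := by
  have e : ∀ u v : ℤ, u ≡ v + n * m [ZMOD m] ↔ u ≡ v [ZMOD m] :=
    fun u v => ⟨fun h => h.trans (add_mul_modEq v n), fun h => h.trans (modEq_add_mul v n)⟩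
  have e' : x + n * m ≡ y [ZMOD m] ↔ x ≡ y [ZMOD m] :=
    ⟨fun h => (modEq_add_mul x n).trans h, fun h => (add_mul_modEq x n).trans h⟩
  ext v
  change reflFun _ _ _ _ = reflFun _ _ _ _
  simp only [reflFun, e, e']
  split_ifs <;> ring

open Classical in
/-- The affine permutation which moves the residue class of `x` by `n * m` and fixes everything
else. -/
noncomputable def shift (x n : ℤ) : AffinePerm m :=
  -- the shifts by `n` and by `-n` are inverse to each other
  have key : ∀ n v : ℤ, (if (if v ≡ x [ZMOD m] then v + n * m else v) ≡ x [ZMOD m] then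
      (if v ≡ x [ZMOD m] then v + n * m else v) + -n * m
      else (if v ≡ x [ZMOD m] then v + n * m else v)) = v := by
    intro n v
    by_cases h : v ≡ x [ZMOD m]
    · rw [if_pos h, if_pos ((add_mul_modEq v n).trans h)]
      ring
    · rw [if_neg h, if_neg h]
  ⟨{ toFun := fun v => if v ≡ x [ZMOD m] then v + n * m else v
     invFun := fun v => if v ≡ x [ZMOD m] then v + -n * m else v
     left_inv := key n
     right_inv := fun v => by simpa using key (-n) v }, by
    intro v
    have e : v + m ≡ x [ZMOD m] ↔ v ≡ x [ZMOD m] := by simp [Int.ModEq]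
    change (if v + m ≡ x [ZMOD m] then v + m + n * m else v + m) =
      (if v ≡ x [ZMOD m] then v + n * m else v) + m
    simp only [e]
    split_ifs <;> ring⟩

lemma shift_smul_of_modEq {x v : ℤ} (h : v ≡ x [ZMOD m]) (n : ℤ) :
    (shift x n : AffinePerm m) • v = v + n * m := if_pos h

lemma shift_smul_self (x n : ℤ) : (shift x n : AffinePerm m) • x = x + n * m :=
  shift_smul_of_modEq rfl n

lemma shift_smul_of_not {x v : ℤ} (h : ¬ v ≡ x [ZMOD m]) (n : ℤ) :
    (shift x n : AffinePerm m) • v = v := if_neg h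

lemma shift_congr {x y : ℤ} (h : x ≡ y [ZMOD m]) (n : ℤ) :
    (shift x n : AffinePerm m) = shift y n := by
  ext v
  by_cases hv : v ≡ x [ZMOD m]
  · rw [shift_smul_of_modEq hv, shift_smul_of_modEq (hv.trans h)]
  · rw [shift_smul_of_not hv, shift_smul_of_not fun h' => hv (h'.trans h.symm)]

lemma shift_zero (x : ℤ) : (shift x 0 : AffinePerm m) = 1 := by
  ext v
  by_cases hv : v ≡ x [ZMOD m]
  · rw [shift_smul_of_modEq hv]; simp
  · rw [shift_smul_of_not hv, one_smul]

lemma shift_add (x n k : ℤ) : (shift x (n + k) : AffinePerm m) = shift x n * shift x k := by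
  ext v
  rw [mul_smul]
  by_cases hv : v ≡ x [ZMOD m]
  · rw [shift_smul_of_modEq hv, shift_smul_of_modEq hv,
      shift_smul_of_modEq ((add_mul_modEq v k).trans hv)]
    ring
  · rw [shift_smul_of_not hv, shift_smul_of_not hv, shift_smul_of_not hv]

lemma shift_neg (x n : ℤ) : (shift x (-n) : AffinePerm m) = (shift x n)⁻¹ := by
  refine (inv_eq_of_mul_eq_one_right ?_).symm
  rw [← shift_add, add_neg_cancel, shift_zero]

lemma shift_eq_zpow (x n : ℤ) : (shift x n : AffinePerm m) = shift x 1 ^ n := by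
  induction n with
  | zero => rw [shift_zero, zpow_zero]
  | succ n ih => rw [shift_add, ih, zpow_add_one]
  | pred n ih => rw [sub_eq_add_neg, shift_add, ih, shift_neg, zpow_add, zpow_neg_one]

lemma mul_shift (g : AffinePerm m) (x n : ℤ) : g * shift x n = shift (g • x) n * g := by
  ext v
  rw [mul_smul, mul_smul]
  by_cases hv : v ≡ x [ZMOD m]
  · rw [shift_smul_of_modEq hv, shift_smul_of_modEq ((smul_modEq_smul g).2 hv), smul_add_mul]
  · rw [shift_smul_of_not hv, shift_smul_of_not (mt (smul_modEq_smul g).1 hv)]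

lemma shift_commute (x y n k : ℤ) :
    (shift x n : AffinePerm m) * shift y k = shift y k * shift x n := by
  rw [mul_shift]
  congr 1
  by_cases h : y ≡ x [ZMOD m]
  · rw [shift_smul_of_modEq h, shift_congr (add_mul_modEq y n)]
  · rw [shift_smul_of_not h]

/-- Any integer can be moved to any other one without moving the other residue classes. -/
lemma exists_smul_eq (x y : ℤ) : ∃ g : AffinePerm m, g • x = y ∧
    ∀ v, ¬ v ≡ x [ZMOD m] → ¬ v ≡ y [ZMOD m] → g • v = v := by
  by_cases h : x ≡ y [ZMOD m]
  · obtain ⟨n, rfl⟩ := modEq_iff_exists_add_mul.1 h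
    exact ⟨shift x n, shift_smul_self x n, fun v hv _ => shift_smul_of_not hv n⟩
  · exact ⟨refl x y, refl_smul_left h, fun v hx hy => refl_smul_of_not hx hy⟩

end AffinePerm

end AffinePerm

/-! ### The group of affine permutations by generators and relations -/

/-- The relations of the affine permutations among the elements `s i` (`i + 1 < m`) and `t i`
(`i < m`) of a group.  Strands are numbered by natural numbers; the values of `s` and `t` outside
the stated ranges are irrelevant. -/
structure AffineRelations (m : ℕ) {K : Type*} [Group K] (s t : ℕ → K) : Prop where
  s_mul_self : ∀ i, i + 1 < m → s i * s i = 1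
  s_comm : ∀ i j, i + 1 < j → j + 1 < m → Commute (s i) (s j)
  braid : ∀ i, i + 2 < m → s i * s (i + 1) * s i = s (i + 1) * s i * s (i + 1)
  s_t_comm_of_lt : ∀ i j, i + 1 < j → j < m → Commute (s i) (t j)
  s_t_comm_of_gt : ∀ i j, j + 1 < i → i + 1 < m → Commute (s i) (t j)
  t_comm : ∀ i j, i < m → j < m → Commute (t i) (t j)
  s_t : ∀ i, i + 1 < m → s i * t i = t (i + 1) * s i

namespace AffineRelations

variable {m : ℕ} {K : Type*} [Group K] {s t : ℕ → K}

/-- The relations imply that `s (j + 1)` commutes with `t j`: conjugation by `s (j + 1) * s j` turns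
the pair into `s j`, `t (j + 2)`. -/
lemma s_succ_t_comm (h : AffineRelations m s t) {j : ℕ} (hj : j + 2 < m) :
    Commute (s (j + 1)) (t j) := by
  have ha := h.s_mul_self j (by omega)
  have hb := h.s_mul_self (j + 1) (by omega)
  have hab := h.braid j hj
  have e1 : s (j + 1) * s j * s (j + 1) = s j * (s (j + 1) * s j) := by
    rw [← hab, mul_assoc]
  have e2 : s (j + 1) * s j * t j = t (j + 2) * (s (j + 1) * s j) := by
    rw [mul_assoc, h.s_t j (by omega), ← mul_assoc, h.s_t (j + 1) (by omega), mul_assoc]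
  have hc := h.s_t_comm_of_lt j (j + 2) (by omega) hj
  have e3 : SemiconjBy (s (j + 1) * s j) (s (j + 1) * t j) (s j * t (j + 2)) :=
    SemiconjBy.mul_right e1 e2
  have e4 : SemiconjBy (s (j + 1) * s j) (t j * s (j + 1)) (s j * t (j + 2)) := by
    rw [hc.eq]
    exact SemiconjBy.mul_right e2 e1
  exact mul_left_cancel (e3.eq.trans e4.eq.symm)

lemma s_t_commute (h : AffineRelations m s t) {i j : ℕ} (hi : i + 1 < m) (hj : j < m)
    (h1 : j ≠ i) (h2 : j ≠ i + 1) : Commute (s i) (t j) := by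
  rcases lt_or_ge (i + 1) j with h3 | h3
  · exact h.s_t_comm_of_lt i j h3 hj
  · rcases lt_or_ge (j + 1) i with h4 | h4
    · exact h.s_t_comm_of_gt i j h4 hi
    · obtain rfl : i = j + 1 := by omega
      exact h.s_succ_t_comm hi

lemma s_t_zpow (h : AffineRelations m s t) {i : ℕ} (hi : i + 1 < m) (a : ℤ) :
    s i * t i ^ a = t (i + 1) ^ a * s i :=
  (SemiconjBy.zpow_right (show SemiconjBy (s i) (t i) (t (i + 1)) from h.s_t i hi) a).eq

lemma s_t_succ_zpow (h : AffineRelations m s t) {i : ℕ} (hi : i + 1 < m) (a : ℤ) :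
    s i * t (i + 1) ^ a = t i ^ a * s i := by
  have hs := h.s_mul_self i hi
  have e := h.s_t_zpow hi a
  calc s i * t (i + 1) ^ a = s i * (t (i + 1) ^ a * s i) * s i := by
        rw [mul_assoc, mul_assoc, hs, mul_one]
    _ = t i ^ a * s i := by rw [← e, ← mul_assoc, hs, one_mul]

/-- The product `s (k + d - 1) * ⋯ * s (k + 1) * s k`, which moves the strand `k` to `k + d`. -/
def desc (s : ℕ → K) (k : ℕ) : ℕ → K
  | 0 => 1
  | d + 1 => s (k + d) * desc s k d

lemma commute_desc {x : K} {k d : ℕ} (h : ∀ l, k ≤ l → l < k + d → Commute x (s l)) :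
    Commute x (desc s k d) := by
  induction d with
  | zero => exact Commute.one_right x
  | succ d ih =>
    exact (h (k + d) (by omega) (by omega)).mul_right (ih fun l h1 h2 => h l h1 (by omega))

/-- Moving the strand `k` to the right past the strands `i + 1` and `i + 2` renumbers them. -/
lemma s_mul_desc (h : AffineRelations m s t) {k d i : ℕ} (hk : k ≤ i) (hi : i + 1 < k + d)
    (hm : k + d < m) : s i * desc s k d = desc s k d * s (i + 1) := by
  induction d with
  | zero => omega
  | succ d ih =>
    rcases (show i + 1 < k + d ∨ i + 1 = k + d by omega) with h1 | h1
    · rw [desc, ← mul_assoc, (h.s_comm i (k + d) h1 (by omega)).eq, mul_assoc,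
        ih h1 (by omega), mul_assoc]
    · cases d with
      | zero => omega
      | succ d =>
        obtain rfl : i = k + d := by omega
        have hc : Commute (s (k + d + 1)) (desc s k d) :=
          commute_desc fun l _ h2 => (h.s_comm l (k + d + 1) (by omega) (by omega)).symm
        simp only [desc, ← add_assoc]
        rw [mul_assoc, mul_assoc, ← hc.eq, ← mul_assoc, ← mul_assoc, ← mul_assoc, ← mul_assoc,
          h.braid (k + d) (by omega)]

lemma t_mul_desc (h : AffineRelations m s t) {k d i : ℕ} (hk : k ≤ i) (hi : i < k + d)
    (hm : k + d < m) (b : ℤ) : t i ^ b * desc s k d = desc s k d * t (i + 1) ^ b := by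
  induction d with
  | zero => omega
  | succ d ih =>
    rcases (show i < k + d ∨ i = k + d by omega) with h1 | rfl
    · rw [desc, ← mul_assoc, ((h.s_t_commute (i := k + d) (j := i) (by omega) (by omega)
        (by omega) (by omega)).zpow_right b).eq.symm, mul_assoc, ih h1 (by omega), mul_assoc]
    · have hc : Commute (t (k + d + 1) ^ b) (desc s k d) :=
        commute_desc fun l _ h2 => ((h.s_t_commute (i := l) (j := k + d + 1) (by omega) (by omega)
          (by omega) (by omega)).zpow_right b).symm
      rw [desc, ← mul_assoc, ← h.s_t_succ_zpow (by omega), mul_assoc, hc.eq, mul_assoc]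

/-- The subgroup generated by those `s i` and `t i` which do not involve the first `k` strands. -/
def tail (m : ℕ) (s t : ℕ → K) (k : ℕ) : Subgroup K :=
  Subgroup.closure ({x | ∃ i, k ≤ i ∧ i + 1 < m ∧ x = s i} ∪ {x | ∃ i, k ≤ i ∧ i < m ∧ x = t i})

lemma s_mem_tail {k i : ℕ} (hk : k ≤ i) (hi : i + 1 < m) : s i ∈ tail m s t k :=
  Subgroup.subset_closure (Or.inl ⟨i, hk, hi, rfl⟩)

lemma t_mem_tail {k i : ℕ} (hk : k ≤ i) (hi : i < m) (b : ℤ) : t i ^ b ∈ tail m s t k :=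
  (tail m s t k).zpow_mem (Subgroup.subset_closure (Or.inr ⟨i, hk, hi, rfl⟩)) b

lemma desc_mem_tail {k d : ℕ} (h : k + d < m) : desc s k d ∈ tail m s t k := by
  induction d with
  | zero => exact Subgroup.one_mem _
  | succ d ih => exact Subgroup.mul_mem _ (s_mem_tail (by omega) (by omega)) (ih (by omega))

lemma tail_eq_bot {k : ℕ} (hk : m ≤ k) : tail m s t k = ⊥ := by
  rw [tail, Subgroup.closure_eq_bot_iff]
  rintro x (⟨i, h1, h2, _⟩ | ⟨i, h1, h2, _⟩) <;> omega

/-- The coset representatives of `tail m s t (k + 1)` in `tail m s t k`: the set of the products on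
the right is stable under multiplication by the generators from the left. -/
lemma exists_of_mem_tail (h : AffineRelations m s t) {k : ℕ} (hk : k < m) {x : K}
    (hx : x ∈ tail m s t k) : ∃ (d : ℕ) (a : ℤ), k + d < m ∧
      ∃ n ∈ tail m s t (k + 1), x = t (k + d) ^ a * (desc s k d * n) := by
  -- `s i` either changes `d` by one or passes to the subgroup
  have key_s : ∀ i, k ≤ i → i + 1 < m → ∀ y, (∃ (d : ℕ) (a : ℤ), k + d < m ∧
      ∃ n ∈ tail m s t (k + 1), y = t (k + d) ^ a * (desc s k d * n)) →
      ∃ (d : ℕ) (a : ℤ), k + d < m ∧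
        ∃ n ∈ tail m s t (k + 1), s i * y = t (k + d) ^ a * (desc s k d * n) := by
    rintro i hki hi _ ⟨d, a, hd, n, hn, rfl⟩
    rcases (show k + d < i ∨ i = k + d ∨ i + 1 = k + d ∨ i + 1 < k + d by omega) with
      h1 | rfl | h1 | h1
    · refine ⟨d, a, hd, s i * n, Subgroup.mul_mem _ (s_mem_tail (by omega) hi) hn, ?_⟩
      have hc : Commute (s i) (desc s k d) :=
        commute_desc fun l _ h2 => (h.s_comm l i (by omega) hi).symm
      rw [← mul_assoc, ((h.s_t_commute (i := i) (j := k + d) hi hd (by omega)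
        (by omega)).zpow_right a).eq, mul_assoc, ← mul_assoc (s i), hc.eq, mul_assoc]
    · refine ⟨d + 1, a, by omega, n, hn, ?_⟩
      rw [← mul_assoc, h.s_t_zpow hi, desc, mul_assoc, mul_assoc]
      rfl
    · cases d with
      | zero => omega
      | succ d =>
        obtain rfl : i = k + d := by omega
        refine ⟨d, a, by omega, n, hn, ?_⟩
        rw [← mul_assoc, ← add_assoc, h.s_t_succ_zpow hi, desc, mul_assoc, ← mul_assoc (s _),
          ← mul_assoc (s _), h.s_mul_self _ hi, one_mul]
    · refine ⟨d, a, hd, s (i + 1) * n,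
        Subgroup.mul_mem _ (s_mem_tail (by omega) (by omega)) hn, ?_⟩
      rw [← mul_assoc, ((h.s_t_commute (i := i) (j := k + d) hi hd (by omega)
        (by omega)).zpow_right a).eq, mul_assoc, ← mul_assoc (s i), h.s_mul_desc hki h1 hd,
        mul_assoc]
  -- `t i` either changes `a` or passes to the subgroup
  have key_t : ∀ i, k ≤ i → i < m → ∀ (b : ℤ) y, (∃ (d : ℕ) (a : ℤ), k + d < m ∧
      ∃ n ∈ tail m s t (k + 1), y = t (k + d) ^ a * (desc s k d * n)) →
      ∃ (d : ℕ) (a : ℤ), k + d < m ∧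
        ∃ n ∈ tail m s t (k + 1), t i ^ b * y = t (k + d) ^ a * (desc s k d * n) := by
    rintro i hki hi b _ ⟨d, a, hd, n, hn, rfl⟩
    have ht := ((h.t_comm i (k + d) hi hd).zpow_zpow b a).eq
    rcases (show k + d < i ∨ i = k + d ∨ i < k + d by omega) with h1 | rfl | h1
    · refine ⟨d, a, hd, t i ^ b * n, Subgroup.mul_mem _ (t_mem_tail (by omega) hi b) hn, ?_⟩
      have hc : Commute (t i ^ b) (desc s k d) :=
        commute_desc fun l _ h2 => ((h.s_t_commute (i := l) (j := i) (by omega) hi (by omega)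
          (by omega)).zpow_right b).symm
      rw [← mul_assoc, ht, mul_assoc, ← mul_assoc (t i ^ b), hc.eq, mul_assoc]
    · exact ⟨d, b + a, hd, n, hn, by rw [← mul_assoc, zpow_add]⟩
    · refine ⟨d, a, hd, t (i + 1) ^ b * n,
        Subgroup.mul_mem _ (t_mem_tail (by omega) (by omega) b) hn, ?_⟩
      rw [← mul_assoc, ht, mul_assoc, ← mul_assoc (t i ^ b), h.t_mul_desc hki h1 hd, mul_assoc]
  induction hx using Subgroup.closure_induction_left with
  | one => exact ⟨0, 0, by omega, 1, Subgroup.one_mem _, by simp [desc]⟩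
  | mul_left x hx y _ ih =>
    rcases hx with ⟨i, h1, h2, rfl⟩ | ⟨i, h1, h2, rfl⟩
    · exact key_s i h1 h2 y ih
    · simpa using key_t i h1 h2 1 y ih
  | inv_mul_cancel x hx y _ ih =>
    rcases hx with ⟨i, h1, h2, rfl⟩ | ⟨i, h1, h2, rfl⟩
    · rw [inv_eq_of_mul_eq_one_left (h.s_mul_self i h2)]
      exact key_s i h1 h2 y ih
    · simpa using key_t i h1 h2 (-1) y ih

end AffineRelations

namespace AffinePerm

variable {m : ℕ}

/-- The reflection which exchanges the strands `i` and `i + 1`. -/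
noncomputable def simple (m : ℕ) (i : ℕ) : AffinePerm m := refl i (i + 1)

/-- The affine permutation which winds the strand `i` once. -/
noncomputable def wind (m : ℕ) (i : ℕ) : AffinePerm m := shift i 1

lemma natCast_modEq_iff {i j : ℕ} (hi : i < m) (hj : j < m) :
    (i : ℤ) ≡ j [ZMOD m] ↔ i = j := by
  rw [modEq_iff_eq (by omega) (by omega) (by omega) (by omega), Nat.cast_inj]

lemma succ_modEq_iff {i j : ℕ} (hi : i + 1 < m) (hj : j < m) :
    (i : ℤ) + 1 ≡ j [ZMOD m] ↔ i + 1 = j := by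
  exact_mod_cast natCast_modEq_iff hi hj

lemma not_modEq_succ {i : ℕ} (hi : i + 1 < m) : ¬ (i : ℤ) ≡ i + 1 [ZMOD m] := by
  intro h
  have := (succ_modEq_iff hi (by omega)).1 h.symm
  omega

lemma simple_smul_self {i : ℕ} (hi : i + 1 < m) : simple m i • (i : ℤ) = i + 1 :=
  refl_smul_left (not_modEq_succ hi)

lemma simple_smul_succ {i : ℕ} (hi : i + 1 < m) : simple m i • ((i : ℤ) + 1) = i :=
  refl_smul_right (not_modEq_succ hi)

lemma simple_smul_of_ne {i j : ℕ} (hi : i + 1 < m) (hj : j < m) (h1 : j ≠ i) (h2 : j ≠ i + 1) :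
    simple m i • (j : ℤ) = j := by
  refine refl_smul_of_not ?_ ?_
  · rwa [natCast_modEq_iff hj (by omega)]
  · rw [Int.modEq_comm, succ_modEq_iff hi hj]
    exact Ne.symm h2

lemma simple_mul (g : AffinePerm m) (i : ℕ) :
    g * simple m i = refl (g • (i : ℤ)) (g • ((i : ℤ) + 1)) * g :=
  mul_refl g _ _

/-- The affine permutations satisfy their defining relations. -/
lemma affineRelations (m : ℕ) : AffineRelations m (simple m) (wind m) where
  s_mul_self i _ := refl_mul_self _ _
  s_comm i j h hj := by
    refine (simple_mul _ _).trans ?_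
    have e : simple m i • ((j : ℤ) + 1) = (j + 1 : ℕ) := by
      exact_mod_cast simple_smul_of_ne (by omega) (by omega) (by omega) (by omega)
    rw [simple_smul_of_ne (by omega) (by omega) (by omega) (by omega), e]
    push_cast
    rfl
  braid i hi := by
    have e1 : simple m (i + 1) • (i : ℤ) = i :=
      simple_smul_of_ne (by omega) (by omega) (by omega) (by omega)
    have e2 : simple m (i + 1) • ((i : ℤ) + 1) = i + 2 := by
      have := simple_smul_self (m := m) (i := i + 1) (by omega)
      push_cast at this
      rw [this]
      ring
    have e3 : simple m i • (((i + 1 : ℕ) : ℤ) + 1) = i + 2 := by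
      have := simple_smul_of_ne (m := m) (i := i) (j := i + 2) (by omega) (by omega) (by omega)
        (by omega)
      rw [show ((i + 1 : ℕ) : ℤ) + 1 = (i + 2 : ℕ) by push_cast; ring, this]
      push_cast
      ring
    have e4 : simple m i • ((i + 1 : ℕ) : ℤ) = i := by
      rw [Nat.cast_add, Nat.cast_one, simple_smul_succ (by omega)]
    rw [simple_mul (simple m i) (i + 1), e3, e4, simple_mul (simple m (i + 1)) i, e1, e2, mul_assoc,
      mul_assoc]
    rw [show simple m i * simple m i = 1 from refl_mul_self _ _,
      show simple m (i + 1) * simple m (i + 1) = 1 from refl_mul_self _ _]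
  s_t_comm_of_lt i j h hj := by
    refine (mul_shift _ _ _).trans ?_
    rw [simple_smul_of_ne (by omega) (by omega) (by omega) (by omega)]
    rfl
  s_t_comm_of_gt i j h hi := by
    refine (mul_shift _ _ _).trans ?_
    rw [simple_smul_of_ne (by omega) (by omega) (by omega) (by omega)]
    rfl
  t_comm i j _ _ := shift_commute _ _ _ _
  s_t i hi := by
    refine (mul_shift _ _ _).trans ?_
    rw [simple_smul_self hi, wind, Nat.cast_add, Nat.cast_one]

end AffinePerm

namespace AffineRelations

variable {m : ℕ} {H : Type*} [Group H] {s t : ℕ → H}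

/-- The pair of `s i` and the simple reflection which it is to represent. -/
noncomputable def pairS (m : ℕ) (s : ℕ → H) (i : ℕ) : H × AffinePerm m :=
  (s i, AffinePerm.simple m i)

/-- The pair of `t i` and the winding which it is to represent. -/
noncomputable def pairT (m : ℕ) (t : ℕ → H) (i : ℕ) : H × AffinePerm m :=
  (t i, AffinePerm.wind m i)

lemma pair (h : AffineRelations m s t) : AffineRelations m (pairS m s) (pairT m t) := by
  have h' := AffinePerm.affineRelations m
  exact
    { s_mul_self := fun i hi => Prod.ext (h.s_mul_self i hi) (h'.s_mul_self i hi)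
      s_comm := fun i j h1 h2 => Prod.ext (h.s_comm i j h1 h2) (h'.s_comm i j h1 h2)
      braid := fun i hi => Prod.ext (h.braid i hi) (h'.braid i hi)
      s_t_comm_of_lt := fun i j h1 h2 =>
        Prod.ext (h.s_t_comm_of_lt i j h1 h2) (h'.s_t_comm_of_lt i j h1 h2)
      s_t_comm_of_gt := fun i j h1 h2 =>
        Prod.ext (h.s_t_comm_of_gt i j h1 h2) (h'.s_t_comm_of_gt i j h1 h2)
      t_comm := fun i j h1 h2 => Prod.ext (h.t_comm i j h1 h2) (h'.t_comm i j h1 h2)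
      s_t := fun i hi => Prod.ext (h.s_t i hi) (h'.s_t i hi) }

/-- The graph of the homomorphism from the affine permutations to `H`, restricted to the affine
permutations of the strands `k, …, m - 1`. -/
noncomputable def graph (m : ℕ) (s t : ℕ → H) (k : ℕ) : Subgroup (H × AffinePerm m) :=
  tail m (pairS m s) (pairT m t) k

lemma graph_smul {k j : ℕ} (hjk : j < k) (hj : j < m) {x : H × AffinePerm m}
    (hx : x ∈ graph m s t k) : x.2 • (j : ℤ) = j := by
  have key : graph m s t k ≤ ((MulAction.stabilizer (AffinePerm m) (j : ℤ)).comap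
      (MonoidHom.snd H (AffinePerm m))) := by
    rw [graph, tail, Subgroup.closure_le]
    rintro _ (⟨i, h1, h2, rfl⟩ | ⟨i, h1, h2, rfl⟩)
    · exact AffinePerm.simple_smul_of_ne h2 hj (by omega) (by omega)
    · refine AffinePerm.shift_smul_of_not ?_ 1
      rw [AffinePerm.natCast_modEq_iff hj h2]
      omega
  exact key hx

lemma desc_smul {k d : ℕ} (h : k + d < m) : (desc (pairS m s) k d).2 • (k : ℤ) = (k + d : ℕ) := by
  induction d with
  | zero => exact one_smul _ _
  | succ d ih =>
    rw [desc, Prod.snd_mul, mul_smul, ih (by omega)]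
    exact (AffinePerm.simple_smul_self (by omega)).trans (by push_cast; ring)

lemma pairT_zpow_smul (i : ℕ) (a : ℤ) : (pairT m t i ^ a).2 • (i : ℤ) = i + a * m := by
  have e : (pairT m t i ^ a).2 = AffinePerm.shift i a := by
    rw [AffinePerm.shift_eq_zpow]
    exact map_zpow (MonoidHom.snd H (AffinePerm m)) _ a
  rw [e, AffinePerm.shift_smul_self]

/-- The coset of an element is determined by the image of the strand `k`. -/
lemma mem_graph_succ (h : AffineRelations m s t) {k : ℕ} (hk : k < m) {x : H × AffinePerm m}
    (hx : x ∈ graph m s t k) (hxk : x.2 • (k : ℤ) = k) : x ∈ graph m s t (k + 1) := by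
  obtain ⟨d, a, hd, n, hn, rfl⟩ := exists_of_mem_tail h.pair hk hx
  rw [Prod.snd_mul, Prod.snd_mul, mul_smul, mul_smul, graph_smul (by omega) hk hn, desc_smul hd,
    pairT_zpow_smul] at hxk
  have hmod : ((k + d : ℕ) : ℤ) ≡ k [ZMOD m] := modEq_iff_exists_add_mul.2 ⟨a, hxk.symm⟩
  rw [AffinePerm.natCast_modEq_iff hd hk] at hmod
  obtain rfl : d = 0 := by omega
  obtain rfl : a = 0 := by
    have h1 : a * (m : ℤ) = 0 := by simpa using hxk
    rcases mul_eq_zero.1 h1 with h2 | h2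
    · exact h2
    · omega
  rw [zpow_zero, desc, one_mul, one_mul]
  exact hn

lemma mem_graph_of_smul (h : AffineRelations m s t) {k : ℕ} (hk : k ≤ m) {x : H × AffinePerm m}
    (hx : x ∈ graph m s t 0) (hxk : ∀ j < k, x.2 • (j : ℤ) = j) : x ∈ graph m s t k := by
  induction k with
  | zero => exact hx
  | succ k ih =>
    exact h.mem_graph_succ hk (ih (by omega) fun j hj => hxk j (by omega)) (hxk k (by omega))

lemma eq_one_of_mem_graph (h : AffineRelations m s t) {x : H × AffinePerm m}
    (hx : x ∈ graph m s t 0) (hx2 : x.2 = 1) : x = 1 := by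
  have := h.mem_graph_of_smul le_rfl hx fun j _ => by rw [hx2, one_smul]
  rwa [graph, tail_eq_bot le_rfl, Subgroup.mem_bot] at this

/-- The coset representatives move the strand `k` to every vertex which is not on an earlier
strand. -/
lemma exists_mem_graph [NeZero m] (n : ℕ) : ∀ (k : ℕ), k + n = m → ∀ g : AffinePerm m,
    (∀ j < k, g • (j : ℤ) = j) → ∃ x ∈ graph m s t k, x.2 = g := by
  have hm : (0 : ℤ) < m := by exact_mod_cast Nat.pos_of_ne_zero (NeZero.ne m)
  -- a vertex is a translate of a vertex in the fundamental domain
  have hres : ∀ v : ℤ, ∃ (r : ℕ) (a : ℤ), r < m ∧ v = r + a * m := fun v =>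
    ⟨(v % m).toNat, v / m, by have := Int.emod_lt_of_pos v hm; omega, by
      rw [Int.toNat_of_nonneg (Int.emod_nonneg v hm.ne'), Int.emod_add_ediv_mul]⟩
  induction n with
  | zero =>
    intro k hk g hg
    refine ⟨1, Subgroup.one_mem _, ?_⟩
    ext v
    obtain ⟨r, a, hr, rfl⟩ := hres v
    rw [AffinePerm.smul_add_mul g, hg r (by omega)]
    exact one_smul _ _
  | succ n ih =>
    intro k hk g hg
    obtain ⟨r, a, hr, hv⟩ := hres (g • (k : ℤ))
    have hrk : k ≤ r := by
      by_contra hlt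
      have h1 : g • (k : ℤ) ≡ g • (r : ℤ) [ZMOD m] := by
        rw [hg r (by omega), hv]
        exact add_mul_modEq _ _
      rw [AffinePerm.smul_modEq_smul, AffinePerm.natCast_modEq_iff (by omega) hr] at h1
      omega
    obtain ⟨d, rfl⟩ := Nat.exists_eq_add_of_le hrk
    set c : H × AffinePerm m := pairT m t (k + d) ^ a * desc (pairS m s) k d with hc
    have hcmem : c ∈ graph m s t k :=
      Subgroup.mul_mem _ (t_mem_tail (by omega) hr a) (desc_mem_tail hr)
    have hck : c.2 • (k : ℤ) = g • (k : ℤ) := by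
      rw [hc, Prod.snd_mul, mul_smul, desc_smul hr, pairT_zpow_smul, hv]
    obtain ⟨x, hx, hx2⟩ := ih (k + 1) (by omega) (c.2⁻¹ * g) (by
      intro j hj
      rw [mul_smul, inv_smul_eq_iff]
      rcases (show j < k ∨ j = k by omega) with h1 | rfl
      · rw [hg j h1, graph_smul h1 (by omega) hcmem]
      · exact hck.symm)
    have hle : graph m s t (k + 1) ≤ graph m s t k :=
      Subgroup.closure_mono (Set.union_subset_union
        (fun _ ⟨i, h1, h2⟩ => ⟨i, by omega, h2⟩) (fun _ ⟨i, h1, h2⟩ => ⟨i, by omega, h2⟩))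
    exact ⟨c * x, Subgroup.mul_mem _ hcmem (hle hx), by rw [Prod.snd_mul, hx2, mul_inv_cancel_left]⟩

/-- The projection of the graph to the affine permutations is bijective: the affine permutations
are presented by the relations `AffineRelations`. -/
lemma bijective_snd_graph [NeZero m] (h : AffineRelations m s t) : Function.Bijective
    ((MonoidHom.snd H (AffinePerm m)).comp (graph m s t 0).subtype) := by
  refine ⟨(injective_iff_map_eq_one _).2 fun x hx => ?_, fun g => ?_⟩
  · exact Subtype.ext (h.eq_one_of_mem_graph x.2 hx)
  · obtain ⟨x, hx, hx2⟩ := exists_mem_graph (s := s) (t := t) m 0 (by omega) g (by simp)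
    exact ⟨⟨x, hx⟩, hx2⟩

/-- The homomorphism from the affine permutations given by elements which satisfy the relations. -/
noncomputable def lift [NeZero m] (h : AffineRelations m s t) : AffinePerm m →* H :=
  ((MonoidHom.fst H (AffinePerm m)).comp (graph m s t 0).subtype).comp
    (MulEquiv.ofBijective _ h.bijective_snd_graph).symm.toMonoidHom

lemma lift_mem_graph [NeZero m] (h : AffineRelations m s t) (g : AffinePerm m) :
    (h.lift g, g) ∈ graph m s t 0 := by
  have e : (MulEquiv.ofBijective _ h.bijective_snd_graph)
    ((MulEquiv.ofBijective _ h.bijective_snd_graph).symm g) = g := MulEquiv.apply_symm_apply _ _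
  have := ((MulEquiv.ofBijective _ h.bijective_snd_graph).symm g).2
  convert this using 1
  exact Prod.ext rfl e.symm

lemma lift_eq [NeZero m] (h : AffineRelations m s t) {x : H × AffinePerm m}
    (hx : x ∈ graph m s t 0) : h.lift x.2 = x.1 := by
  have := h.eq_one_of_mem_graph (Subgroup.mul_mem _ (h.lift_mem_graph x.2)
    (Subgroup.inv_mem _ hx)) (by simp)
  have h1 := congrArg Prod.fst this
  exact mul_inv_eq_one.1 h1

lemma lift_simple [NeZero m] (h : AffineRelations m s t) {i : ℕ} (hi : i + 1 < m) :
    h.lift (AffinePerm.simple m i) = s i :=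
  h.lift_eq (x := pairS m s i) (s_mem_tail (Nat.zero_le i) hi)

lemma lift_wind [NeZero m] (h : AffineRelations m s t) {i : ℕ} (hi : i < m) :
    h.lift (AffinePerm.wind m i) = t i :=
  h.lift_eq (x := pairT m t i) (by
    have := t_mem_tail (s := pairS m s) (t := pairT m t) (Nat.zero_le i) hi 1
    rwa [zpow_one] at this)

/-- The image of an affine permutation which fixes the first `k` strands is a product of generators
which do not involve these strands. -/
lemma lift_mem_tail [NeZero m] (h : AffineRelations m s t) {k : ℕ} (hk : k ≤ m) {g : AffinePerm m}
    (hg : ∀ j < k, g • (j : ℤ) = j) : h.lift g ∈ tail m s t k := by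
  have h1 : (h.lift g, g) ∈ graph m s t k := h.mem_graph_of_smul hk (h.lift_mem_graph g) hg
  have h2 : graph m s t k ≤ (tail m s t k).comap (MonoidHom.fst H (AffinePerm m)) := by
    rw [graph, tail, Subgroup.closure_le]
    rintro _ (⟨i, h1, h2, rfl⟩ | ⟨i, h1, h2, rfl⟩)
    · exact s_mem_tail h1 h2
    · exact Subgroup.subset_closure (Or.inr ⟨i, h1, h2, rfl⟩)
  have h3 := h2 h1
  exact h3

end AffineRelations

/-! ### Cup-caps along arbitrary arcs -/

section Arcs

variable {m : ℕ}

namespace AffinePerm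

lemma exists_smul_two (hm : 2 ≤ m) {x y : ℤ} (hxy : ¬ x ≡ y [ZMOD m]) :
    ∃ g : AffinePerm m, g • (0 : ℤ) = x ∧ g • (1 : ℤ) = y := by
  obtain ⟨g, hg, -⟩ := exists_smul_eq (m := m) 0 x
  obtain ⟨h, hh, hh'⟩ := exists_smul_eq (m := m) (g • (1 : ℤ)) y
  refine ⟨h * g, ?_, by rw [mul_smul, hh]⟩
  rw [mul_smul, hg]
  refine hh' x ?_ hxy
  rw [← hg, smul_modEq_smul]
  exact_mod_cast mt (natCast_modEq_iff (m := m) (i := 0) (j := 1) (by omega) (by omega)).1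
    (by omega)

lemma exists_smul_three (hm : 3 ≤ m) {x y z : ℤ} (hxy : ¬ x ≡ y [ZMOD m])
    (hxz : ¬ x ≡ z [ZMOD m]) (hyz : ¬ y ≡ z [ZMOD m]) :
    ∃ g : AffinePerm m, g • (0 : ℤ) = x ∧ g • (1 : ℤ) = y ∧ g • (2 : ℤ) = z := by
  obtain ⟨g, hg0, hg1⟩ := exists_smul_two (by omega) hxy
  obtain ⟨h, hh, hh'⟩ := exists_smul_eq (m := m) (g • (2 : ℤ)) z
  refine ⟨h * g, ?_, ?_, by rw [mul_smul, hh]⟩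
  · rw [mul_smul, hg0]
    refine hh' x ?_ hxz
    rw [← hg0, smul_modEq_smul]
    exact_mod_cast mt (natCast_modEq_iff (m := m) (i := 0) (j := 2) (by omega) (by omega)).1
      (by omega)
  · rw [mul_smul, hg1]
    refine hh' y ?_ hyz
    rw [← hg1, smul_modEq_smul]
    exact_mod_cast mt (natCast_modEq_iff (m := m) (i := 1) (j := 2) (by omega) (by omega)).1
      (by omega)

lemma exists_smul_four (hm : 4 ≤ m) {x y z u : ℤ} (hxy : ¬ x ≡ y [ZMOD m])
    (hxz : ¬ x ≡ z [ZMOD m]) (hyz : ¬ y ≡ z [ZMOD m]) (hxu : ¬ x ≡ u [ZMOD m])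
    (hyu : ¬ y ≡ u [ZMOD m]) (hzu : ¬ z ≡ u [ZMOD m]) :
    ∃ g : AffinePerm m, g • (0 : ℤ) = x ∧ g • (1 : ℤ) = y ∧ g • (2 : ℤ) = z ∧ g • (3 : ℤ) = u := by
  obtain ⟨g, hg0, hg1, hg2⟩ := exists_smul_three (by omega) hxy hxz hyz
  obtain ⟨h, hh, hh'⟩ := exists_smul_eq (m := m) (g • (3 : ℤ)) u
  refine ⟨h * g, ?_, ?_, ?_, by rw [mul_smul, hh]⟩
  · rw [mul_smul, hg0]
    refine hh' x ?_ hxu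
    rw [← hg0, smul_modEq_smul]
    exact_mod_cast mt (natCast_modEq_iff (m := m) (i := 0) (j := 3) (by omega) (by omega)).1
      (by omega)
  · rw [mul_smul, hg1]
    refine hh' y ?_ hyu
    rw [← hg1, smul_modEq_smul]
    exact_mod_cast mt (natCast_modEq_iff (m := m) (i := 1) (j := 3) (by omega) (by omega)).1
      (by omega)
  · rw [mul_smul, hg2]
    refine hh' z ?_ hzu
    rw [← hg2, smul_modEq_smul]
    exact_mod_cast mt (natCast_modEq_iff (m := m) (i := 2) (j := 3) (by omega) (by omega)).1
      (by omega)

end AffinePerm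

lemma two_le_of_not_modEq [NeZero m] {x y : ℤ} (hxy : ¬ x ≡ y [ZMOD m]) : 2 ≤ m := by
  have := Nat.pos_of_ne_zero (NeZero.ne m)
  by_contra hm
  obtain rfl : m = 1 := by omega
  exact hxy (by simp [Int.modEq_one])

lemma three_le_of_not_modEq [NeZero m] {x y z : ℤ} (hxy : ¬ x ≡ y [ZMOD m])
    (hxz : ¬ x ≡ z [ZMOD m]) (hyz : ¬ y ≡ z [ZMOD m]) : 3 ≤ m := by
  have := two_le_of_not_modEq hxy
  by_contra hm
  obtain rfl : m = 2 := by omega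
  simp only [Int.ModEq] at hxy hxz hyz
  push_cast at hxy hxz hyz
  omega

lemma four_le_of_not_modEq [NeZero m] {x y z u : ℤ} (hxy : ¬ x ≡ y [ZMOD m])
    (hxz : ¬ x ≡ z [ZMOD m]) (hyz : ¬ y ≡ z [ZMOD m]) (hxu : ¬ x ≡ u [ZMOD m])
    (hyu : ¬ y ≡ u [ZMOD m]) (hzu : ¬ z ≡ u [ZMOD m]) : 4 ≤ m := by
  have := three_le_of_not_modEq hxy hxz hyz
  by_contra hm
  obtain rfl : m = 3 := by omega
  simp only [Int.ModEq] at hxy hxz hyz hxu hyu hzu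
  push_cast at hxy hxz hyz hxu hyu hzu
  omega

open AffinePerm

variable {k A : Type*} [CommRing k] [Ring A] [Algebra k A]

section Conj

variable (ρ : AffinePerm m →* A)

/-- Conjugation by the image of an affine permutation. -/
def conj (g : AffinePerm m) (a : A) : A := ρ g * a * ρ g⁻¹

lemma map_mul_inv (g : AffinePerm m) : ρ g * ρ g⁻¹ = 1 := by
  rw [← map_mul, mul_inv_cancel, map_one]

lemma map_inv_mul (g : AffinePerm m) : ρ g⁻¹ * ρ g = 1 := by
  rw [← map_mul, inv_mul_cancel, map_one]

lemma conj_mul (g : AffinePerm m) (a b : A) : conj ρ g (a * b) = conj ρ g a * conj ρ g b := by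
  have e : ρ g * a * ρ g⁻¹ * (ρ g * b * ρ g⁻¹) = ρ g * a * (ρ g⁻¹ * ρ g) * b * ρ g⁻¹ := by
    noncomm_ring
  rw [conj, conj, conj, e, map_inv_mul, mul_one, mul_assoc (ρ g) a b]

lemma conj_one (g : AffinePerm m) : conj ρ g 1 = 1 := by
  rw [conj, mul_one, map_mul_inv]

lemma conj_smul (g : AffinePerm m) (r : k) (a : A) : conj ρ g (r • a) = r • conj ρ g a := by
  simp [conj]

lemma conj_conj (g h : AffinePerm m) (a : A) : conj ρ g (conj ρ h a) = conj ρ (g * h) a := by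
  simp [conj, mul_assoc]

lemma map_mul_eq_conj_mul (g : AffinePerm m) (a : A) : ρ g * a = conj ρ g a * ρ g := by
  rw [conj, mul_assoc, map_inv_mul, mul_one]

lemma conj_eq_iff {g : AffinePerm m} {a b : A} : conj ρ g a = b ↔ ρ g * a = b * ρ g := by
  rw [map_mul_eq_conj_mul]
  constructor
  · intro h
    rw [h]
  · intro h
    have := congrArg (· * ρ g⁻¹) h
    simpa only [mul_assoc, map_mul_inv, mul_one] using this

lemma conj_map (g h : AffinePerm m) : conj ρ g (ρ h) = ρ (g * h * g⁻¹) := by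
  simp [conj]

lemma map_refl_smul (g : AffinePerm m) (x y : ℤ) :
    ρ (refl (g • x) (g • y)) = conj ρ g (ρ (refl x y)) := by
  rw [conj_map, mul_refl, mul_inv_cancel_right]

lemma map_shift_smul (g : AffinePerm m) (x n : ℤ) :
    ρ (shift (g • x) n) = conj ρ g (ρ (shift x n)) := by
  rw [conj_map, mul_shift, mul_inv_cancel_right]

end Conj

open Classical in
/-- The conjugate of `e`, seen as a cup and cap at the vertices `0` and `1`, with cup and cap at the
vertices `x` and `y`.  It is only meaningful if `e` commutes with the stabilizer of `0` and `1`, and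
if `x` and `y` are not congruent modulo `m`. -/
noncomputable def arc (ρ : AffinePerm m →* A) (e : A) (x y : ℤ) : A :=
  if h : ∃ g : AffinePerm m, g • (0 : ℤ) = x ∧ g • (1 : ℤ) = y then conj ρ h.choose e else 0

lemma arc_eq_conj {ρ : AffinePerm m →* A} {e : A}
    (hs : ∀ g : AffinePerm m, g • (0 : ℤ) = 0 → g • (1 : ℤ) = 1 → ρ g * e = e * ρ g)
    (g : AffinePerm m) : arc ρ e (g • (0 : ℤ)) (g • (1 : ℤ)) = conj ρ g e := by
  have H : ∃ g' : AffinePerm m, g' • (0 : ℤ) = g • (0 : ℤ) ∧ g' • (1 : ℤ) = g • (1 : ℤ) :=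
    ⟨g, rfl, rfl⟩
  rw [arc, dif_pos H]
  obtain ⟨h0, h1⟩ := H.choose_spec
  have hs : conj ρ (g⁻¹ * H.choose) e = e :=
    (conj_eq_iff ρ).2 (hs _ (by rw [mul_smul, h0, inv_smul_smul])
      (by rw [mul_smul, h1, inv_smul_smul]))
  calc conj ρ H.choose e = conj ρ (g * (g⁻¹ * H.choose)) e := by rw [mul_inv_cancel_left]
    _ = conj ρ g e := by rw [← conj_conj, hs]

/-- The relations between affine permutations and the cup-cap `e` at the vertices `0` and `1`. -/
structure CupCapRelations (β : k) (ρ : AffinePerm m →* A) (e : A) : Prop where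
  stab : ∀ g : AffinePerm m, g • (0 : ℤ) = 0 → g • (1 : ℤ) = 1 → ρ g * e = e * ρ g
  refl_mul : 2 ≤ m → ρ (refl 0 1) * e = e
  mul_refl : 2 ≤ m → e * ρ (refl 0 1) = e
  shift_mul : 2 ≤ m → ρ (shift 0 1) * ρ (shift 1 1) * e = e
  mul_shift : 2 ≤ m → e * (ρ (shift 0 1) * ρ (shift 1 1)) = e
  mul_shift_mul : 2 ≤ m → ∀ n, e * ρ (shift 0 n) * e = β • e
  mul_arc : 3 ≤ m → e * arc ρ e 1 2 = e * (ρ (refl 1 2) * ρ (refl 0 1))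
  arc_comm : 4 ≤ m → e * arc ρ e 2 3 = arc ρ e 2 3 * e
  exchange : 4 ≤ m → e * arc ρ e 2 3 * (ρ (refl 0 2) * ρ (refl 1 3)) = e * arc ρ e 2 3

namespace CupCapRelations

variable {β : k} {ρ : AffinePerm m →* A} {e : A}

lemma arc_eq (h : CupCapRelations β ρ e) (g : AffinePerm m) :
    arc ρ e (g • (0 : ℤ)) (g • (1 : ℤ)) = conj ρ g e := arc_eq_conj h.stab g

lemma mul_shift_zpow (h : CupCapRelations β ρ e) (hm : 2 ≤ m) (n : ℤ) :
    e * (ρ (shift 0 n) * ρ (shift 1 n)) = e := by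
  have h1 : ∀ n : ℕ, e * ρ ((shift 0 1 * shift 1 1) ^ n) = e := by
    intro n
    induction n with
    | zero => simp
    | succ n ih => rw [pow_succ', map_mul, ← mul_assoc, map_mul, h.mul_shift hm, ih]
  have hc : Commute (shift 0 1 : AffinePerm m) (shift 1 1) := shift_commute _ _ _ _
  rw [← map_mul, shift_eq_zpow 0, shift_eq_zpow 1, ← hc.mul_zpow]
  obtain ⟨k, rfl | rfl⟩ := n.eq_nat_or_neg
  · exact_mod_cast h1 k
  · have := congrArg (· * ρ ((shift 0 1 * shift 1 1) ^ (-(k : ℤ)))) (h1 k)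
    simp only [mul_assoc, ← map_mul] at this
    simpa using this.symm

variable [NeZero m]

lemma arc_smul (h : CupCapRelations β ρ e) (g : AffinePerm m) {x y : ℤ} (hxy : ¬ x ≡ y [ZMOD m]) :
    arc ρ e (g • x) (g • y) = conj ρ g (arc ρ e x y) := by
  obtain ⟨g', rfl, rfl⟩ := exists_smul_two (two_le_of_not_modEq hxy) hxy
  rw [h.arc_eq, conj_conj, ← h.arc_eq, mul_smul, mul_smul]

lemma arc_symm (h : CupCapRelations β ρ e) {x y : ℤ} (hxy : ¬ x ≡ y [ZMOD m]) :
    arc ρ e x y = arc ρ e y x := by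
  have hm := two_le_of_not_modEq hxy
  obtain ⟨g, rfl, rfl⟩ := exists_smul_two hm hxy
  rw [smul_modEq_smul] at hxy
  have e1 : arc ρ e (g • (1 : ℤ)) (g • (0 : ℤ)) = conj ρ (g * refl 0 1) e := by
    rw [← h.arc_eq, mul_smul, mul_smul, refl_smul_left hxy, refl_smul_right hxy]
  rw [e1, ← conj_conj, (conj_eq_iff ρ).2 ((h.refl_mul hm).trans (h.mul_refl hm).symm), h.arc_eq]

lemma arc_mul_refl (h : CupCapRelations β ρ e) {x y : ℤ} (hxy : ¬ x ≡ y [ZMOD m]) :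
    arc ρ e x y * ρ (refl x y) = arc ρ e x y := by
  have hm := two_le_of_not_modEq hxy
  obtain ⟨g, rfl, rfl⟩ := exists_smul_two hm hxy
  rw [h.arc_eq, map_refl_smul, ← conj_mul, h.mul_refl hm]

lemma arc_mul_shift (h : CupCapRelations β ρ e) {x y : ℤ} (hxy : ¬ x ≡ y [ZMOD m]) (n : ℤ) :
    arc ρ e x y * (ρ (shift x n) * ρ (shift y n)) = arc ρ e x y := by
  have hm := two_le_of_not_modEq hxy
  obtain ⟨g, rfl, rfl⟩ := exists_smul_two hm hxy
  rw [h.arc_eq, map_shift_smul, map_shift_smul, ← conj_mul, ← conj_mul, h.mul_shift_zpow hm]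

lemma arc_add_mul (h : CupCapRelations β ρ e) {x y : ℤ} (hxy : ¬ x ≡ y [ZMOD m]) (n : ℤ) :
    arc ρ e (x + n * m) (y + n * m) = arc ρ e x y := by
  have hm := two_le_of_not_modEq hxy
  obtain ⟨g, rfl, rfl⟩ := exists_smul_two hm hxy
  rw [smul_modEq_smul] at hxy
  have hc : Commute (shift 0 1 : AffinePerm m) (shift 1 1) := shift_commute _ _ _ _
  have h1 : Commute e (ρ (shift 0 1 * shift 1 1)) := by
    rw [Commute, SemiconjBy, map_mul, h.mul_shift hm, h.shift_mul hm]
  have h2 : ∀ n : ℕ, Commute e (ρ ((shift 0 1 * shift 1 1) ^ n)) := fun n => by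
    rw [map_pow]
    exact h1.pow_right n
  have h3 : conj ρ (shift 0 n * shift 1 n) e = e := by
    rw [shift_eq_zpow 0, shift_eq_zpow 1, ← hc.mul_zpow]
    obtain ⟨k, rfl | rfl⟩ := n.eq_nat_or_neg
    · exact (conj_eq_iff ρ).2 (by exact_mod_cast (h2 k).eq.symm)
    · have h4 : conj ρ ((shift 0 1 * shift 1 1) ^ k) e = e := (conj_eq_iff ρ).2 (h2 k).eq.symm
      rw [zpow_neg, zpow_natCast]
      nth_rewrite 1 [← h4]
      rw [conj_conj, inv_mul_cancel, conj, inv_one, map_one, one_mul, mul_one]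
  have e1 : g • (0 : ℤ) + n * m = (g * (shift 0 n * shift 1 n)) • (0 : ℤ) := by
    rw [mul_smul, mul_smul, shift_smul_of_not hxy, shift_smul_self, smul_add_mul]
  have e2 : g • (1 : ℤ) + n * m = (g * (shift 0 n * shift 1 n)) • (1 : ℤ) := by
    rw [mul_smul, shift_commute, mul_smul, shift_smul_of_not fun h => hxy h.symm, shift_smul_self,
      smul_add_mul]
  rw [e1, e2, h.arc_eq, ← conj_conj, h3, h.arc_eq]

/-- Two arcs between the same strands produce a loop, which need not be contractible. -/
lemma arc_mul_arc_add (h : CupCapRelations β ρ e) {x y : ℤ} (hxy : ¬ x ≡ y [ZMOD m]) (n : ℤ) :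
    arc ρ e x y * arc ρ e (x + n * m) y = β • (arc ρ e x y * ρ (shift x (-n))) := by
  have hm := two_le_of_not_modEq hxy
  obtain ⟨g, rfl, rfl⟩ := exists_smul_two hm hxy
  rw [smul_modEq_smul] at hxy
  have e1 : arc ρ e (g • (0 : ℤ) + n * m) (g • (1 : ℤ)) = conj ρ g (conj ρ (shift 0 n) e) := by
    rw [conj_conj, ← h.arc_eq, mul_smul, shift_smul_self, smul_add_mul, mul_smul,
      shift_smul_of_not fun h => hxy h.symm]
  have e2 : e * conj ρ (shift 0 n) e = β • (e * ρ (shift 0 (-n))) := by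
    rw [conj, ← mul_assoc, ← mul_assoc, h.mul_shift_mul hm, smul_mul_assoc, shift_neg]
  rw [e1, h.arc_eq, map_shift_smul, ← conj_mul, e2, conj_smul, conj_mul]

/-- Two arcs with exactly one common strand. -/
lemma arc_mul_arc (h : CupCapRelations β ρ e) {x y z : ℤ} (hxy : ¬ x ≡ y [ZMOD m])
    (hxz : ¬ x ≡ z [ZMOD m]) (hyz : ¬ y ≡ z [ZMOD m]) :
    arc ρ e x y * arc ρ e y z = arc ρ e x y * (ρ (refl y z) * ρ (refl x y)) := by
  have hm := three_le_of_not_modEq hxy hxz hyz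
  obtain ⟨g, rfl, rfl, rfl⟩ := exists_smul_three hm hxy hxz hyz
  rw [smul_modEq_smul] at hyz
  rw [h.arc_smul g hyz, h.arc_eq, map_refl_smul, map_refl_smul, ← conj_mul, ← conj_mul,
    ← conj_mul, h.mul_arc hm]

lemma arc_commute (h : CupCapRelations β ρ e) {x y z u : ℤ} (hxy : ¬ x ≡ y [ZMOD m])
    (hxz : ¬ x ≡ z [ZMOD m]) (hyz : ¬ y ≡ z [ZMOD m]) (hxu : ¬ x ≡ u [ZMOD m])
    (hyu : ¬ y ≡ u [ZMOD m]) (hzu : ¬ z ≡ u [ZMOD m]) :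
    arc ρ e x y * arc ρ e z u = arc ρ e z u * arc ρ e x y := by
  have hm := four_le_of_not_modEq hxy hxz hyz hxu hyu hzu
  obtain ⟨g, rfl, rfl, rfl, rfl⟩ := exists_smul_four hm hxy hxz hyz hxu hyu hzu
  rw [smul_modEq_smul] at hzu
  rw [h.arc_smul g hzu, h.arc_eq, ← conj_mul, ← conj_mul, h.arc_comm hm]

/-- Exchanging two disjoint arcs. -/
lemma arc_mul_arc_mul_exchange (h : CupCapRelations β ρ e) {x y z u : ℤ} (hxy : ¬ x ≡ y [ZMOD m])
    (hxz : ¬ x ≡ z [ZMOD m]) (hyz : ¬ y ≡ z [ZMOD m]) (hxu : ¬ x ≡ u [ZMOD m])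
    (hyu : ¬ y ≡ u [ZMOD m]) (hzu : ¬ z ≡ u [ZMOD m]) :
    arc ρ e x y * arc ρ e z u * (ρ (refl x z) * ρ (refl y u)) = arc ρ e x y * arc ρ e z u := by
  have hm := four_le_of_not_modEq hxy hxz hyz hxu hyu hzu
  obtain ⟨g, rfl, rfl, rfl, rfl⟩ := exists_smul_four hm hxy hxz hyz hxu hyu hzu
  rw [smul_modEq_smul] at hzu
  rw [h.arc_smul g hzu, h.arc_eq, map_refl_smul, map_refl_smul, ← conj_mul, ← conj_mul,
    ← conj_mul, h.exchange hm]

end CupCapRelations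

end Arcs

/-! ### Normal forms -/

open AffinePerm

section NormalForm

variable {m : ℕ} {k A : Type*} [CommRing k] [Ring A] [Algebra k A]

/-- `ArcProduct ρ e w a` says that `a` is the product of the cup-caps along the arcs of the
involution `w`, where an arc is a pair of vertices exchanged by `w`, taken up to translation. -/
inductive ArcProduct (ρ : AffinePerm m →* A) (e : A) : AffinePerm m → A → Prop
  | one : ArcProduct ρ e 1 1
  | mul {x y : ℤ} {w : AffinePerm m} {a : A} (hxy : ¬ x ≡ y [ZMOD m]) (hx : w • x = x)
      (hy : w • y = y) (h : ArcProduct ρ e w a) : ArcProduct ρ e (refl x y * w) (arc ρ e x y * a)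

lemma commute_refl_of_smul {w : AffinePerm m} {x y : ℤ} (hx : w • x = x) (hy : w • y = y) :
    w * refl x y = refl x y * w := by
  rw [mul_refl, hx, hy]

lemma smul_add_mul_eq_self {w : AffinePerm m} {x : ℤ} (hx : w • x = x) (n : ℤ) :
    w • (x + n * m) = x + n * m := by
  rw [smul_add_mul, hx]

/-- Fixing a vertex is a property of its residue class. -/
lemma smul_eq_self_of_modEq {w : AffinePerm m} {x v : ℤ} (hx : w • x = x) (h : v ≡ x [ZMOD m]) :
    w • v = v := by
  obtain ⟨n, rfl⟩ := modEq_iff_exists_add_mul.1 h.symm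
  exact smul_add_mul_eq_self hx n

namespace ArcProduct

variable {ρ : AffinePerm m →* A} {e : A}

lemma mul_self {w : AffinePerm m} {a : A} (h : ArcProduct ρ e w a) : w * w = 1 := by
  induction h with
  | one => rw [mul_one]
  | @mul x y w a hxy hx hy _ ih =>
    rw [mul_assoc, ← mul_assoc w, commute_refl_of_smul hx hy, mul_assoc, ih, mul_one,
      refl_mul_self]

lemma smul_smul_self {w : AffinePerm m} (hw : w * w = 1) (x : ℤ) : w • w • x = x := by
  rw [smul_smul, hw, one_smul]

lemma not_modEq_of_smul {w : AffinePerm m} (hw : w * w = 1) {x : ℤ} (hx : w • x ≠ x) :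
    ¬ x ≡ w • x [ZMOD m] :=
  fun h' => hx (eq_of_smul_modEq hw h'.symm)

lemma eq_one {w : AffinePerm m} {a : A} (h : ArcProduct ρ e w a) (hw : w = 1) : a = 1 := by
  cases h with
  | one => rfl
  | @mul x y w a hxy hx hy _ =>
    have h1 : (refl x y * w) • x = x := by rw [hw, one_smul]
    rw [mul_smul, hx, refl_smul_left hxy] at h1
    exact absurd (h1 ▸ rfl) hxy

lemma refl_mul_smul_left {w : AffinePerm m} (hw : w * w = 1) {x : ℤ} (hx : w • x ≠ x) :
    (refl x (w • x) * w) • x = x := by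
  rw [mul_smul, refl_smul_right (not_modEq_of_smul hw hx)]

lemma refl_mul_smul_right {w : AffinePerm m} (hw : w * w = 1) {x : ℤ} (hx : w • x ≠ x) :
    (refl x (w • x) * w) • w • x = w • x := by
  rw [mul_smul, smul_smul_self hw, refl_smul_left (not_modEq_of_smul hw hx)]

/-- A vertex which is moved after removing an arc is moved by the involution, and disjoint from the
arc. -/
lemma smul_ne_of_refl_mul {w : AffinePerm m} (hw : w * w = 1) {x v : ℤ} (hx : w • x ≠ x)
    (hv : (refl x (w • x) * w) • v ≠ v) :
    w • v ≠ v ∧ ¬ v ≡ x [ZMOD m] ∧ ¬ v ≡ w • x [ZMOD m] := by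
  have h1 : ¬ v ≡ x [ZMOD m] :=
    fun h => hv (smul_eq_self_of_modEq (refl_mul_smul_left hw hx) h)
  have h2 : ¬ v ≡ w • x [ZMOD m] :=
    fun h => hv (smul_eq_self_of_modEq (refl_mul_smul_right hw hx) h)
  refine ⟨fun h => hv ?_, h1, h2⟩
  rw [mul_smul, h, refl_smul_of_not h1 h2]

variable [NeZero m] {β : k}

lemma conj (H : CupCapRelations β ρ e) {w : AffinePerm m} {a : A} (h : ArcProduct ρ e w a)
    (g : AffinePerm m) : ArcProduct ρ e (g * w * g⁻¹) (AffineDiagram.conj ρ g a) := by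
  induction h with
  | one =>
    rw [conj_one, mul_one, mul_inv_cancel]
    exact one
  | @mul x y w a hxy hx hy _ ih =>
    have e1 : g * (refl x y * w) * g⁻¹ = refl (g • x) (g • y) * (g * w * g⁻¹) := by
      rw [← mul_assoc g, AffinePerm.mul_refl]
      group
    rw [conj_mul, e1, ← H.arc_smul g hxy]
    refine mul (mt (smul_modEq_smul g).1 hxy) ?_ ?_ ih
    · rw [mul_smul, inv_smul_smul, mul_smul, hx]
    · rw [mul_smul, inv_smul_smul, mul_smul, hy]

/-- Any arc of the involution can be moved to the front. -/
lemma exists_of_smul_ne (H : CupCapRelations β ρ e) {w : AffinePerm m} {a : A}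
    (h : ArcProduct ρ e w a) {x : ℤ} (hx : w • x ≠ x) :
    ∃ a', ArcProduct ρ e (refl x (w • x) * w) a' ∧ a = arc ρ e x (w • x) * a' := by
  have key : ∀ y, w • x = y → ∃ a', ArcProduct ρ e (refl x y * w) a' ∧ a = arc ρ e x y * a' := by
    induction h with
    | one => exact absurd (one_smul _ _) hx
    | @mul z u w a hzu hz hu h ih =>
      rintro y rfl
      rcases modEq_cases m z u x with ⟨n, rfl⟩ | ⟨n, rfl⟩ | ⟨h1, h2⟩
      · rw [mul_smul, smul_add_mul_eq_self hz, refl_smul_left_add hzu, refl_add_mul,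
          H.arc_add_mul hzu, ← mul_assoc, refl_mul_self, one_mul]
        exact ⟨a, h, rfl⟩
      · rw [mul_smul, smul_add_mul_eq_self hu, refl_smul_right_add hzu, refl_add_mul,
          H.arc_add_mul fun h => hzu h.symm, refl_comm u z, ← H.arc_symm hzu, ← mul_assoc,
          refl_mul_self, one_mul]
        exact ⟨a, h, rfl⟩
      · have h1' : ¬ w • x ≡ z [ZMOD m] := by rwa [← hz, smul_modEq_smul]
        have h2' : ¬ w • x ≡ u [ZMOD m] := by rwa [← hu, smul_modEq_smul]
        have e1 : (refl z u * w) • x = w • x := by rw [mul_smul, refl_smul_of_not h1' h2']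
        rw [e1] at hx ⊢
        obtain ⟨a', ha', rfl⟩ := ih hx _ rfl
        have hxw := not_modEq_of_smul h.mul_self hx
        refine ⟨arc ρ e z u * a', ?_, ?_⟩
        · have e2 : (refl x (w • x) : AffinePerm m) * refl z u = refl z u * refl x (w • x) := by
            refine commute_refl_of_smul ?_ ?_
            · exact refl_smul_of_not (fun h => h1 h.symm) (fun h => h1' h.symm)
            · exact refl_smul_of_not (fun h => h2 h.symm) (fun h => h2' h.symm)
          rw [← mul_assoc, e2, mul_assoc]
          refine mul hzu ?_ ?_ ha'
          · rw [mul_smul, hz, refl_smul_of_not (fun h => h1 h.symm) (fun h => h1' h.symm)]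
          · rw [mul_smul, hu, refl_smul_of_not (fun h => h2 h.symm) (fun h => h2' h.symm)]
        · rw [← mul_assoc, ← mul_assoc, H.arc_commute hzu (fun h => h1 h.symm)
            (fun h => h2 h.symm) (fun h => h1' h.symm) (fun h => h2' h.symm) hxw]
  exact key _ rfl

/-- An affine permutation commutes with the cup-caps along arcs which it does not meet. -/
lemma map_mul_comm (H : CupCapRelations β ρ e) {w : AffinePerm m} {a : A}
    (h : ArcProduct ρ e w a) {g : AffinePerm m} (hg : ∀ v : ℤ, w • v ≠ v → g • v = v) :
    ρ g * a = a * ρ g := by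
  induction h with
  | one => rw [one_mul, mul_one]
  | @mul x y w a hxy hx hy h ih =>
    have e1 : g • x = x := hg x fun h' => by
      rw [mul_smul, hx, refl_smul_left hxy] at h'
      exact hxy (h' ▸ rfl)
    have e2 : g • y = y := hg y fun h' => by
      rw [mul_smul, hy, refl_smul_right hxy] at h'
      exact hxy (h' ▸ rfl)
    have e3 : ρ g * arc ρ e x y = arc ρ e x y * ρ g := by
      rw [← conj_eq_iff, ← H.arc_smul g hxy, e1, e2]
    rw [← mul_assoc, e3, mul_assoc, ih, mul_assoc]
    intro v hv
    refine hg v fun h' => hv ?_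
    have h1 : ¬ v ≡ x [ZMOD m] := fun h => hv (smul_eq_self_of_modEq hx h)
    have h2 : ¬ v ≡ y [ZMOD m] := fun h => hv (smul_eq_self_of_modEq hy h)
    rwa [mul_smul, refl_smul_of_not (by rwa [← hx, smul_modEq_smul])
      (by rwa [← hy, smul_modEq_smul])] at h'

/-- The affine permutations which permute the arcs of `w` and fix all other vertices act
transitively on the vertices of the arcs, by elements which the product of the cup-caps absorbs:
windings along an arc, the reflection in an arc, and exchanges of two arcs. -/
lemma exists_absorbed (H : CupCapRelations β ρ e) {w : AffinePerm m} {a : A}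
    (h : ArcProduct ρ e w a) {x z : ℤ} (hx : w • x ≠ x) (hz : w • z ≠ z) :
    ∃ g : AffinePerm m, g • z = x ∧ g * w = w * g ∧ (∀ v : ℤ, w • v = v → g • v = v) ∧
      a * ρ g = a := by
  have hw := h.mul_self
  have hxw := not_modEq_of_smul hw hx
  have hzw := not_modEq_of_smul hw hz
  have hfix : ∀ v : ℤ, w • v = v → ∀ u, w • u ≠ u → ¬ v ≡ u [ZMOD m] ∧ ¬ v ≡ w • u [ZMOD m] := by
    refine fun v hv u hu => ⟨fun h => hu (smul_eq_self_of_modEq hv h.symm), fun h => hu ?_⟩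
    rw [← hv, smul_modEq_smul] at h
    exact smul_eq_self_of_modEq hv h.symm
  obtain ⟨a', ha', hae⟩ := h.exists_of_smul_ne H hx
  -- permutations of the two strands of a single arc
  have single : ∀ g : AffinePerm m, (∀ v, ¬ v ≡ x [ZMOD m] → ¬ v ≡ w • x [ZMOD m] → g • v = v) →
      arc ρ e x (w • x) * ρ g = arc ρ e x (w • x) →
      (∀ v : ℤ, w • v = v → g • v = v) ∧ a * ρ g = a := by
    refine fun g hg hg' => ⟨fun v hv => hg v (hfix v hv x hx).1 (hfix v hv x hx).2, ?_⟩
    rw [hae, mul_assoc, ← ha'.map_mul_comm H, ← mul_assoc, hg']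
    intro v hv
    obtain ⟨-, h1, h2⟩ := smul_ne_of_refl_mul hw hx hv
    exact hg v h1 h2
  have shifts : ∀ n : ℤ, w * (shift x n * shift (w • x) n) = shift x n * shift (w • x) n * w := by
    intro n
    rw [← mul_assoc, mul_shift w x, mul_assoc, mul_shift w, smul_smul_self hw, ← mul_assoc,
      shift_commute]
  rcases modEq_cases m x (w • x) z with ⟨n, rfl⟩ | ⟨n, rfl⟩ | ⟨h1, h2⟩
  · refine ⟨shift x (-n) * shift (w • x) (-n), ?_, (shifts _).symm, single _ ?_ ?_⟩
    · rw [mul_smul, shift_smul_of_not fun h => hxw ((modEq_add_mul x n).trans h),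
        shift_smul_of_modEq (add_mul_modEq x n)]
      ring
    · intro v hv1 hv2
      rw [mul_smul, shift_smul_of_not hv2, shift_smul_of_not hv1]
    · rw [map_mul, H.arc_mul_shift hxw]
  · refine ⟨refl x (w • x) * (shift x (-n) * shift (w • x) (-n)), ?_, ?_, single _ ?_ ?_⟩
    · rw [mul_smul, mul_smul, shift_smul_of_modEq (add_mul_modEq _ n), neg_mul,
        add_neg_cancel_right, shift_smul_of_not fun h => hxw h.symm, refl_smul_right hxw]
    · have e1 : w * refl x (w • x) = refl x (w • x) * w := by
        rw [AffinePerm.mul_refl, smul_smul_self hw, refl_comm]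
      rw [mul_assoc, ← shifts, ← mul_assoc, ← e1, mul_assoc]
    · intro v hv1 hv2
      rw [mul_smul, mul_smul, shift_smul_of_not hv2, shift_smul_of_not hv1,
        refl_smul_of_not hv1 hv2]
    · rw [map_mul, ← mul_assoc, H.arc_mul_refl hxw, map_mul, H.arc_mul_shift hxw]
  · have h3 : ¬ w • z ≡ x [ZMOD m] := by
      rw [← smul_smul_self hw x, smul_modEq_smul]
      exact h2
    have h4 : ¬ w • z ≡ w • x [ZMOD m] := by rwa [smul_modEq_smul]
    have e0 : (refl x (w • x) * w) • z = w • z := by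
      rw [mul_smul, refl_smul_of_not h3 h4]
    obtain ⟨b, hb, rfl⟩ := ha'.exists_of_smul_ne H (x := z) (by rwa [e0])
    rw [e0] at hb hae
    refine ⟨refl x z * refl (w • x) (w • z), ?_, ?_, ?_, ?_⟩
    · rw [mul_smul, refl_smul_of_not h2 hzw, refl_smul_right fun h => h1 h.symm]
    · rw [← mul_assoc, AffinePerm.mul_refl w x z, mul_assoc (refl _ _) w, AffinePerm.mul_refl w,
        smul_smul_self hw, smul_smul_self hw, ← mul_assoc]
      congr 1
      refine commute_refl_of_smul ?_ ?_
      · exact refl_smul_of_not (fun h => hxw h.symm) (fun h => h2 h.symm)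
      · exact refl_smul_of_not h3 fun h => hzw h.symm
    · intro v hv
      rw [mul_smul, refl_smul_of_not (hfix v hv x hx).2 (hfix v hv z hz).2,
        refl_smul_of_not (hfix v hv x hx).1 (hfix v hv z hz).1]
    · have hb' : ρ (refl x z * refl (w • x) (w • z)) * b =
          b * ρ (refl x z * refl (w • x) (w • z)) := by
        refine hb.map_mul_comm H fun v hv => ?_
        have hz' : (refl x (w • x) * w) • z ≠ z := by rwa [e0]
        rw [← e0] at hv
        obtain ⟨hv1, hv2, hv3⟩ := smul_ne_of_refl_mul ha'.mul_self hz' hv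
        obtain ⟨-, hv4, hv5⟩ := smul_ne_of_refl_mul hw hx hv1
        rw [e0] at hv3
        rw [mul_smul, refl_smul_of_not hv5 hv3, refl_smul_of_not hv4 hv2]
      rw [hae, ← mul_assoc, mul_assoc _ b, ← hb', ← mul_assoc, map_mul,
        H.arc_mul_arc_mul_exchange hxw (fun h => h1 h.symm) (fun h => h2 h.symm)
          (fun h => h3 h.symm) (fun h => h4 h.symm) hzw]

/-- The product of the cup-caps along the arcs of `w` is unique, and it absorbs every affine
permutation which permutes the arcs and fixes all other vertices. -/
lemma mul_map_eq (H : CupCapRelations β ρ e) {w : AffinePerm m} {a : A} (h : ArcProduct ρ e w a) :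
    ∀ {b : A} {u : AffinePerm m}, ArcProduct ρ e w b → u * w = w * u →
      (∀ v : ℤ, w • v = v → u • v = v) → a * ρ u = b := by
  induction h with
  | one =>
    intro b u hb _ hu
    obtain rfl : u = 1 := AffinePerm.ext fun v => (hu v (one_smul _ _)).trans (one_smul _ _).symm
    rw [hb.eq_one rfl, map_one, mul_one]
  | @mul x y w a hxy hx hy h ih =>
    have h' : ArcProduct ρ e (refl x y * w) (arc ρ e x y * a) := mul hxy hx hy h
    have hwx : (refl x y * w) • x = y := by rw [mul_smul, hx, refl_smul_left hxy]
    have hyx : y ≠ x := fun h => hxy (h ▸ rfl)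
    -- the case in which the arc at `x` is fixed pointwise
    have fixed : ∀ {b : A} {u : AffinePerm m}, ArcProduct ρ e (refl x y * w) b →
        u * (refl x y * w) = refl x y * w * u →
        (∀ v : ℤ, (refl x y * w) • v = v → u • v = v) → u • x = x →
        arc ρ e x y * a * ρ u = b := by
      intro b u hb huw hu hux
      have huy : u • y = y := by
        rw [← hwx, smul_smul, huw, mul_smul, hux]
      obtain ⟨b', hb', rfl⟩ := hb.exists_of_smul_ne H (x := x) (by rwa [hwx])
      rw [hwx, ← mul_assoc, refl_mul_self, one_mul] at hb'
      rw [hwx, mul_assoc, ih hb']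
      · have h1 := commute_refl_of_smul hux huy
        rw [← mul_assoc, h1, mul_assoc, mul_assoc] at huw
        exact mul_left_cancel huw
      · intro v hv
        by_cases h1 : v ≡ x [ZMOD m]
        · exact smul_eq_self_of_modEq hux h1
        by_cases h2 : v ≡ y [ZMOD m]
        · exact smul_eq_self_of_modEq huy h2
        exact hu v (by rw [mul_smul, hv, refl_smul_of_not h1 h2])
    intro b u hb huw hu
    have hux : (refl x y * w) • u • x ≠ u • x := by
      rw [smul_smul, ← huw, mul_smul, hwx]
      exact fun h => hyx (smul_left_cancel u h)
    obtain ⟨g, hg1, hg2, hg3, hg4⟩ := h'.exists_absorbed H (x := x) (by rwa [hwx]) hux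
    rw [← hg4, mul_assoc, ← map_mul]
    refine fixed hb ?_ ?_ ?_
    · rw [mul_assoc, huw, ← mul_assoc, hg2, mul_assoc]
    · intro v hv
      rw [mul_smul, hu v hv, hg3 v hv]
    · rw [mul_smul, hg1]

end ArcProduct

variable {ρ : AffinePerm m →* A} {e : A}

/-- The span of the normal forms: the products of cup-caps along disjoint arcs and an affine
permutation. -/
def normalSpan (k : Type*) [CommRing k] [Algebra k A] (ρ : AffinePerm m →* A) (e : A) :
    Submodule k A :=
  Submodule.span k {x | ∃ w a g, ArcProduct ρ e w a ∧ x = a * ρ g}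

lemma mul_mem_normalSpan {w : AffinePerm m} {a : A} (h : ArcProduct ρ e w a) (g : AffinePerm m) :
    a * ρ g ∈ normalSpan k ρ e := Submodule.subset_span ⟨w, a, g, h, rfl⟩

variable [NeZero m] {β : k}

lemma map_mul_mem_normalSpan (H : CupCapRelations β ρ e) (g : AffinePerm m) {x : A}
    (hx : x ∈ normalSpan k ρ e) : ρ g * x ∈ normalSpan k ρ e := by
  induction hx using Submodule.span_induction with
  | mem x hx =>
    obtain ⟨w, a, g', h, rfl⟩ := hx
    rw [← mul_assoc, map_mul_eq_conj_mul, mul_assoc, ← map_mul]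
    exact mul_mem_normalSpan (h.conj H g) _
  | zero => rw [mul_zero]; exact Submodule.zero_mem _
  | add x y _ _ hx hy => rw [mul_add]; exact Submodule.add_mem _ hx hy
  | smul r x _ hx => rw [mul_smul_comm]; exact Submodule.smul_mem _ r hx

/-- The case of a cup-cap which meets an arc at the strand of `x`. -/
lemma arc_mul_mem_normalSpan_of_ne (H : CupCapRelations β ρ e) {w : AffinePerm m} {a : A}
    (h : ArcProduct ρ e w a) {x y : ℤ} (hxy : ¬ x ≡ y [ZMOD m]) (hx : w • x ≠ x)
    (g : AffinePerm m) : arc ρ e x y * (a * ρ g) ∈ normalSpan k ρ e := by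
  have hw := h.mul_self
  have hxw := ArcProduct.not_modEq_of_smul hw hx
  have hl := ArcProduct.refl_mul_smul_left hw hx
  have hr := ArcProduct.refl_mul_smul_right hw hx
  obtain ⟨a', ha', rfl⟩ := h.exists_of_smul_ne H hx
  by_cases hy : y ≡ w • x [ZMOD m]
  · obtain ⟨n, hn⟩ := modEq_iff_exists_add_mul.1 hy
    have hy' := smul_eq_self_of_modEq hr hy
    rw [hn] at ha' hl hy' ⊢
    rw [H.arc_symm hxy, H.arc_symm (x := x) (y := y + n * m)
      fun h => hxy (h.trans (add_mul_modEq y n)), mul_assoc, ← mul_assoc (arc ρ e y x),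
      H.arc_mul_arc_add fun h => hxy h.symm, smul_mul_assoc, mul_assoc, ← mul_assoc (ρ _) a',
      map_mul_eq_conj_mul, mul_assoc (AffineDiagram.conj _ _ _), ← map_mul, ← mul_assoc]
    refine Submodule.smul_mem _ _ (mul_mem_normalSpan (ArcProduct.mul (fun h => hxy h.symm) ?_ ?_
      (ha'.conj H _)) _)
    · rw [mul_smul, mul_smul, ← shift_neg, neg_neg, shift_smul_self, smul_add_mul, hy',
        ← shift_smul_self (m := m) y n, smul_smul, shift_neg, inv_mul_cancel, one_smul]
    · rw [mul_smul, mul_smul, ← shift_neg, neg_neg, shift_smul_of_not hxy, hl,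
        shift_smul_of_not hxy]
  · have hyx : ¬ y ≡ x [ZMOD m] := fun h => hxy h.symm
    rw [H.arc_symm hxy, mul_assoc, ← mul_assoc (arc ρ e y x), H.arc_mul_arc hyx hy hxw,
      ← map_mul, mul_assoc, ← mul_assoc (ρ _) a', map_mul_eq_conj_mul,
      mul_assoc (AffineDiagram.conj _ _ _), ← map_mul, ← mul_assoc]
    refine mul_mem_normalSpan (ArcProduct.mul hyx ?_ ?_ (ha'.conj H _)) _
    · rw [mul_smul, mul_smul, mul_inv_rev, refl_inv, refl_inv]
      have e1 : (refl y x * refl x (w • x) : AffinePerm m) • y = x := by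
        rw [mul_smul, refl_smul_of_not hyx hy, refl_smul_left hyx]
      rw [e1, hl, ← e1, smul_smul]
      have e2 : (refl x (w • x) * refl y x : AffinePerm m) * (refl y x * refl x (w • x)) = 1 := by
        rw [mul_assoc, ← mul_assoc (refl y x), refl_mul_self, one_mul, refl_mul_self]
      rw [e1, e2, one_smul]
    · rw [mul_smul, mul_smul, mul_inv_rev, refl_inv, refl_inv]
      have e1 : (refl y x * refl x (w • x) : AffinePerm m) • x = w • x := by
        rw [mul_smul, refl_smul_left hxw, refl_smul_of_not (fun h => hy h.symm)
          (fun h => hxw h.symm)]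
      have e2 : (refl x (w • x) * refl y x : AffinePerm m) • w • x = x := by
        rw [mul_smul, refl_smul_of_not (fun h => hy h.symm) (fun h => hxw h.symm),
          refl_smul_right hxw]
      rw [e1, hr, e2]

lemma arc_mul_mem_normalSpan (H : CupCapRelations β ρ e) {x y : ℤ} (hxy : ¬ x ≡ y [ZMOD m])
    {z : A} (hz : z ∈ normalSpan k ρ e) : arc ρ e x y * z ∈ normalSpan k ρ e := by
  induction hz using Submodule.span_induction with
  | mem z hz =>
    obtain ⟨w, a, g, h, rfl⟩ := hz
    by_cases hx : w • x = x
    · by_cases hy : w • y = y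
      · rw [← mul_assoc]
        exact mul_mem_normalSpan (ArcProduct.mul hxy hx hy h) g
      · rw [H.arc_symm hxy]
        exact arc_mul_mem_normalSpan_of_ne H h (fun h => hxy h.symm) hy g
    · exact arc_mul_mem_normalSpan_of_ne H h hxy hx g
  | zero => rw [mul_zero]; exact Submodule.zero_mem _
  | add x y _ _ hx hy => rw [mul_add]; exact Submodule.add_mem _ hx hy
  | smul r x _ hx => rw [mul_smul_comm]; exact Submodule.smul_mem _ r hx

/-- The normal forms span the subalgebra generated by the affine permutations and the cup-caps. -/
lemma normalSpan_eq_top (H : CupCapRelations β ρ e)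
    (hgen : Algebra.adjoin k
      (Set.range ρ ∪ {a | ∃ x y : ℤ, ¬ x ≡ y [ZMOD m] ∧ a = arc ρ e x y}) = ⊤) :
    normalSpan k ρ e = ⊤ := by
  have key : ∀ x : A, ∀ z ∈ normalSpan k ρ e, x * z ∈ normalSpan k ρ e := by
    intro x
    have hx : x ∈ Algebra.adjoin k
        (Set.range ρ ∪ {a | ∃ x y : ℤ, ¬ x ≡ y [ZMOD m] ∧ a = arc ρ e x y}) :=
      hgen ▸ Algebra.mem_top
    induction hx using Algebra.adjoin_induction with
    | mem x hx =>
      rcases hx with ⟨g, rfl⟩ | ⟨x, y, hxy, rfl⟩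
      · exact fun z hz => map_mul_mem_normalSpan H g hz
      · exact fun z hz => arc_mul_mem_normalSpan H hxy hz
    | algebraMap r =>
      intro z hz
      rw [← Algebra.smul_def]
      exact Submodule.smul_mem _ r hz
    | add x y _ _ hx hy =>
      intro z hz
      rw [add_mul]
      exact Submodule.add_mem _ (hx z hz) (hy z hz)
    | mul x y _ _ hx hy =>
      intro z hz
      rw [mul_assoc]
      exact hx _ (hy z hz)
  refine (Submodule.eq_top_iff').2 fun x => ?_
  have h1 : (1 : A) ∈ normalSpan k ρ e := by
    have := mul_mem_normalSpan (k := k) (ArcProduct.one (ρ := ρ) (e := e)) 1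
    rwa [map_one, mul_one] at this
  have := key x 1 h1
  rwa [mul_one] at this

end NormalForm

/-! ### The presented algebra -/

section Presented

lemma refl_zero_two {m : ℕ} (hm : 3 ≤ m) :
    (refl 0 2 : AffinePerm m) = simple m 1 * simple m 0 * simple m 1 := by
  have h0 := simple_smul_of_ne (m := m) (i := 1) (j := 0) (by omega) (by omega)
    (by omega) (by omega)
  have h1 := simple_smul_self (m := m) (i := 1) (by omega)
  rw [simple_mul (simple m 1) 0, mul_assoc,
    show simple m 1 * simple m 1 = 1 from refl_mul_self _ _, mul_one]
  norm_num at h0 h1 ⊢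
  rw [h0, h1]

lemma refl_one_three {m : ℕ} (hm : 4 ≤ m) :
    (refl 1 3 : AffinePerm m) = simple m 1 * simple m 2 * simple m 1 := by
  have h0 := simple_smul_succ (m := m) (i := 1) (by omega)
  have h1 := simple_smul_of_ne (m := m) (i := 1) (j := 3) (by omega) (by omega)
    (by omega) (by omega)
  rw [simple_mul (simple m 1) 2, mul_assoc,
    show simple m 1 * simple m 1 = 1 from refl_mul_self _ _, mul_one]
  norm_num at h0 h1 ⊢
  rw [h0, h1]

variable {k : Type*} [CommRing k] {m : ℕ} (β : k)

/-- The class of an element of the free algebra in the presented algebra. -/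
noncomputable def toPresented : FreeAlgebra k (Gen m) →ₐ[k] Presented m β :=
  RingQuot.mkAlgHom k (Rel β)

variable {β}

lemma toPresented_rel {x y : FreeAlgebra k (Gen m)} (h : Rel β x y) :
    toPresented β x = toPresented β y := RingQuot.mkAlgHom_rel k h

variable (β)

/-- The unit `s i` of the presented algebra, numbered by a natural number. -/
noncomputable def presS (m : ℕ) (i : ℕ) : (Presented m β)ˣ :=
  if h : i + 1 < m then
    have e : toPresented β (gen k (.s (⟨i, by omega⟩ : Fin (m - 1)))) *
        toPresented β (gen k (.s ⟨i, by omega⟩)) = 1 := by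
      rw [← map_mul, toPresented_rel (Rel.s_sq _), map_one]
    ⟨_, _, e, e⟩
  else 1

/-- The unit `t i` of the presented algebra, numbered by a natural number. -/
noncomputable def presT (m : ℕ) (i : ℕ) : (Presented m β)ˣ :=
  if h : i < m then
    ⟨toPresented β (gen k (.t ⟨i, h⟩)), toPresented β (gen k (.tInv ⟨i, h⟩)),
      by rw [← map_mul, toPresented_rel (Rel.t_inv _), map_one],
      by rw [← map_mul, toPresented_rel (Rel.inv_t _), map_one]⟩
  else 1

/-- The element `e i` of the presented algebra, numbered by a natural number. -/
noncomputable def presE (m : ℕ) (i : ℕ) : Presented m β :=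
  if h : i + 1 < m then toPresented β (gen k (.e ⟨i, by omega⟩)) else 0

variable {β}

lemma presS_val {i : ℕ} (h : i + 1 < m) :
    (presS β m i : Presented m β) = toPresented β (gen k (.s ⟨i, by omega⟩)) := by
  rw [presS, dif_pos h]

lemma presT_val {i : ℕ} (h : i < m) :
    (presT β m i : Presented m β) = toPresented β (gen k (.t ⟨i, h⟩)) := by
  rw [presT, dif_pos h]

lemma presT_inv_val {i : ℕ} (h : i < m) :
    (((presT β m i)⁻¹ : (Presented m β)ˣ) : Presented m β) =
      toPresented β (gen k (.tInv ⟨i, h⟩)) := by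
  rw [presT, dif_pos h]
  rfl

lemma presE_eq {i : ℕ} (h : i + 1 < m) :
    presE β m i = toPresented β (gen k (.e ⟨i, by omega⟩)) := by
  rw [presE, dif_pos h]

lemma presT_zpow_val {i : ℕ} (h : i < m) (a : ℤ) :
    (((presT β m i) ^ a : (Presented m β)ˣ) : Presented m β) =
      toPresented β (tPow k ⟨i, h⟩ a) := by
  cases a with
  | ofNat n =>
    rw [tPow, map_pow, ← presT_val h, Int.ofNat_eq_natCast, zpow_natCast, Units.val_pow_eq_pow_val]
  | negSucc n =>
    rw [tPow, map_pow, ← presT_inv_val h, zpow_negSucc, ← inv_pow, Units.val_pow_eq_pow_val]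

variable (β m) in
lemma presented_affineRelations : AffineRelations m (presS β m) (presT β m) where
  s_mul_self i hi := Units.ext (by
    rw [Units.val_mul, presS_val hi, ← map_mul, toPresented_rel (Rel.s_sq _), map_one,
      Units.val_one])
  s_comm i j h hj := Units.ext (by
    rw [Units.val_mul, Units.val_mul, presS_val (by omega), presS_val hj, ← map_mul, ← map_mul,
      toPresented_rel (Rel.s_comm _ _ (Or.inl h))])
  braid i hi := Units.ext (by
    rw [Units.val_mul, Units.val_mul, Units.val_mul, Units.val_mul, presS_val (by omega),
      presS_val (i := i + 1) (by omega), ← map_mul, ← map_mul, ← map_mul, ← map_mul,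
      toPresented_rel (Rel.braid _ _ rfl)])
  s_t_comm_of_lt i j h hj := Units.ext (by
    rw [Units.val_mul, Units.val_mul, presS_val (by omega), presT_val hj, ← map_mul, ← map_mul,
      toPresented_rel (Rel.s_t_comm _ _ (Or.inl h))])
  s_t_comm_of_gt i j h hi := Units.ext (by
    rw [Units.val_mul, Units.val_mul, presS_val hi, presT_val (by omega), ← map_mul, ← map_mul,
      toPresented_rel (Rel.s_t_comm _ _ (Or.inr h))])
  t_comm i j hi hj := Units.ext (by
    rw [Units.val_mul, Units.val_mul, presT_val hi, presT_val hj, ← map_mul, ← map_mul,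
      toPresented_rel (Rel.t_comm _ _)])
  s_t i hi := Units.ext (by
    rw [Units.val_mul, Units.val_mul, presS_val hi, presT_val (by omega), presT_val hi, ← map_mul,
      ← map_mul]
    exact toPresented_rel (Rel.s_t _))

variable [NeZero m]

variable (β m) in
/-- The affine permutations in the presented algebra. -/
noncomputable def presPerm : AffinePerm m →* Presented m β :=
  (Units.coeHom _).comp (presented_affineRelations m β).lift

lemma presPerm_simple {i : ℕ} (hi : i + 1 < m) :
    presPerm m β (simple m i) = toPresented β (gen k (.s ⟨i, by omega⟩)) := by
  rw [← presS_val hi, ← (presented_affineRelations m β).lift_simple hi]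
  rfl

lemma presPerm_wind {i : ℕ} (hi : i < m) :
    presPerm m β (wind m i) = toPresented β (gen k (.t ⟨i, hi⟩)) := by
  rw [← presT_val hi, ← (presented_affineRelations m β).lift_wind hi]
  rfl

lemma presPerm_wind_inv {i : ℕ} (hi : i < m) :
    presPerm m β (wind m i)⁻¹ = toPresented β (gen k (.tInv ⟨i, hi⟩)) := by
  rw [← presT_inv_val hi, ← (presented_affineRelations m β).lift_wind hi, ← map_inv]
  rfl

lemma presPerm_shift {i : ℕ} (hi : i < m) (a : ℤ) :
    presPerm m β (shift i a) = toPresented β (tPow k ⟨i, hi⟩ a) := by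
  rw [← presT_zpow_val hi, ← (presented_affineRelations m β).lift_wind hi, ← map_zpow,
    shift_eq_zpow]
  rfl

/-- An affine permutation which fixes `0` and `1` is a product of generators which commute with
`e 0`. -/
lemma presPerm_mul_presE (g : AffinePerm m) (h0 : g • (0 : ℤ) = 0) (h1 : g • (1 : ℤ) = 1) :
    presPerm m β g * presE β m 0 = presE β m 0 * presPerm m β g := by
  by_cases hm : 0 + 1 < m
  · have hg := (presented_affineRelations m β).lift_mem_tail (k := 2) (g := g) (by omega) (by
      intro j hj
      interval_cases j
      · exact h0
      · exact h1)
    have key : ∀ u ∈ AffineRelations.tail m (presS β m) (presT β m) 2,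
        Commute (u : Presented m β) (presE β m 0) := by
      intro u hu
      induction hu using Subgroup.closure_induction with
      | mem u hu =>
        rcases hu with ⟨i, h1, h2, rfl⟩ | ⟨i, h1, h2, rfl⟩
        · rw [presS_val h2, presE_eq hm, Commute, SemiconjBy, ← map_mul, ← map_mul,
            toPresented_rel (Rel.s_e_comm _ _ (Or.inr (show 0 + 1 < i from h1)))]
        · rw [presT_val h2, presE_eq hm, Commute, SemiconjBy, ← map_mul, ← map_mul,
            toPresented_rel (Rel.e_t_comm _ _ (Or.inl (show 0 + 1 < i from h1)))]
      | one => exact Commute.one_left _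
      | mul u v _ _ hu hv =>
        rw [Units.val_mul]
        exact hu.mul_left hv
      | inv u _ hu => exact hu.units_inv_left
    exact (key _ hg).eq
  · rw [presE, dif_neg hm, mul_zero, zero_mul]

/-- The elements `e i` are conjugate to `e 0`. -/
lemma arc_presE {i : ℕ} (hi : i + 1 < m) :
    arc (presPerm m β) (presE β m 0) i (i + 1) = presE β m i := by
  have key : ∀ i, i + 1 < m → ∃ g : AffinePerm m, g • (0 : ℤ) = i ∧ g • (1 : ℤ) = i + 1 ∧
      conj (presPerm m β) g (presE β m 0) = presE β m i := by
    intro i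
    induction i with
    | zero =>
      intro _
      exact ⟨1, one_smul _ _, one_smul _ _, by
        rw [conj, inv_one, map_one, one_mul, mul_one]⟩
    | succ i ih =>
      intro hi
      obtain ⟨g, h0, h1, hg⟩ := ih (by omega)
      refine ⟨simple m i * simple m (i + 1) * g, ?_, ?_, ?_⟩
      · rw [mul_smul, h0, mul_smul, simple_smul_of_ne hi (by omega) (by omega) (by omega),
          simple_smul_self (by omega)]
        push_cast
        rfl
      · rw [mul_smul, h1, mul_smul, ← Nat.cast_succ, simple_smul_self hi, ← Nat.cast_succ,
          simple_smul_of_ne (by omega) hi (by omega) (by omega)]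
      · rw [← conj_conj, hg, conj_eq_iff, map_mul, presPerm_simple (by omega),
          presPerm_simple (by omega), presE_eq (by omega), presE_eq hi, ← mul_assoc, ← map_mul,
          ← map_mul, ← map_mul, ← map_mul, toPresented_rel (Rel.s_s_e _ _ (Or.inl rfl)),
          toPresented_rel (Rel.e_s_s _ _ (Or.inr rfl))]
  obtain ⟨g, h0, h1, hg⟩ := key i hi
  rw [← h0, show g • (0 : ℤ) + 1 = g • (1 : ℤ) by rw [h0, h1], arc_eq_conj presPerm_mul_presE, hg]

variable (β m) in
/-- The exchange of two arcs is absorbed since `e 0 * e 2 * (s 1 * s 0 * s 2 * s 1)` is equal to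
`e 2 * e 0 * e 1 * s 2 * s 1 = e 0 * e 2 * e 1 * e 2 = e 0 * e 2`. -/
lemma presented_cupCapRelations : CupCapRelations β (presPerm m β) (presE β m 0) := by
  have r01 : (refl 0 1 : AffinePerm m) = simple m 0 := by simp [simple]
  have r12 : (refl 1 2 : AffinePerm m) = simple m 1 := by norm_num [simple]
  have t0 : (shift 0 1 : AffinePerm m) = wind m 0 := by simp [wind]
  have t1 : (shift 1 1 : AffinePerm m) = wind m 1 := by simp [wind]
  have a1 : 3 ≤ m → arc (presPerm m β) (presE β m 0) 1 2 = presE β m 1 := fun hm => by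
    exact_mod_cast arc_presE (β := β) (m := m) (i := 1) (by omega)
  have a2 : 4 ≤ m → arc (presPerm m β) (presE β m 0) 2 3 = presE β m 2 := fun hm => by
    exact_mod_cast arc_presE (β := β) (m := m) (i := 2) (by omega)
  have ess : ∀ i j, i + 1 < m → j + 1 < m → (j = i + 1 ∨ i = j + 1) →
      presE β m i * (presPerm m β (simple m j) * presPerm m β (simple m i)) =
        presE β m i * presE β m j := by
    intro i j hi hj hij
    rw [presE_eq hi, presE_eq hj, presPerm_simple hi, presPerm_simple hj, ← mul_assoc, ← map_mul,
      ← map_mul, ← map_mul, toPresented_rel (Rel.e_s_s _ _ hij)]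
  have ec : 4 ≤ m → presE β m 0 * presE β m 2 = presE β m 2 * presE β m 0 := fun hm => by
    rw [presE_eq (by omega), presE_eq (by omega), ← map_mul, ← map_mul,
      toPresented_rel (Rel.e_comm _ _ (Or.inl (by simp)))]
  exact
    { stab := presPerm_mul_presE
      refl_mul := fun hm => by
        rw [r01, presPerm_simple hm, presE_eq hm, ← map_mul, toPresented_rel (Rel.s_e _)]
      mul_refl := fun hm => by
        rw [r01, presPerm_simple hm, presE_eq hm, ← map_mul, toPresented_rel (Rel.e_s _)]
      shift_mul := fun hm => by
        rw [t0, t1, presPerm_wind (by omega), presPerm_wind hm, presE_eq hm, ← map_mul, ← map_mul]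
        exact toPresented_rel (Rel.t_t_e (⟨0, by omega⟩ : Fin (m - 1)))
      mul_shift := fun hm => by
        rw [t0, t1, presPerm_wind (by omega), presPerm_wind hm, presE_eq hm, ← mul_assoc,
          ← map_mul, ← map_mul]
        exact toPresented_rel (Rel.e_t_t (⟨0, by omega⟩ : Fin (m - 1)))
      mul_shift_mul := fun hm n => by
        have t0n : (shift 0 n : AffinePerm m) = shift ((0 : ℕ) : ℤ) n := by simp
        rw [t0n, presPerm_shift (by omega), presE_eq hm, ← map_mul, ← map_mul, ← map_smul]
        exact toPresented_rel (Rel.e_t_e _ n)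
      mul_arc := fun hm => by
        rw [a1 hm, r01, r12, ess 0 1 (by omega) (by omega) (Or.inl rfl)]
      arc_comm := fun hm => by rw [a2 hm, ec hm]
      exchange := fun hm => by
        -- the exchange of the first two pairs of strands is `s 1 * s 0 * s 2 * s 1`
        have e1 : (refl 0 2 * refl 1 3 : AffinePerm m) =
            simple m 1 * simple m 0 * (simple m 2 * simple m 1) := by
          rw [refl_zero_two (by omega), refl_one_three hm]
          simp only [mul_assoc]
          rw [← mul_assoc (simple m 1) (simple m 1),
            show simple m 1 * simple m 1 = 1 from refl_mul_self _ _, one_mul]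
        have e2 : presE β m 2 * presE β m 1 * presE β m 2 = presE β m 2 := by
          rw [presE_eq (by omega), presE_eq (by omega), ← map_mul, ← map_mul,
            toPresented_rel (Rel.e_e_e _ _ (Or.inr rfl))]
        rw [a2 hm, ← map_mul, e1, map_mul, map_mul, map_mul, ec hm, ← mul_assoc,
          mul_assoc (presE β m 2), ess 0 1 (by omega) (by omega) (Or.inl rfl),
          ← mul_assoc (presE β m 2), ← ec hm, mul_assoc (_ * _),
          ess 1 2 (by omega) (by omega) (Or.inl rfl), mul_assoc, ← mul_assoc (presE β m 2), e2] }

lemma exists_presPerm_eq_tau : ∃ g : AffinePerm m,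
    presPerm m β g = toPresented β (gen k .tau) ∧
      presPerm m β g⁻¹ = toPresented β (gen k .tauInv) := by
  have hm := Nat.pos_of_ne_zero (NeZero.ne m)
  have h1 : toPresented β (gen k (.tau : Gen m)) * toPresented β (gen k .tauInv) = 1 := by
    rw [← map_mul, toPresented_rel Rel.tau_inv, map_one]
  obtain ⟨g, hg⟩ : ∃ g, presPerm m β g = toPresented β (gen k .tau) := by
    refine ⟨wind m 0 * (List.ofFn fun i : Fin (m - 1) => simple m i).prod, ?_⟩
    rw [toPresented_rel (Rel.tau_eq ⟨0, hm⟩ rfl), map_mul, map_mul, presPerm_wind hm, map_list_prod,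
      map_list_prod, List.map_ofFn, List.map_ofFn]
    congr 3
    funext i
    exact presPerm_simple (by omega)
  refine ⟨g, hg, ?_⟩
  have h2 := map_inv_mul (presPerm m β) g
  rw [hg] at h2
  exact left_inv_eq_right_inv h2 h1

lemma presented_adjoin : Algebra.adjoin k (Set.range (presPerm m β) ∪
    {a | ∃ x y : ℤ, ¬ x ≡ y [ZMOD m] ∧ a = arc (presPerm m β) (presE β m 0) x y}) = ⊤ := by
  rw [eq_top_iff]
  intro x _
  obtain ⟨y, rfl⟩ := RingQuot.mkAlgHom_surjective k (Rel (m := m) β) x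
  change toPresented β y ∈ _
  induction y using FreeAlgebra.induction with
  | grade0 r => rw [AlgHom.commutes]; exact Subalgebra.algebraMap_mem _ r
  | mul x y hx hy => rw [map_mul]; exact Subalgebra.mul_mem _ (hx trivial) (hy trivial)
  | add x y hx hy => rw [map_add]; exact Subalgebra.add_mem _ (hx trivial) (hy trivial)
  | grade1 g =>
    refine Algebra.subset_adjoin ?_
    obtain ⟨c, hc, hc'⟩ := exists_presPerm_eq_tau (m := m) (β := β)
    cases g with
    | tau => exact Or.inl ⟨c, hc⟩
    | tauInv => exact Or.inl ⟨c⁻¹, hc'⟩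
    | s i => exact Or.inl ⟨_, presPerm_simple (i := i) (by omega)⟩
    | t i => exact Or.inl ⟨_, presPerm_wind i.2⟩
    | tInv i => exact Or.inl ⟨_, presPerm_wind_inv i.2⟩
    | e i =>
      have hi : (i : ℕ) + 1 < m := by omega
      refine Or.inr ⟨i, i + 1, not_modEq_succ hi, ?_⟩
      rw [arc_presE hi, presE_eq hi]

end Presented

/-! ### Normal diagrams -/

section BrauerDiagrams

variable {m : ℕ}

open Classical in
/-- The component of a vertex at position `v` in the row `b`, where the arcs of the row are those of
the involution `w`, and the vertices fixed by `w` are joined to the other row. -/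
noncomputable def label (w : AffinePerm m) (v : ℤ) (b : Bool) : Sym2 ℤ × Option Bool :=
  (s(v, w • v), if w • v = v then none else some b)

lemma label_eq_iff {w : AffinePerm m} (hw : w * w = 1) {v v' : ℤ} {b b' : Bool} :
    label w v b = label w v' b' ↔
      (v' = v ∨ v' = w • v) ∧ (w • v = v ∨ b = b') := by
  have hs : s(v, w • v) = s(v', w • v') ↔ v' = v ∨ v' = w • v := by
    rw [Sym2.eq_iff]
    constructor
    · rintro (⟨h, -⟩ | ⟨-, h⟩)
      · exact Or.inl h.symm
      · exact Or.inr h.symm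
    · rintro (rfl | rfl)
      · exact Or.inl ⟨rfl, rfl⟩
      · exact Or.inr ⟨(ArcProduct.smul_smul_self hw v).symm, rfl⟩
  rw [label, label, Prod.mk.injEq, hs, and_congr_right_iff]
  intro h
  have h' : w • v' = v' ↔ w • v = v := by
    rcases h with rfl | rfl
    · rfl
    · rw [ArcProduct.smul_smul_self hw, eq_comm]
  by_cases h1 : w • v = v <;> simp [h1, h']

/-- The diagram whose top arcs are the arcs of the involution `w`, and which is obtained from it by
stacking it on the diagram of the bijection `g`: the bottom vertex `u` is at the position
`g • u`. -/
noncomputable def normalDiagram (w g : AffinePerm m) : Diagram m where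
  part := Setoid.ker fun p : ℤ × Bool => label w (if p.2 then p.1 else g • p.1) p.2
  invariant := by
    have key : ∀ (v v' : ℤ) (b b' : Bool),
        label w (v + m) b = label w (v' + m) b' ↔ label w v b = label w v' b' := by
      intro v v' b b'
      have e1 : ∀ v : ℤ, w • (v + m) = w • v + m := fun v => by simpa using smul_add_mul w v 1
      simp only [label, e1, Prod.mk.injEq, add_left_inj, Sym2.eq_iff]
    rintro ⟨x, b⟩ ⟨y, c⟩
    have e2 : ∀ v : ℤ, g • (v + m) = g • v + m := fun v => by simpa using smul_add_mul g v 1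
    have e3 : ∀ (v : ℤ) (b : Bool), (if b then v + m else g • (v + m)) =
        (if b then v else g • v) + m := fun v b => by cases b <;> simp [e2]
    simp only [translate, Setoid.ker_def]
    rw [e3, e3, key]

lemma normalDiagram_part {w g : AffinePerm m} (p q : ℤ × Bool) :
    (normalDiagram w g).part p q ↔ label w (if p.2 then p.1 else g • p.1) p.2 =
      label w (if q.2 then q.1 else g • q.1) q.2 := Iff.rfl

lemma normalDiagram_top_top {w g : AffinePerm m} (hw : w * w = 1) {v v' : ℤ} :
    (normalDiagram w g).part (v, true) (v', true) ↔ v' = v ∨ v' = w • v := by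
  rw [normalDiagram_part, label_eq_iff hw]
  simp

lemma normalDiagram_top_bottom {w g : AffinePerm m} (hw : w * w = 1) {v u : ℤ} :
    (normalDiagram w g).part (v, true) (u, false) ↔ w • v = v ∧ g • u = v := by
  rw [normalDiagram_part, label_eq_iff hw]
  simp only [if_true, Bool.false_eq_true, if_false, Bool.true_eq_false, or_false]
  constructor
  · rintro ⟨h | h, h'⟩
    · exact ⟨h', h⟩
    · exact ⟨h', h.trans h'⟩
  · rintro ⟨h, h'⟩
    exact ⟨Or.inl h', h⟩

lemma normalDiagram_bottom_bottom {w g : AffinePerm m} (hw : w * w = 1) {u u' : ℤ} :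
    (normalDiagram w g).part (u, false) (u', false) ↔ u' = u ∨ g • u' = w • g • u := by
  rw [normalDiagram_part, label_eq_iff hw]
  simp

/-- A normal diagram is generated by its edges. -/
lemma normalDiagram_part_le {w g : AffinePerm m} (hw : w * w = 1) {S : Setoid (ℤ × Bool)}
    (h1 : ∀ v : ℤ, w • v ≠ v → S (v, true) (w • v, true))
    (h2 : ∀ v : ℤ, w • v ≠ v → S (g⁻¹ • v, false) (g⁻¹ • w • v, false))
    (h3 : ∀ v : ℤ, w • v = v → S (v, true) (g⁻¹ • v, false)) : (normalDiagram w g).part ≤ S := by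
  rintro ⟨v, b⟩ ⟨v', b'⟩ h
  cases b <;> cases b'
  · rcases (normalDiagram_bottom_bottom hw).1 h with rfl | h
    · exact S.refl' _
    · by_cases hv : w • g • v = g • v
      · rw [hv] at h
        rw [smul_left_cancel g h]
      · have := h2 _ hv
        rwa [← h, inv_smul_smul, inv_smul_smul] at this
  · obtain ⟨hv, rfl⟩ := (normalDiagram_top_bottom hw).1 ((normalDiagram w g).part.symm' h)
    have := h3 _ hv
    rw [inv_smul_smul] at this
    exact S.symm' this
  · obtain ⟨hv, rfl⟩ := (normalDiagram_top_bottom hw).1 h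
    have := h3 _ hv
    rwa [inv_smul_smul] at this
  · rcases (normalDiagram_top_top hw).1 h with rfl | rfl
    · exact S.refl' _
    · by_cases hv : w • v = v
      · rw [hv]
      · exact h1 v hv

lemma normalDiagram_mul_le {w g u : AffinePerm m} (hw : w * w = 1) (hu : u * w = w * u)
    (hf : ∀ v : ℤ, w • v = v → u • v = v) :
    (normalDiagram w (u * g)).part ≤ (normalDiagram w g).part := by
  refine normalDiagram_part_le hw (fun v _ => ?_) (fun v _ => ?_) (fun v hv => ?_)
  · exact (normalDiagram_top_top hw).2 (Or.inr rfl)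
  · refine (normalDiagram_bottom_bottom hw).2 (Or.inr ?_)
    have hu' : u⁻¹ * w = w * u⁻¹ := by
      rw [inv_mul_eq_iff_eq_mul, ← mul_assoc, hu, mul_inv_cancel_right]
    rw [mul_inv_rev, mul_smul, mul_smul, smul_inv_smul, smul_inv_smul, smul_smul, hu', mul_smul]
  · refine (normalDiagram_top_bottom hw).2 ⟨hv, ?_⟩
    rw [mul_inv_rev, mul_smul, smul_inv_smul, inv_smul_eq_iff, hf v hv]

/-- A normal diagram is not changed by an affine permutation which permutes the arcs and fixes all
other vertices. -/
lemma normalDiagram_mul {w g u : AffinePerm m} (hw : w * w = 1) (hu : u * w = w * u)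
    (hf : ∀ v : ℤ, w • v = v → u • v = v) : normalDiagram w (u * g) = normalDiagram w g := by
  refine Diagram.ext (le_antisymm (normalDiagram_mul_le hw hu hf) ?_)
  have := normalDiagram_mul_le (g := u * g) (u := u⁻¹) hw
    (by rw [inv_mul_eq_iff_eq_mul, ← mul_assoc, hu, mul_inv_cancel_right])
    (fun v hv => by rw [inv_smul_eq_iff, hf v hv])
  rwa [inv_mul_cancel_left] at this

/-- A normal diagram determines its arcs, and the bijection up to the ambiguity described in
`normalDiagram_mul`. -/
lemma eq_of_normalDiagram_eq {w g w' g' : AffinePerm m} (hw : w * w = 1) (hw' : w' * w' = 1)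
    (h : normalDiagram w g = normalDiagram w' g') :
    w = w' ∧ g * g'⁻¹ * w = w * (g * g'⁻¹) ∧ ∀ v : ℤ, w • v = v → (g * g'⁻¹) • v = v := by
  obtain rfl : w = w' := by
    ext v
    have h1 : (normalDiagram w g).part (v, true) (w • v, true) :=
      (normalDiagram_top_top hw).2 (Or.inr rfl)
    have h2 : (normalDiagram w' g').part (v, true) (w' • v, true) :=
      (normalDiagram_top_top hw').2 (Or.inr rfl)
    rw [h, normalDiagram_top_top hw'] at h1
    rw [← h, normalDiagram_top_top hw] at h2
    rcases h1 with h1 | h1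
    · rcases h2 with h2 | h2
      · rw [h1, h2]
      · exact h2.symm
    · exact h1
  have e1 : g⁻¹ * w * g = g'⁻¹ * w * g' := by
    ext u
    have key : ∀ g : AffinePerm m, (g⁻¹ * w * g) • u = g⁻¹ • w • g • u := fun g => by
      rw [mul_smul, mul_smul]
    have h1 : (normalDiagram w g).part (u, false) (g⁻¹ • w • g • u, false) :=
      (normalDiagram_bottom_bottom hw).2 (Or.inr (smul_inv_smul _ _))
    have h2 : (normalDiagram w g').part (u, false) (g'⁻¹ • w • g' • u, false) :=
      (normalDiagram_bottom_bottom hw).2 (Or.inr (smul_inv_smul _ _))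
    rw [h, normalDiagram_bottom_bottom hw] at h1
    rw [← h, normalDiagram_bottom_bottom hw] at h2
    rw [key, key]
    rcases h1 with h1 | h1
    · rcases h2 with h2 | h2
      · rw [h1, h2]
      · exact (eq_inv_smul_iff.2 h2).symm
    · exact eq_inv_smul_iff.2 h1
  refine ⟨rfl, ?_, fun v hv => ?_⟩
  · calc g * g'⁻¹ * w = g * (g'⁻¹ * w * g') * g'⁻¹ := by group
      _ = w * (g * g'⁻¹) := by rw [← e1]; group
  · have h1 : (normalDiagram w g').part (v, true) (g'⁻¹ • v, false) :=
      (normalDiagram_top_bottom hw).2 ⟨hv, smul_inv_smul _ _⟩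
    rw [← h, normalDiagram_top_bottom hw] at h1
    rw [mul_smul, h1.2]

/-! ### Components of a stack -/

/-- A labelling of the three rows such that joined vertices have the same label is constant on the
components of the stack. -/
lemma eq_of_stack {X L : Type} {R R' : Setoid (X × Bool)} (f : X × Fin 3 → L)
    (hR : R ≤ Setoid.ker (f ∘ upper)) (hR' : R' ≤ Setoid.ker (f ∘ lower)) {p q : X × Fin 3}
    (hpq : stack R R' p q) : f p = f q := by
  replace hpq : Relation.EqvGen _ p q := hpq
  induction hpq with
  | rel p q h =>
    rcases h with ⟨x, y, h, rfl, rfl⟩ | ⟨x, y, h, rfl, rfl⟩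
    · exact hR h
    · exact hR' h
  | refl p => rfl
  | symm p q _ ih => exact ih.symm
  | trans p q r _ _ ih1 ih2 => exact ih1.trans ih2

/-- A stack is computed by a labelling of its three rows such that outer vertices with the same
label are joined. -/
lemma comp_eq_ker {X L : Type} {R R' : Setoid (X × Bool)} {F : X × Bool → L} (f : X × Fin 3 → L)
    (hR : R ≤ Setoid.ker (f ∘ upper)) (hR' : R' ≤ Setoid.ker (f ∘ lower)) (hF : f ∘ outer = F)
    (h : Setoid.ker F ≤ (stack R R').comap outer) : comp R R' = Setoid.ker F := by
  refine le_antisymm ?_ h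
  intro p q hpq
  subst hF
  exact eq_of_stack f hR hR' hpq

lemma stack_upper {X : Type} {R R' : Setoid (X × Bool)} {p q : X × Bool} (h : R p q) :
    stack R R' (upper p) (upper q) := Relation.EqvGen.rel _ _ (Or.inl ⟨p, q, h, rfl, rfl⟩)

lemma stack_lower {X : Type} {R R' : Setoid (X × Bool)} {p q : X × Bool} (h : R' p q) :
    stack R R' (lower p) (lower q) := Relation.EqvGen.rel _ _ (Or.inr ⟨p, q, h, rfl, rfl⟩)

lemma stack_le_stack_onCylinder (D D' : Diagram m) {p q : ℤ × Fin 3}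
    (h : stack D.part D'.part p q) : stack D.onCylinder D'.onCylinder p q :=
  (stack_onCylinder D D' p q).2 ⟨0, by simpa [translate_zero] using h⟩

/-- There are no closed components if every vertex of the middle row is joined to another row. -/
lemma loops_eq_zero {D D' : Diagram m}
    (h : ∀ v : ℤ, ∃ p, stack D.part D'.part (outer p) (v, 1)) : D.loops D' = 0 := by
  have e : closedComponents D.onCylinder D'.onCylinder = ∅ := by
    rw [Set.eq_empty_iff_forall_notMem]
    rintro _ ⟨⟨⟨x, i⟩, rfl⟩, hc⟩
    have h1 : i = 1 := hc (x, i) (Setoid.refl' (stack D.onCylinder D'.onCylinder) _)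
    subst h1
    obtain ⟨⟨v, b⟩, hp⟩ := h x
    have h2 := hc _ (stack_le_stack_onCylinder D D' hp)
    cases b <;> exact absurd h2 (by simp [outer])
  rw [Diagram.loops, e, Set.ncard_empty]

end BrauerDiagrams

/-! ### Stacking normal diagrams -/

section Products

variable {m : ℕ}

/-- The label of a vertex of the normal diagram of `w` and `g`. -/
noncomputable def vertexLabel (w g : AffinePerm m) (p : ℤ × Bool) : Sym2 ℤ × Option Bool :=
  label w (if p.2 then p.1 else g • p.1) p.2

lemma normalDiagram_part_eq (w g : AffinePerm m) :
    (normalDiagram w g).part = Setoid.ker (vertexLabel w g) := rfl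

lemma label_of_fixed {w : AffinePerm m} {v : ℤ} (hv : w • v = v) (b b' : Bool) :
    label w v b = label w v b' := by
  rw [label, label, if_pos hv, if_pos hv]

lemma label_smul {w : AffinePerm m} (hw : w * w = 1) (v : ℤ) (b : Bool) :
    label w (w • v) b = label w v b := by
  rw [label_eq_iff hw, ArcProduct.smul_smul_self hw]
  exact ⟨Or.inr rfl, Or.inr rfl⟩

/-- The diagram of an affine permutation: the bottom vertex `u` is joined to the top vertex
`g • u`. -/
noncomputable abbrev permDiagram (g : AffinePerm m) : Diagram m := normalDiagram 1 g

/-- The diagram with the translates of a cup and a cap at the vertices `x` and `y`, and vertical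
lines elsewhere. -/
noncomputable abbrev arcDiagram (x y : ℤ) : Diagram m := normalDiagram (refl x y) 1

lemma permDiagram_part_le {g : AffinePerm m} {S : Setoid (ℤ × Bool)}
    (h : ∀ v : ℤ, S (v, true) (g⁻¹ • v, false)) : (permDiagram g).part ≤ S :=
  normalDiagram_part_le (mul_one 1) (fun _ hv => absurd (one_smul _ _) hv)
    (fun _ hv => absurd (one_smul _ _) hv) fun v _ => h v

lemma permDiagram_top_bottom (g : AffinePerm m) (v : ℤ) :
    (permDiagram g).part (v, true) (g⁻¹ • v, false) :=
  (normalDiagram_top_bottom (mul_one 1)).2 ⟨one_smul _ _, smul_inv_smul _ _⟩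

lemma arcDiagram_part_le {x y : ℤ} (hxy : ¬ x ≡ y [ZMOD m]) {S : Setoid (ℤ × Bool)}
    (h1 : ∀ (n : ℤ) (b : Bool), S (x + n * m, b) (y + n * m, b))
    (h2 : ∀ v : ℤ, ¬ v ≡ x [ZMOD m] → ¬ v ≡ y [ZMOD m] → S (v, true) (v, false)) :
    (arcDiagram x y : Diagram m).part ≤ S := by
  have h3 : ∀ (b : Bool) (v : ℤ), (refl x y : AffinePerm m) • v ≠ v →
      S (v, b) ((refl x y : AffinePerm m) • v, b) := by
    intro b v hv
    rcases modEq_cases m x y v with ⟨n, rfl⟩ | ⟨n, rfl⟩ | ⟨hx, hy⟩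
    · rw [refl_smul_left_add hxy]
      exact h1 n b
    · rw [refl_smul_right_add hxy]
      exact S.symm' (h1 n b)
    · exact absurd (refl_smul_of_not hx hy) hv
  refine normalDiagram_part_le (refl_mul_self x y) (h3 true) ?_ ?_
  · intro v hv
    rw [inv_one, one_smul, one_smul]
    exact h3 false v hv
  · intro v hv
    rw [inv_one, one_smul]
    rcases modEq_cases m x y v with ⟨n, rfl⟩ | ⟨n, rfl⟩ | ⟨hx, hy⟩
    · rw [refl_smul_left_add hxy, add_left_inj] at hv
      exact absurd (hv ▸ rfl) hxy
    · rw [refl_smul_right_add hxy, add_left_inj] at hv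
      exact absurd (hv ▸ rfl) hxy
    · exact h2 v hx hy

lemma arcDiagram_arc {x y : ℤ} (hxy : ¬ x ≡ y [ZMOD m]) (n : ℤ) (b : Bool) :
    (arcDiagram x y : Diagram m).part (x + n * m, b) (y + n * m, b) := by
  cases b
  · refine (normalDiagram_bottom_bottom (refl_mul_self x y)).2 (Or.inr ?_)
    rw [one_smul, one_smul, refl_smul_left_add hxy]
  · refine (normalDiagram_top_top (refl_mul_self x y)).2 (Or.inr ?_)
    rw [refl_smul_left_add hxy]

lemma arcDiagram_through {x y v : ℤ} (hx : ¬ v ≡ x [ZMOD m]) (hy : ¬ v ≡ y [ZMOD m]) :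
    (arcDiagram x y : Diagram m).part (v, true) (v, false) :=
  (normalDiagram_top_bottom (refl_mul_self x y)).2 ⟨refl_smul_of_not hx hy, one_smul _ _⟩

lemma normalDiagram_top_arc {w g : AffinePerm m} (hw : w * w = 1) (v : ℤ) :
    (normalDiagram w g).part (v, true) (w • v, true) :=
  (normalDiagram_top_top hw).2 (Or.inr rfl)

lemma normalDiagram_bottom_arc {w g : AffinePerm m} (hw : w * w = 1) (v : ℤ) :
    (normalDiagram w g).part (g⁻¹ • v, false) (g⁻¹ • w • v, false) :=
  (normalDiagram_bottom_bottom hw).2 (Or.inr (by rw [smul_inv_smul, smul_inv_smul]))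

lemma normalDiagram_through {w g : AffinePerm m} (hw : w * w = 1) {v : ℤ} (hv : w • v = v) :
    (normalDiagram w g).part (v, true) (g⁻¹ • v, false) :=
  (normalDiagram_top_bottom hw).2 ⟨hv, smul_inv_smul _ _⟩

/-- A labelling of the three rows of a stack, given row by row. -/
def rowLabel {L : Type} (f0 f1 f2 : ℤ → L) (p : ℤ × Fin 3) : L := ![f0, f1, f2] p.2 p.1

lemma rowLabel_outer {L : Type} (f0 f1 f2 : ℤ → L) :
    rowLabel f0 f1 f2 ∘ outer = fun p => if p.2 then f2 p.1 else f0 p.1 := by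
  funext ⟨v, b⟩
  cases b <;> rfl

section Stacks

variable {D D' : Diagram m}

lemma stack_top_middle {v u : ℤ} (h : D.part (v, true) (u, false)) :
    stack D.part D'.part (v, 2) (u, 1) := stack_upper h

lemma stack_top_top {v u : ℤ} (h : D.part (v, true) (u, true)) :
    stack D.part D'.part (v, 2) (u, 2) := stack_upper h

lemma stack_middle_middle {v u : ℤ} (h : D.part (v, false) (u, false)) :
    stack D.part D'.part (v, 1) (u, 1) := stack_upper h

lemma stack_middle_bottom {v u : ℤ} (h : D'.part (v, true) (u, false)) :
    stack D.part D'.part (v, 1) (u, 0) := stack_lower h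

lemma stack_middle_middle' {v u : ℤ} (h : D'.part (v, true) (u, true)) :
    stack D.part D'.part (v, 1) (u, 1) := stack_lower h

lemma stack_bottom_bottom {v u : ℤ} (h : D'.part (v, false) (u, false)) :
    stack D.part D'.part (v, 0) (u, 0) := stack_lower h

end Stacks

lemma permDiagram_comp (h w g : AffinePerm m) (hw : w * w = 1) :
    (permDiagram h).comp (normalDiagram w g) = normalDiagram (h * w * h⁻¹) (h * g) := by
  have hw' : h * w * h⁻¹ * (h * w * h⁻¹) = 1 := by
    calc h * w * h⁻¹ * (h * w * h⁻¹) = h * (w * w) * h⁻¹ := by group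
      _ = 1 := by rw [hw, mul_one, mul_inv_cancel]
  have e1 : ∀ v : ℤ, (h * w * h⁻¹) • h • v = h • w • v := fun v => by
    rw [mul_smul, mul_smul, inv_smul_smul]
  refine Diagram.ext (comp_eq_ker (F := vertexLabel (h * w * h⁻¹) (h * g))
    (rowLabel (fun u => label (h * w * h⁻¹) (h • g • u) false)
      (fun v => label (h * w * h⁻¹) (h • v) true)
      (fun v => label (h * w * h⁻¹) v true)) ?_ ?_ ?_ ?_)
  · refine permDiagram_part_le fun v => ?_
    change label _ v true = label _ (h • h⁻¹ • v) true
    rw [smul_inv_smul]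
  · refine normalDiagram_part_le hw ?_ ?_ ?_
    · intro v _
      change label _ (h • v) true = label _ (h • w • v) true
      rw [← e1, label_smul hw']
    · intro v _
      change label _ (h • g • g⁻¹ • v) false = label _ (h • g • g⁻¹ • w • v) false
      rw [smul_inv_smul, smul_inv_smul, ← e1, label_smul hw']
    · intro v hv
      change label _ (h • v) true = label _ (h • g • g⁻¹ • v) false
      rw [smul_inv_smul]
      exact label_of_fixed (by rw [e1, hv]) _ _
  · rw [rowLabel_outer]
    funext ⟨v, b⟩
    cases b
    · change label _ (h • g • v) false = label _ ((h * g) • v) false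
      rw [mul_smul]
    · rfl
  · have up : ∀ v : ℤ, stack (permDiagram h).part (normalDiagram w g).part (v, 2) (h⁻¹ • v, 1) :=
      fun v => stack_top_middle (permDiagram_top_bottom h v)
    have e2 : ∀ v : ℤ, h⁻¹ • (h * w * h⁻¹) • v = w • h⁻¹ • v := fun v => by
      rw [mul_smul, mul_smul, inv_smul_smul]
    have e3 : ∀ v : ℤ, (h * g)⁻¹ • v = g⁻¹ • h⁻¹ • v := fun v => by rw [mul_inv_rev, mul_smul]
    refine normalDiagram_part_le hw' ?_ ?_ ?_
    · intro v _
      refine Setoid.trans' (stack _ _) (up v) (Setoid.trans' (stack _ _) ?_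
        (Setoid.symm' (stack _ _) (up _)))
      rw [e2]
      exact stack_middle_middle' (normalDiagram_top_arc hw _)
    · intro v _
      change stack _ _ (_, 0) (_, 0)
      rw [e3, e3, e2]
      exact stack_bottom_bottom (normalDiagram_bottom_arc hw _)
    · intro v hv
      refine Setoid.trans' (stack _ _) (up v) ?_
      change stack _ _ (_, 1) (_, 0)
      rw [e3]
      exact stack_middle_bottom (normalDiagram_through hw (by rw [← e2, hv]))

lemma permDiagram_loops (h : AffinePerm m) (D : Diagram m) : (permDiagram h).loops D = 0 := by
  refine loops_eq_zero fun v => ⟨(h • v, true), ?_⟩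
  refine stack_top_middle ?_
  have := permDiagram_top_bottom h (h • v)
  rwa [inv_smul_smul] at this

lemma comp_permDiagram (w g h : AffinePerm m) (hw : w * w = 1) :
    (normalDiagram w g).comp (permDiagram h) = normalDiagram w (g * h) := by
  refine Diagram.ext (comp_eq_ker (F := vertexLabel w (g * h))
    (rowLabel (fun u => label w (g • h • u) false) (fun v => label w (g • v) false)
      (fun v => label w v true)) ?_ ?_ ?_ ?_)
  · refine normalDiagram_part_le hw ?_ ?_ ?_
    · intro v _
      exact (label_smul hw v true).symm
    · intro v _
      change label w (g • g⁻¹ • v) false = label w (g • g⁻¹ • w • v) false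
      rw [smul_inv_smul, smul_inv_smul, label_smul hw]
    · intro v hv
      change label w v true = label w (g • g⁻¹ • v) false
      rw [smul_inv_smul]
      exact label_of_fixed hv _ _
  · refine permDiagram_part_le fun v => ?_
    change label w (g • v) false = label w (g • h • h⁻¹ • v) false
    rw [smul_inv_smul]
  · rw [rowLabel_outer]
    funext ⟨v, b⟩
    cases b
    · change label _ (g • h • v) false = label _ ((g * h) • v) false
      rw [mul_smul]
    · rfl
  · have down : ∀ v : ℤ, stack (normalDiagram w g).part (permDiagram h).part (v, 1) (h⁻¹ • v, 0) :=
      fun v => stack_middle_bottom (permDiagram_top_bottom h v)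
    have e3 : ∀ v : ℤ, (g * h)⁻¹ • v = h⁻¹ • g⁻¹ • v := fun v => by rw [mul_inv_rev, mul_smul]
    refine normalDiagram_part_le hw ?_ ?_ ?_
    · intro v _
      exact stack_top_top (normalDiagram_top_arc hw v)
    · intro v _
      change stack _ _ (_, 0) (_, 0)
      rw [e3, e3]
      exact Setoid.trans' (stack _ _) (Setoid.symm' (stack _ _) (down _))
        (Setoid.trans' (stack _ _) (stack_middle_middle (normalDiagram_bottom_arc hw _)) (down _))
    · intro v hv
      change stack _ _ (_, 2) (_, 0)
      rw [e3]
      exact Setoid.trans' (stack _ _) (stack_top_middle (normalDiagram_through hw hv)) (down _)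

lemma loops_permDiagram (h : AffinePerm m) (D : Diagram m) : D.loops (permDiagram h) = 0 :=
  loops_eq_zero fun v => ⟨(h⁻¹ • v, false), Setoid.symm' (stack _ _)
    (stack_middle_bottom (permDiagram_top_bottom h v))⟩

/-- Stacking an arc on through strands. -/
lemma arcDiagram_comp {x y : ℤ} (hxy : ¬ x ≡ y [ZMOD m]) {w : AffinePerm m} (g : AffinePerm m)
    (hw : w * w = 1) (hx : w • x = x) (hy : w • y = y) :
    (arcDiagram x y).comp (normalDiagram w g) = normalDiagram (refl x y * w) g ∧
      (arcDiagram x y).loops (normalDiagram w g) = 0 := by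
  set s : AffinePerm m := refl x y with hs
  have hc : w * s = s * w := commute_refl_of_smul hx hy
  have hss : s * s = 1 := refl_mul_self x y
  have hsw : s * w * (s * w) = 1 := by
    rw [mul_assoc, ← mul_assoc w, hc, mul_assoc, hw, mul_one, hss]
  -- the vertices of the arc are fixed by `w`, and the other ones by `s`
  have cases : ∀ v : ℤ, (w • v = v ∧ w • s • v = s • v ∧ s • v ≠ v) ∨
      (s • v = v ∧ s • w • v = w • v ∧ (s * w) • v = w • v ∧
        (¬ v ≡ x [ZMOD m] ∧ ¬ v ≡ y [ZMOD m])) := by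
    intro v
    have hne : x ≠ y := fun h => hxy (h ▸ rfl)
    rcases modEq_cases m x y v with ⟨n, rfl⟩ | ⟨n, rfl⟩ | ⟨h1, h2⟩
    · refine Or.inl ⟨smul_add_mul_eq_self hx n, ?_, ?_⟩
      · rw [refl_smul_left_add hxy, smul_add_mul_eq_self hy]
      · rw [refl_smul_left_add hxy]
        exact fun h => hne (add_right_cancel h).symm
    · refine Or.inl ⟨smul_add_mul_eq_self hy n, ?_, ?_⟩
      · rw [refl_smul_right_add hxy, smul_add_mul_eq_self hx]
      · rw [refl_smul_right_add hxy]
        exact fun h => hne (add_right_cancel h)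
    · have h3 : s • w • v = w • v := by
        refine refl_smul_of_not ?_ ?_
        · rwa [← hx, smul_modEq_smul]
        · rwa [← hy, smul_modEq_smul]
      exact Or.inr ⟨refl_smul_of_not h1 h2, h3, by rw [mul_smul, h3], h1, h2⟩
  have hwx : ∀ n : ℤ, w • (x + n * m) = x + n * m := smul_add_mul_eq_self hx
  have hlab : ∀ (n : ℤ) (b : Bool), label (s * w) (x + n * m) b = label (s * w) (y + n * m) b := by
    intro n b
    rw [← label_smul hsw, mul_smul, hwx, refl_smul_left_add hxy]
  -- the label of a middle vertex is the one of the outer vertex to which it is joined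
  obtain ⟨mid, hmid, hmid'⟩ : ∃ mid : ℤ → Sym2 ℤ × Option Bool,
      (∀ v, s • v = v → mid v = label (s * w) v true) ∧
        ∀ v, s • v ≠ v → mid v = label (s * w) v false := by
    classical
    refine ⟨fun v => label (s * w) v (decide (s • v = v)), fun v h => ?_, fun v h => ?_⟩
    · simp only [h, decide_true]
    · simp only [h, decide_false]
  refine ⟨Diagram.ext (comp_eq_ker (F := vertexLabel (s * w) g)
    (rowLabel (fun u => label (s * w) (g • u) false)
      mid (fun v => label (s * w) v true)) ?_ ?_ ?_ ?_), ?_⟩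
  · refine arcDiagram_part_le hxy ?_ ?_
    · intro n b
      cases b
      · have h1 : s • (x + n * m) ≠ x + n * m := by
          rcases cases (x + n * m) with h | h
          · exact h.2.2
          · exact absurd (add_mul_modEq x n) h.2.2.2.1
        have h2 : s • (y + n * m) ≠ y + n * m := by
          rcases cases (y + n * m) with h | h
          · exact h.2.2
          · exact absurd (add_mul_modEq y n) h.2.2.2.2
        exact (hmid' _ h1).trans ((hlab n false).trans (hmid' _ h2).symm)
      · exact hlab n true
    · intro v h1 h2
      exact (hmid v (refl_smul_of_not h1 h2)).symm
  · refine normalDiagram_part_le hw ?_ ?_ ?_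
    · intro v hv
      rcases cases v with h | ⟨h1, h2, h3, -⟩
      · exact absurd h.1 hv
      · change mid v = mid (w • v)
        rw [hmid v h1, hmid _ h2, ← label_smul hsw, h3]
    · intro v hv
      rcases cases v with h | ⟨h1, h2, h3, -⟩
      · exact absurd h.1 hv
      · change label _ (g • g⁻¹ • v) _ = label _ (g • g⁻¹ • w • v) _
        rw [smul_inv_smul, smul_inv_smul, ← label_smul hsw, h3]
    · intro v hv
      change mid v = label _ (g • g⁻¹ • v) _
      rw [smul_inv_smul]
      rcases cases v with ⟨-, -, h⟩ | ⟨h1, h2, h3, -⟩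
      · exact hmid' v h
      · rw [hmid v h1]
        exact label_of_fixed (h3.trans hv) _ _
  · rw [rowLabel_outer]
    funext ⟨v, b⟩
    cases b <;> rfl
  · have up : ∀ v : ℤ, s • v = v →
        stack (arcDiagram x y).part (normalDiagram w g).part (v, 2) (v, 1) :=
      fun v hv => by
        have := normalDiagram_through (g := 1) hss hv
        rw [inv_one, one_smul] at this
        exact stack_top_middle this
    have down : ∀ v : ℤ, w • v = v →
        stack (arcDiagram x y).part (normalDiagram w g).part (v, 1) (g⁻¹ • v, 0) :=
      fun v hv => stack_middle_bottom (normalDiagram_through hw hv)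
    refine normalDiagram_part_le hsw ?_ ?_ ?_
    · intro v hv
      rcases cases v with ⟨h1, h2, h3⟩ | ⟨h1, h2, h3, -⟩
      · rw [mul_smul, h1]
        exact stack_top_top (normalDiagram_top_arc hss v)
      · rw [h3]
        exact Setoid.trans' (stack _ _) (up v h1) (Setoid.trans' (stack _ _)
          (stack_middle_middle' (normalDiagram_top_arc hw v))
          (Setoid.symm' (stack _ _) (up _ h2)))
    · intro v hv
      rcases cases v with ⟨h1, h2, h3⟩ | ⟨h1, h2, h3, -⟩
      · rw [mul_smul, h1]
        have := normalDiagram_bottom_arc (g := 1) hss v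
        rw [inv_one, one_smul, one_smul] at this
        exact Setoid.trans' (stack _ _) (Setoid.symm' (stack _ _) (down v h1))
          (Setoid.trans' (stack _ _) (stack_middle_middle this) (down _ h2))
      · rw [h3]
        exact stack_bottom_bottom (normalDiagram_bottom_arc hw v)
    · intro v hv
      rcases cases v with ⟨h1, h2, h3⟩ | ⟨h1, h2, h3, -⟩
      · rw [mul_smul, h1] at hv
        exact absurd hv h3
      · exact Setoid.trans' (stack _ _) (up v h1) (down v (h3.symm.trans hv))
  · refine loops_eq_zero fun v => ?_
    rcases cases v with ⟨h1, h2, h3⟩ | ⟨h1, h2, h3, -⟩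
    · exact ⟨(g⁻¹ • v, false), Setoid.symm' (stack _ _)
        (stack_middle_bottom (normalDiagram_through hw h1))⟩
    · refine ⟨(v, true), stack_top_middle ?_⟩
      have := normalDiagram_through (g := 1) hss h1
      rwa [inv_one, one_smul] at this

end Products

section Products

variable {m : ℕ}

lemma label_arc {x y : ℤ} (hxy : ¬ x ≡ y [ZMOD m]) (n : ℤ) (b : Bool) :
    label (refl x y : AffinePerm m) (x + n * m) b =
      label (refl x y : AffinePerm m) (y + n * m) b := by
  rw [← label_smul (refl_mul_self x y), refl_smul_left_add hxy]

lemma modEq_of_refl_smul_ne {x y v : ℤ} (hv : (refl x y : AffinePerm m) • v ≠ v) :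
    (∃ n : ℤ, v = x + n * m) ∨ ∃ n : ℤ, v = y + n * m := by
  rcases modEq_cases m x y v with h | h | ⟨h1, h2⟩
  · exact Or.inl h
  · exact Or.inr h
  · exact absurd (refl_smul_of_not h1 h2) hv

lemma not_modEq_of_refl_smul_eq {x y v : ℤ} (hxy : ¬ x ≡ y [ZMOD m])
    (hv : (refl x y : AffinePerm m) • v = v) : ¬ v ≡ x [ZMOD m] ∧ ¬ v ≡ y [ZMOD m] := by
  have hne : x ≠ y := fun h => hxy (h ▸ rfl)
  constructor <;> intro h <;> have h' := smul_eq_self_of_modEq hv h.symm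
  · rw [refl_smul_left hxy] at h'
    exact hne h'.symm
  · rw [refl_smul_right hxy] at h'
    exact hne h'

/-- Stacking two arcs with exactly one common strand. -/
lemma arcDiagram_comp_of_shared {x y z : ℤ} (hxy : ¬ x ≡ y [ZMOD m]) (hxz : ¬ x ≡ z [ZMOD m])
    (hyz : ¬ y ≡ z [ZMOD m]) :
    (arcDiagram x y : Diagram m).comp (arcDiagram y z) =
        normalDiagram (refl x y) (refl y z * refl x y) ∧
      (arcDiagram x y : Diagram m).loops (arcDiagram y z) = 0 := by
  set s : AffinePerm m := refl x y with hs
  have hss : s * s = 1 := refl_mul_self x y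
  set c : AffinePerm m := refl y z * s with hc
  have hcx : c • x = z := by rw [hc, mul_smul, refl_smul_left hxy, refl_smul_left hyz]
  have hcy : c • y = x := by rw [hc, mul_smul, refl_smul_right hxy, refl_smul_of_not hxy hxz]
  have hcz : c • z = y := by
    rw [hc, mul_smul, refl_smul_of_not (fun h => hxz h.symm) (fun h => hyz h.symm),
      refl_smul_right hyz]
  have hcv : ∀ v, ¬ v ≡ x [ZMOD m] → ¬ v ≡ y [ZMOD m] → ¬ v ≡ z [ZMOD m] → c • v = v := by
    intro v h1 h2 h3
    rw [hc, mul_smul, refl_smul_of_not h1 h2, refl_smul_of_not h2 h3]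
  have hzs : ∀ n : ℤ, s • (z + n * m) = z + n * m :=
    smul_add_mul_eq_self (refl_smul_of_not (fun h => hxz h.symm) (fun h => hyz h.symm))
  have hzn : ∀ n : ℤ, ¬ z + n * m ≡ x [ZMOD m] ∧ ¬ z + n * m ≡ y [ZMOD m] := fun n =>
    ⟨fun h => hxz (h.symm.trans (add_mul_modEq z n)),
      fun h => hyz (h.symm.trans (add_mul_modEq z n))⟩
  have hxn : ∀ n : ℤ, ¬ x + n * m ≡ y [ZMOD m] ∧ ¬ x + n * m ≡ z [ZMOD m] := fun n =>
    ⟨fun h => hxy ((modEq_add_mul x n).trans h), fun h => hxz ((modEq_add_mul x n).trans h)⟩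
  -- the middle vertices `x`, `y`, `z` are all joined to the top vertex `z`
  obtain ⟨mid, hmid, hmidx, hmidy⟩ : ∃ mid : ℤ → Sym2 ℤ × Option Bool,
      (∀ v, ¬ v ≡ x [ZMOD m] → ¬ v ≡ y [ZMOD m] → mid v = label s v true) ∧
      (∀ n : ℤ, mid (x + n * m) = label s (z + n * m) true) ∧
        ∀ n : ℤ, mid (y + n * m) = label s (z + n * m) true := by
    classical
    refine ⟨fun v => label s (if v ≡ x [ZMOD m] then v - x + z else
      if v ≡ y [ZMOD m] then v - y + z else v) true, fun v h1 h2 => ?_, fun n => ?_, fun n => ?_⟩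
    · simp only [h1, h2, if_false]
    · simp only [if_pos (add_mul_modEq x n)]
      congr 1
      ring
    · simp only [if_neg fun h => hxy (((modEq_add_mul y n).trans h).symm),
        if_pos (add_mul_modEq y n)]
      congr 1
      ring
  refine ⟨Diagram.ext (comp_eq_ker (F := vertexLabel s c)
    (rowLabel (fun u => label s (c • u) false) mid (fun v => label s v true)) ?_ ?_ ?_ ?_), ?_⟩
  · refine arcDiagram_part_le hxy ?_ ?_
    · intro n b
      cases b
      · exact (hmidx n).trans (hmidy n).symm
      · exact label_arc hxy n true
    · intro v h1 h2
      exact (hmid v h1 h2).symm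
  · refine arcDiagram_part_le hyz ?_ ?_
    · intro n b
      cases b
      · change label s (c • (y + n * m)) false = label s (c • (z + n * m)) false
        rw [smul_add_mul, smul_add_mul, hcy, hcz]
        exact label_arc hxy n false
      · exact (hmidy n).trans (hmid _ (hzn n).1 (hzn n).2).symm
    · intro v h1 h2
      change mid v = label s (c • v) false
      by_cases h3 : v ≡ x [ZMOD m]
      · obtain ⟨n, rfl⟩ := modEq_iff_exists_add_mul.1 h3.symm
        rw [hmidx, smul_add_mul, hcx]
        exact label_of_fixed (hzs n) _ _
      · rw [hmid v h3 h1, hcv v h3 h1 h2]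
        exact label_of_fixed (refl_smul_of_not h3 h1) _ _
  · rw [rowLabel_outer]
    funext ⟨v, b⟩
    cases b <;> rfl
  · have hcx' : ∀ n : ℤ, c⁻¹ • (x + n * m) = y + n * m := fun n => by
      rw [smul_add_mul, inv_smul_eq_iff.2 hcy.symm]
    have hcy' : ∀ n : ℤ, c⁻¹ • (y + n * m) = z + n * m := fun n => by
      rw [smul_add_mul, inv_smul_eq_iff.2 hcz.symm]
    have hcz' : ∀ n : ℤ, c⁻¹ • (z + n * m) = x + n * m := fun n => by
      rw [smul_add_mul, inv_smul_eq_iff.2 hcx.symm]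
    refine normalDiagram_part_le hss ?_ ?_ ?_
    · intro v _
      exact stack_top_top (normalDiagram_top_arc hss v)
    · intro v hv
      rcases modEq_of_refl_smul_ne hv with ⟨n, rfl⟩ | ⟨n, rfl⟩
      · rw [refl_smul_left_add hxy, hcx', hcy']
        exact stack_bottom_bottom (arcDiagram_arc hyz n false)
      · rw [refl_smul_right_add hxy, hcx', hcy']
        exact Setoid.symm' _ (stack_bottom_bottom (arcDiagram_arc hyz n false))
    · intro v hv
      obtain ⟨h1, h2⟩ := not_modEq_of_refl_smul_eq hxy hv
      refine Setoid.trans' (stack _ _) (stack_top_middle (arcDiagram_through h1 h2)) ?_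
      change stack _ _ _ (_, 0)
      by_cases h3 : v ≡ z [ZMOD m]
      · obtain ⟨n, rfl⟩ := modEq_iff_exists_add_mul.1 h3.symm
        rw [hcz']
        refine Setoid.trans' (stack _ _) (Setoid.symm' (stack _ _)
          (stack_middle_middle' (arcDiagram_arc hyz n true))) ?_
        refine Setoid.trans' (stack _ _) (Setoid.symm' (stack _ _)
          (stack_middle_middle (arcDiagram_arc hxy n false))) ?_
        exact stack_middle_bottom (arcDiagram_through (hxn n).1 (hxn n).2)
      · rw [inv_smul_eq_iff.2 (hcv v h1 h2 h3).symm]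
        exact stack_middle_bottom (arcDiagram_through h2 h3)
  · refine loops_eq_zero fun v => ?_
    rcases modEq_cases m x y v with ⟨n, rfl⟩ | ⟨n, rfl⟩ | ⟨h1, h2⟩
    · exact ⟨(x + n * m, false), Setoid.symm' (stack _ _)
        (stack_middle_bottom (arcDiagram_through (hxn n).1 (hxn n).2))⟩
    · exact ⟨(z + n * m, true), Setoid.trans' (stack _ _)
        (stack_top_middle (arcDiagram_through (hzn n).1 (hzn n).2))
        (Setoid.symm' (stack _ _) (stack_middle_middle' (arcDiagram_arc hyz n true)))⟩
    · exact ⟨(v, true), stack_top_middle (arcDiagram_through h1 h2)⟩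

/-- Stacking two arcs between the same strands: the middle row contains a single closed component on
the cylinder, which is not contractible unless `n = 0`. -/
lemma arcDiagram_comp_of_parallel {x y : ℤ} (hxy : ¬ x ≡ y [ZMOD m]) (n : ℤ) :
    (arcDiagram x y : Diagram m).comp (arcDiagram (x + n * m) y) =
        normalDiagram (refl x y) (shift x (-n)) ∧
      (arcDiagram x y : Diagram m).loops (arcDiagram (x + n * m) y) = 1 := by
  set s : AffinePerm m := refl x y with hs
  have hss : s * s = 1 := refl_mul_self x y
  set g : AffinePerm m := shift x (-n) with hg
  have hxy' : ¬ x + n * m ≡ y [ZMOD m] := fun h => hxy ((modEq_add_mul x n).trans h)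
  have hn : ∀ v, ¬ v ≡ x [ZMOD m] → ¬ v ≡ x + n * m [ZMOD m] :=
    fun v h h' => h (h'.trans (add_mul_modEq x n))
  have hn' : ∀ v, ¬ v ≡ x + n * m [ZMOD m] → ¬ v ≡ x [ZMOD m] :=
    fun v h h' => h (h'.trans (modEq_add_mul x n))
  have e1 : ∀ k : ℤ, x + n * m + k * m = x + (n + k) * m := fun k => by ring
  have hyn : ∀ k : ℤ, ¬ y + k * m ≡ x [ZMOD m] :=
    fun k h => hxy (((modEq_add_mul y k).trans h).symm)
  constructor
  · -- the middle vertices of the loop may share any label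
    obtain ⟨mid, hmid, hmid'⟩ : ∃ mid : ℤ → Sym2 ℤ × Option Bool,
        (∀ v, ¬ v ≡ x [ZMOD m] → ¬ v ≡ y [ZMOD m] → mid v = label s v true) ∧
        ∀ v, (v ≡ x [ZMOD m] ∨ v ≡ y [ZMOD m]) → mid v = label s x true := by
      classical
      refine ⟨fun v => label s (if v ≡ x [ZMOD m] ∨ v ≡ y [ZMOD m] then x else v) true,
        fun v h1 h2 => ?_, fun v h => ?_⟩
      · simp only [h1, h2, or_self, if_false]
      · simp only [h, if_true]
    have hmx : ∀ k : ℤ, mid (x + k * m) = label s x true :=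
      fun k => hmid' _ (Or.inl (add_mul_modEq x k))
    have hmy : ∀ k : ℤ, mid (y + k * m) = label s x true :=
      fun k => hmid' _ (Or.inr (add_mul_modEq y k))
    refine Diagram.ext (comp_eq_ker (F := vertexLabel s g)
      (rowLabel (fun u => label s (g • u) false) mid (fun v => label s v true)) ?_ ?_ ?_ ?_)
    · refine arcDiagram_part_le hxy ?_ ?_
      · intro k b
        cases b
        · exact (hmx k).trans (hmy k).symm
        · exact label_arc hxy k true
      · intro v h1 h2
        exact (hmid v h1 h2).symm
    · refine arcDiagram_part_le hxy' ?_ ?_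
      · intro k b
        cases b
        · change label s (g • (x + n * m + k * m)) false = label s (g • (y + k * m)) false
          have e2 : x + (n + k) * m + -n * m = x + k * m := by ring
          rw [hg, e1, shift_smul_of_modEq (add_mul_modEq x _), shift_smul_of_not (hyn k), e2]
          exact label_arc hxy k false
        · change mid (x + n * m + k * m) = mid (y + k * m)
          rw [e1, hmx, hmy]
      · intro v h1 h2
        change mid v = label s (g • v) false
        rw [hmid v (hn' v h1) h2, hg, shift_smul_of_not (hn' v h1)]
        exact label_of_fixed (refl_smul_of_not (hn' v h1) h2) _ _
    · rw [rowLabel_outer]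
      funext ⟨v, b⟩
      cases b <;> rfl
    · have hgi : g⁻¹ = shift x n := by rw [hg, shift_neg, inv_inv]
      have hgx : ∀ k : ℤ, g⁻¹ • (x + k * m) = x + n * m + k * m := fun k => by
        rw [hgi, shift_smul_of_modEq (add_mul_modEq x k)]
        ring
      have hgv : ∀ v : ℤ, ¬ v ≡ x [ZMOD m] → g⁻¹ • v = v := fun v h => by
        rw [hgi, shift_smul_of_not h]
      refine normalDiagram_part_le hss ?_ ?_ ?_
      · intro v _
        exact stack_top_top (normalDiagram_top_arc hss v)
      · intro v hv
        rcases modEq_of_refl_smul_ne hv with ⟨k, rfl⟩ | ⟨k, rfl⟩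
        · rw [refl_smul_left_add hxy, hgx, hgv _ (hyn k)]
          exact stack_bottom_bottom (arcDiagram_arc hxy' k false)
        · rw [refl_smul_right_add hxy, hgx, hgv _ (hyn k)]
          exact Setoid.symm' _ (stack_bottom_bottom (arcDiagram_arc hxy' k false))
      · intro v hv
        obtain ⟨h1, h2⟩ := not_modEq_of_refl_smul_eq hxy hv
        rw [hgv v h1]
        exact Setoid.trans' (stack _ _) (stack_top_middle (arcDiagram_through h1 h2))
          (stack_middle_bottom (arcDiagram_through (hn v h1) h2))
  · set D : Diagram m := arcDiagram x y
    set D' : Diagram m := arcDiagram (x + n * m) y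
    -- the vertices of the loop are a union of components
    have inv : ∀ p q : ℤ × Fin 3, stack D.onCylinder D'.onCylinder p q →
        (p.2 = 1 ∧ (p.1 ≡ x [ZMOD m] ∨ p.1 ≡ y [ZMOD m])) =
          (q.2 = 1 ∧ (q.1 ≡ x [ZMOD m] ∨ q.1 ≡ y [ZMOD m])) := by
      intro p q h
      obtain ⟨k, h⟩ := (stack_onCylinder D D' p q).1 h
      have e : ∀ z : ℤ, q.1 + k * m ≡ z [ZMOD m] ↔ q.1 ≡ z [ZMOD m] := fun z =>
        ⟨(modEq_add_mul q.1 k).trans, (add_mul_modEq q.1 k).trans⟩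
      have key := eq_of_stack
        (fun p : ℤ × Fin 3 => p.2 = 1 ∧ (p.1 ≡ x [ZMOD m] ∨ p.1 ≡ y [ZMOD m])) ?_ ?_ h
      · simp only [translate, e] at key
        exact key
      · refine arcDiagram_part_le hxy ?_ ?_
        · intro k b
          cases b <;> simp [upper, Setoid.ker_def]
        · intro v h1 h2
          simp [upper, Setoid.ker_def, h1, h2]
      · refine arcDiagram_part_le hxy' ?_ ?_
        · intro k b
          cases b <;> simp [lower, Setoid.ker_def, e1]
        · intro v h1 h2
          simp [lower, Setoid.ker_def, hn' v h1, h2]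
    have hyx : stack D.onCylinder D'.onCylinder (y, 1) (x, 1) := by
      refine stack_le_stack_onCylinder D D' (Setoid.symm' _ (stack_middle_middle ?_))
      simpa using arcDiagram_arc hxy 0 false
    have hcl : ∀ v : ℤ, (v ≡ x [ZMOD m] ∨ v ≡ y [ZMOD m]) →
        stack D.onCylinder D'.onCylinder (v, 1) (x, 1) := by
      rintro v (h | h)
      · obtain ⟨k, rfl⟩ := modEq_iff_exists_add_mul.1 h.symm
        exact stack_onCylinder_translate D D' k (x, 1)
      · obtain ⟨k, rfl⟩ := modEq_iff_exists_add_mul.1 h.symm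
        exact Setoid.trans' _ (stack_onCylinder_translate D D' k (y, 1)) hyx
    have e : closedComponents D.onCylinder D'.onCylinder =
        {{q | stack D.onCylinder D'.onCylinder q (x, 1)}} := by
      ext C
      rw [Set.mem_singleton_iff]
      constructor
      · rintro ⟨⟨⟨v, i⟩, rfl⟩, hc⟩
        have h1 : i = 1 := hc (v, i) (Setoid.refl' (stack D.onCylinder D'.onCylinder) _)
        subst h1
        by_cases hv : v ≡ x [ZMOD m] ∨ v ≡ y [ZMOD m]
        · ext q
          exact ⟨fun h => Setoid.trans' _ h (hcl v hv),
            fun h => Setoid.trans' _ h (Setoid.symm' _ (hcl v hv))⟩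
        · rw [not_or] at hv
          have h2 : (2 : Fin 3) = 1 := hc (v, 2) (stack_le_stack_onCylinder D D'
            (stack_top_middle (arcDiagram_through hv.1 hv.2)))
          exact absurd h2 (by decide)
      · rintro rfl
        refine ⟨⟨(x, 1), rfl⟩, fun q hq => ?_⟩
        exact ((inv q (x, 1) hq).mpr ⟨rfl, Or.inl rfl⟩).1
    rw [Diagram.loops, e, Set.ncard_singleton]

end Products

/-! ### The diagrams of the generators -/

section Generators

variable {m : ℕ}

lemma emod_eq_iff_modEq {i : ℕ} (hi : i < m) (x : ℤ) : x % m = i ↔ x ≡ i [ZMOD m] := by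
  rw [Int.ModEq, Int.emod_eq_of_lt (by omega : (0 : ℤ) ≤ i) (by omega : (i : ℤ) < m)]

lemma strands_eq_permDiagram {f : ℤ → ℤ} (hf : ∀ x, f (x + m) = f x + m) {g : AffinePerm m}
    (hg : ∀ x, g • x = f x) : strands f hf = permDiagram g := by
  refine Diagram.ext (Setoid.ext fun p q => ?_)
  have h1 : ∀ p : ℤ × Bool, (if p.2 then p.1 else g • p.1) = if p.2 then p.1 else f p.1 := by
    rintro ⟨x, b⟩
    cases b
    · exact hg x
    · rfl
  rw [normalDiagram_part, label_eq_iff (mul_one 1), h1, h1, one_smul, or_self]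
  exact ⟨fun h => ⟨Eq.symm h, Or.inl rfl⟩, fun h => h.1.symm⟩

lemma id_eq_permDiagram : Diagram.id m = permDiagram 1 := by
  refine Diagram.ext (Setoid.ext fun p q => ?_)
  rw [normalDiagram_part, label_eq_iff (mul_one 1)]
  simp only [one_smul, or_self, true_or, and_true, ite_self]
  exact eq_comm

lemma simple_mul_self (i : ℕ) : simple m i * simple m i = 1 := refl_mul_self _ _

lemma crossing_eq (i : Fin (m - 1)) : crossing i = permDiagram (simple m i) := by
  have hi : (i : ℕ) + 1 < m := by omega
  refine strands_eq_permDiagram _ fun x => ?_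
  have e1 := emod_eq_iff_modEq (m := m) (i := i) (by omega) x
  have e2 := emod_eq_iff_modEq (m := m) (i := i + 1) hi x
  rw [Nat.cast_add, Nat.cast_one] at e2
  simp only [e1, e2]
  split_ifs with h1 h2
  · obtain ⟨n, rfl⟩ := modEq_iff_exists_add_mul.1 h1.symm
    rw [simple, refl_smul_left_add (not_modEq_succ hi)]
    ring
  · obtain ⟨n, rfl⟩ := modEq_iff_exists_add_mul.1 h2.symm
    rw [simple, refl_smul_right_add (not_modEq_succ hi)]
    ring
  · exact refl_smul_of_not h1 h2

lemma winding_eq (a : ℤ) (i : Fin m) : winding a i = permDiagram (shift (i : ℕ) a) := by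
  refine strands_eq_permDiagram _ fun x => ?_
  simp only [emod_eq_iff_modEq i.2 x]
  split_ifs with h
  · exact shift_smul_of_modEq h a
  · exact shift_smul_of_not h a

lemma cupCap_eq (i : Fin (m - 1)) : cupCap i = arcDiagram ((i : ℕ) : ℤ) ((i : ℕ) + 1) := by
  have hi : (i : ℕ) + 1 < m := by omega
  have hne := not_modEq_succ hi
  have e1 := emod_eq_iff_modEq (m := m) (i := i) (by omega)
  have e2 := emod_eq_iff_modEq (m := m) (i := i + 1) hi
  rw [Nat.cast_add, Nat.cast_one] at e2
  refine Diagram.ext (le_antisymm ?_ ?_)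
  · -- the label of a vertex is a function of the invariant which defines `cupCap`
    obtain ⟨H, key⟩ : ∃ H : ℤ × Option Bool → Sym2 ℤ × Option Bool, ∀ p : ℤ × Bool,
        vertexLabel (refl (i : ℕ) ((i : ℕ) + 1)) (1 : AffinePerm m) p =
          H (if p.1 % m = i then (p.1, some p.2)
            else if p.1 % m = i + 1 then (p.1 - 1, some p.2) else (p.1, none)) := by
      refine ⟨fun z => z.2.elim (label (refl (i : ℕ) ((i : ℕ) + 1) : AffinePerm m) z.1 true)
        (label (refl (i : ℕ) ((i : ℕ) + 1) : AffinePerm m) z.1), ?_⟩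
      rintro ⟨x, b⟩
      have hl : vertexLabel (refl (i : ℕ) ((i : ℕ) + 1)) (1 : AffinePerm m) (x, b) =
          label (refl (i : ℕ) ((i : ℕ) + 1) : AffinePerm m) x b := by
        cases b
        · exact congrArg (fun y => label _ y false) (one_smul _ x)
        · rfl
      rw [hl]
      simp only [e1, e2]
      split_ifs with h1 h2
      · rfl
      · obtain ⟨n, rfl⟩ := modEq_iff_exists_add_mul.1 h2.symm
        have e3 : (i : ℤ) + 1 + n * m - 1 = i + n * m := by ring
        simp only [Option.elim_some, e3]
        exact (label_arc hne n b).symm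
      · exact label_of_fixed (refl_smul_of_not h1 h2) _ _
    intro p q h
    rw [normalDiagram_part_eq, Setoid.ker_def, key, key]
    exact congrArg H h
  · refine arcDiagram_part_le hne ?_ ?_
    · intro n b
      have h1 : ((i : ℕ) : ℤ) + n * m ≡ (i : ℕ) [ZMOD m] := add_mul_modEq _ n
      have h2 : ((i : ℕ) : ℤ) + 1 + n * m ≡ (i : ℕ) + 1 [ZMOD m] := add_mul_modEq _ n
      have h3 : ¬ ((i : ℕ) : ℤ) + 1 + n * m ≡ (i : ℕ) [ZMOD m] := fun h => hne (h.symm.trans h2)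
      change (if _ then _ else _) = (if _ then _ else _)
      simp only [e1, e2, h1, h2, h3, if_true, if_false]
      rw [Prod.mk.injEq]
      exact ⟨by ring, rfl⟩
    · intro v h1 h2
      change (if _ then _ else _) = (if _ then _ else _)
      simp only [e1, e2, h1, h2, if_false]

/-- The translation by `a`. -/
def translation (m : ℕ) (a : ℤ) : AffinePerm m :=
  ⟨Equiv.addRight a, fun x => by simp only [Equiv.coe_addRight]; ring⟩

lemma twist_eq (a : ℤ) : twist m a = permDiagram (translation m a) :=
  strands_eq_permDiagram _ fun _ => rfl

lemma prod_simple_smul {n : ℕ} (hn : n < m) {j : ℕ} (hj : j < m) :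
    (List.ofFn fun i : Fin n => simple m i).prod • (j : ℤ) =
      ((if j < n then j + 1 else if j = n then 0 else j : ℕ) : ℤ) := by
  induction n generalizing j with
  | zero =>
    rw [List.ofFn_zero, List.prod_nil, one_smul, if_neg (by omega)]
    split_ifs with h
    · rw [h]
    · rfl
  | succ n ih =>
    rw [List.ofFn_succ_last, List.prod_append, List.prod_singleton, mul_smul]
    simp only [Fin.val_castSucc, Fin.val_last]
    rcases (show j < n ∨ j = n ∨ j = n + 1 ∨ n + 1 < j by omega) with h | rfl | rfl | h
    · rw [simple_smul_of_ne hn hj (by omega) (by omega), ih (by omega) hj, if_pos h,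
        if_pos (by omega)]
    · rw [simple_smul_self hn, ← Nat.cast_succ, ih (by omega) hn, if_neg (by omega),
        if_neg (by omega), if_pos (by omega)]
    · rw [Nat.cast_add, Nat.cast_one, simple_smul_succ hn, ih (by omega) (by omega),
        if_neg (by omega), if_pos rfl, if_neg (by omega), if_pos rfl]
    · rw [simple_smul_of_ne hn hj (by omega) (by omega), ih (by omega) hj, if_neg (by omega),
        if_neg (by omega), if_neg (by omega), if_neg (by omega)]

/-- The global twist is a winding of the first strand followed by a cycle of all strands. -/
lemma translation_one_eq [NeZero m] : translation m 1 =
    wind m 0 * (List.ofFn fun i : Fin (m - 1) => simple m i).prod := by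
  have hm : 0 < m := Nat.pos_of_ne_zero (NeZero.ne m)
  have hm' : (0 : ℤ) < m := by exact_mod_cast hm
  have key : ∀ j : ℕ, j < m → translation m 1 • (j : ℤ) =
      (wind m 0 * (List.ofFn fun i : Fin (m - 1) => simple m i).prod) • (j : ℤ) := by
    intro j hj
    rw [mul_smul, prod_simple_smul (by omega) hj]
    change (j : ℤ) + 1 = _
    rcases (show j < m - 1 ∨ j = m - 1 by omega) with h | h
    · rw [if_pos h]
      refine (shift_smul_of_not ?_ 1).symm
      rw [succ_modEq_iff (by omega) hm]
      omega
    · rw [if_neg (by omega), if_pos h]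
      refine Eq.trans ?_ (shift_smul_self _ 1).symm
      push_cast
      omega
  ext v
  obtain ⟨j, n, hj, rfl⟩ : ∃ (j : ℕ) (n : ℤ), j < m ∧ v = j + n * m :=
    ⟨(v % m).toNat, v / m, by have := Int.emod_lt_of_pos v hm'; omega, by
      rw [Int.toNat_of_nonneg (Int.emod_nonneg v hm'.ne'), Int.emod_add_ediv_mul]⟩
  rw [smul_add_mul, smul_add_mul, key j hj]

lemma simple_conj {i j : ℕ} (hi : i + 1 < m) (hj : j + 1 < m) (h : j = i + 1 ∨ i = j + 1) :
    simple m i * simple m j * simple m i * (simple m i * simple m j)⁻¹ = simple m j := by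
  have e : simple m i * simple m j * simple m i = simple m j * simple m i * simple m j := by
    rcases h with rfl | rfl
    · exact (affineRelations m).braid i hj
    · exact ((affineRelations m).braid j hi).symm
  have hi' : (simple m i)⁻¹ = simple m i := refl_inv _ _
  have hj' : (simple m j)⁻¹ = simple m j := refl_inv _ _
  rw [e, mul_inv_rev, hi', hj', mul_assoc, ← mul_assoc (simple m j) (simple m j),
    simple_mul_self, one_mul, mul_assoc, simple_mul_self, mul_one]

end Generators

section DiagramAlgebra

variable {k : Type*} [CommRing k] {m : ℕ} [NeZero m] (β : k)

/-- The affine permutations in the partition algebra. -/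
noncomputable def diagPerm (m : ℕ) [NeZero m] (β : k) : AffinePerm m →* PartitionAlgebra k m β where
  toFun g := ofDiagram β (permDiagram g)
  map_one' := by
    rw [← id_eq_permDiagram]
    rfl
  map_mul' g h := by
    rw [ofDiagram_mul_ofDiagram, permDiagram_loops, pow_zero, one_smul,
      comp_permDiagram _ _ _ (mul_one 1)]

/-- The normal diagrams in the partition algebra. -/
noncomputable def diagNormal (m : ℕ) [NeZero m] (β : k) (w g : AffinePerm m) :
    PartitionAlgebra k m β := ofDiagram β (normalDiagram w g)

variable {β}

lemma diagPerm_mul_diagNormal (h g : AffinePerm m) {w : AffinePerm m} (hw : w * w = 1) :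
    diagPerm m β h * diagNormal m β w g = diagNormal m β (h * w * h⁻¹) (h * g) := by
  change ofDiagram β _ * ofDiagram β _ = _
  rw [ofDiagram_mul_ofDiagram, permDiagram_loops, pow_zero, one_smul, permDiagram_comp _ _ _ hw]
  rfl

lemma diagNormal_mul_diagPerm (g h : AffinePerm m) {w : AffinePerm m} (hw : w * w = 1) :
    diagNormal m β w g * diagPerm m β h = diagNormal m β w (g * h) := by
  change ofDiagram β _ * ofDiagram β _ = _
  rw [ofDiagram_mul_ofDiagram, loops_permDiagram, pow_zero, one_smul, comp_permDiagram _ _ _ hw]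
  rfl

lemma diagArc_mul_diagNormal {x y : ℤ} (hxy : ¬ x ≡ y [ZMOD m]) {w : AffinePerm m}
    (g : AffinePerm m) (hw : w * w = 1) (hx : w • x = x) (hy : w • y = y) :
    diagNormal m β (refl x y) 1 * diagNormal m β w g = diagNormal m β (refl x y * w) g := by
  obtain ⟨h1, h2⟩ := arcDiagram_comp hxy g hw hx hy
  change ofDiagram β _ * ofDiagram β _ = _
  rw [ofDiagram_mul_ofDiagram, h2, pow_zero, one_smul, h1]
  rfl

lemma diagArc_mul_diagArc {x y z : ℤ} (hxy : ¬ x ≡ y [ZMOD m]) (hxz : ¬ x ≡ z [ZMOD m])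
    (hyz : ¬ y ≡ z [ZMOD m]) : diagNormal m β (refl x y) 1 * diagNormal m β (refl y z) 1 =
      diagNormal m β (refl x y) (refl y z * refl x y) := by
  obtain ⟨h1, h2⟩ := arcDiagram_comp_of_shared hxy hxz hyz
  change ofDiagram β _ * ofDiagram β _ = _
  rw [ofDiagram_mul_ofDiagram, h2, pow_zero, one_smul, h1]
  rfl

lemma diagArc_mul_diagArc_add {x y : ℤ} (hxy : ¬ x ≡ y [ZMOD m]) (n : ℤ) :
    diagNormal m β (refl x y) 1 * diagNormal m β (refl (x + n * m) y) 1 =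
      β • diagNormal m β (refl x y) (shift x (-n)) := by
  obtain ⟨h1, h2⟩ := arcDiagram_comp_of_parallel hxy n
  change ofDiagram β _ * ofDiagram β _ = _
  rw [ofDiagram_mul_ofDiagram, h2, pow_one, h1]
  rfl

/-- The generators as elements of the partition algebra. -/
noncomputable def genMap (m : ℕ) [NeZero m] (β : k) :
    FreeAlgebra k (Gen m) →ₐ[k] PartitionAlgebra k m β :=
  FreeAlgebra.lift k fun g => ofDiagram β g.diagram

lemma genMap_gen (g : Gen m) : genMap m β (gen k g) = ofDiagram β g.diagram :=
  FreeAlgebra.lift_ι_apply _ _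

lemma genMap_s (i : Fin (m - 1)) : genMap m β (gen k (.s i)) = diagPerm m β (simple m i) := by
  rw [genMap_gen, Gen.diagram, crossing_eq]
  rfl

lemma genMap_t (i : Fin m) : genMap m β (gen k (.t i)) = diagPerm m β (wind m i) := by
  rw [genMap_gen, Gen.diagram, winding_eq]
  rfl

lemma genMap_tInv (i : Fin m) : genMap m β (gen k (.tInv i)) = diagPerm m β (wind m i)⁻¹ := by
  rw [genMap_gen, Gen.diagram, winding_eq, wind, ← shift_neg]
  rfl

lemma genMap_tau : genMap m β (gen k .tau) = diagPerm m β (translation m 1) := by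
  rw [genMap_gen, Gen.diagram, twist_eq]
  rfl

lemma genMap_tauInv : genMap m β (gen k .tauInv) = diagPerm m β (translation m 1)⁻¹ := by
  rw [genMap_gen, Gen.diagram, twist_eq]
  rfl

lemma genMap_e (i : Fin (m - 1)) : genMap m β (gen k (.e i)) = diagNormal m β (simple m i) 1 := by
  rw [genMap_gen, Gen.diagram, cupCap_eq]
  rfl

lemma genMap_tPow (i : Fin m) (a : ℤ) :
    genMap m β (tPow k i a) = diagPerm m β (shift (i : ℕ) a) := by
  rw [shift_eq_zpow]
  cases a with
  | ofNat n => rw [tPow, map_pow, genMap_t, Int.ofNat_eq_natCast, zpow_natCast, map_pow]; rfl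
  | negSucc n => rw [tPow, map_pow, genMap_tInv, zpow_negSucc, ← inv_pow, map_pow]; rfl

lemma diagSimple_mul_diagSimple {i j : ℕ} (hi : i + 1 < m) (hj : j + 1 < m)
    (h : j = i + 1 ∨ i = j + 1) : diagNormal m β (simple m i) 1 * diagNormal m β (simple m j) 1 =
      diagNormal m β (simple m i) (simple m j * simple m i) := by
  rcases h with rfl | rfl
  · have e : simple m (i + 1) = refl ((i : ℤ) + 1) (i + 2) := by
      rw [simple, Nat.cast_add, Nat.cast_one, add_assoc]
      rfl
    rw [e]
    refine diagArc_mul_diagArc (not_modEq_succ hi) ?_ ?_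
    · have := mt (natCast_modEq_iff (i := i) (j := i + 2) (by omega) hj).1 (by omega)
      exact_mod_cast this
    · have := mt (natCast_modEq_iff (i := i + 1) (j := i + 2) hi hj).1 (by omega)
      exact_mod_cast this
  · have e : simple m (j + 1) = refl ((j : ℤ) + 2) (j + 1) := by
      rw [simple, Nat.cast_add, Nat.cast_one, add_assoc, refl_comm]
      rfl
    have e' : simple m j = refl ((j : ℤ) + 1) j := refl_comm _ _
    rw [e, e']
    refine diagArc_mul_diagArc ?_ ?_ fun h => not_modEq_succ hj h.symm
    · have := mt (natCast_modEq_iff (i := j + 2) (j := j + 1) hi hj).1 (by omega)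
      exact_mod_cast this
    · have := mt (natCast_modEq_iff (i := j + 2) (j := j) hi (by omega)).1 (by omega)
      exact_mod_cast this

lemma diagNormal_absorb {w g u : AffinePerm m} (hw : w * w = 1) (hu : u * w = w * u)
    (hf : ∀ v : ℤ, w • v = v → u • v = v) : diagNormal m β w (u * g) = diagNormal m β w g := by
  rw [diagNormal, normalDiagram_mul hw hu hf, diagNormal]

lemma diagSimple_comm {g : AffinePerm m} {i : ℕ} (h0 : g • (i : ℤ) = i)
    (h1 : g • ((i : ℤ) + 1) = i + 1) : diagPerm m β g * diagNormal m β (simple m i) 1 =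
      diagNormal m β (simple m i) 1 * diagPerm m β g := by
  rw [diagPerm_mul_diagNormal _ _ (simple_mul_self i),
    diagNormal_mul_diagPerm _ _ (simple_mul_self i), simple_mul, h0, h1, mul_inv_cancel_right,
    mul_one, one_mul]
  rfl

/-- The diagrams satisfy the defining relations. -/
lemma genMap_rel {x y : FreeAlgebra k (Gen m)} (h : Rel β x y) :
    genMap m β x = genMap m β y := by
  have R := affineRelations m
  have perm : ∀ {g h : AffinePerm m}, g = h → diagPerm m β g = diagPerm m β h :=
    fun h => congrArg _ h
  -- the winding of both strands of an arc commutes with the arc and fixes the other strands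
  have wind2 : ∀ i : ℕ, i + 1 < m →
      wind m i * wind m (i + 1) * simple m i = simple m i * (wind m i * wind m (i + 1)) ∧
        ∀ v : ℤ, simple m i • v = v → (wind m i * wind m (i + 1)) • v = v := by
    intro i hi
    constructor
    · have e1 := R.s_t_succ_zpow hi 1
      rw [zpow_one, zpow_one] at e1
      rw [← mul_assoc, R.s_t i hi, mul_assoc (wind m (i + 1)), e1, ← mul_assoc,
        (R.t_comm i (i + 1) (by omega) hi).eq]
    · intro v hv
      obtain ⟨h1, h2⟩ := not_modEq_of_refl_smul_eq (not_modEq_succ hi) hv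
      rw [mul_smul]
      have e : wind m (i + 1) • v = v := shift_smul_of_not (by push_cast; exact h2) 1
      rw [e]
      exact shift_smul_of_not h1 1
  cases h with
  | s_sq i =>
    rw [map_mul, genMap_s, ← map_mul, simple_mul_self, map_one, map_one]
  | s_comm i j h =>
    rw [map_mul, map_mul, genMap_s, genMap_s, ← map_mul, ← map_mul]
    rcases h with h | h
    · exact perm (R.s_comm i j h (by omega)).eq
    · exact perm (R.s_comm j i h (by omega)).eq.symm
  | braid i j h =>
    rw [map_mul, map_mul, map_mul, map_mul, genMap_s, genMap_s, ← map_mul, ← map_mul, ← map_mul,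
      ← map_mul, h]
    exact perm (R.braid i (by omega))
  | e_sq i =>
    rw [map_mul, map_smul, genMap_e]
    have := diagArc_mul_diagArc_add (β := β) (not_modEq_succ (m := m) (i := i) (by omega)) 0
    rw [zero_mul, add_zero, neg_zero, shift_zero] at this
    exact this
  | e_e_e i j h =>
    have hi : (i : ℕ) + 1 < m := by omega
    have hj : (j : ℕ) + 1 < m := by omega
    rw [map_mul, map_mul, genMap_e, genMap_e, mul_assoc, diagSimple_mul_diagSimple hj hi h.symm,
      ← one_mul (simple m i * simple m j), ← diagNormal_mul_diagPerm _ _ (simple_mul_self _),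
      ← mul_assoc, diagSimple_mul_diagSimple hi hj h,
      diagNormal_mul_diagPerm _ _ (simple_mul_self _), mul_assoc,
      ← mul_assoc (simple m i) (simple m i), simple_mul_self, one_mul, simple_mul_self]
  | e_comm i j h =>
    have hi : (i : ℕ) + 1 < m := by omega
    have hj : (j : ℕ) + 1 < m := by omega
    have key : ∀ i j : ℕ, i + 1 < m → j + 1 < m → (i + 1 < j ∨ j + 1 < i) →
        diagNormal m β (simple m i) 1 * diagNormal m β (simple m j) 1 =
          diagNormal m β (simple m i * simple m j) 1 := by
      intro i j hi hj h
      refine diagArc_mul_diagNormal (not_modEq_succ hi) 1 (simple_mul_self j)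
        (simple_smul_of_ne hj (by omega) (by omega) (by omega)) ?_
      exact_mod_cast simple_smul_of_ne hj hi (by omega) (by omega)
    rw [map_mul, map_mul, genMap_e, genMap_e, key i j hi hj h, key j i hj hi h.symm]
    rcases h with h | h
    · rw [(R.s_comm i j h hj).eq]
    · rw [(R.s_comm j i h hi).eq]
  | s_e_comm i j h =>
    rw [map_mul, map_mul, genMap_s, genMap_e]
    refine diagSimple_comm (simple_smul_of_ne (by omega) (by omega) (by omega) (by omega)) ?_
    exact_mod_cast simple_smul_of_ne (m := m) (i := i) (j := j + 1) (by omega) (by omega) (by omega)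
      (by omega)
  | s_s_e i j h =>
    have hi : (i : ℕ) + 1 < m := by omega
    have hj : (j : ℕ) + 1 < m := by omega
    rw [map_mul, map_mul, map_mul, genMap_s, genMap_s, genMap_e, genMap_e, ← map_mul,
      diagPerm_mul_diagNormal _ _ (simple_mul_self _), simple_conj hi hj h,
      diagSimple_mul_diagSimple hj hi h.symm, mul_one]
  | e_s_s i j h =>
    have hi : (i : ℕ) + 1 < m := by omega
    have hj : (j : ℕ) + 1 < m := by omega
    rw [map_mul, map_mul, map_mul, genMap_s, genMap_s, genMap_e, genMap_e, mul_assoc, ← map_mul,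
      diagNormal_mul_diagPerm _ _ (simple_mul_self _), diagSimple_mul_diagSimple hi hj h, one_mul]
  | s_e i =>
    rw [map_mul, genMap_s, genMap_e, diagPerm_mul_diagNormal _ _ (simple_mul_self _),
      mul_inv_cancel_right, diagNormal_absorb (simple_mul_self _) rfl fun v hv => hv]
  | e_s i =>
    rw [map_mul, genMap_s, genMap_e, diagNormal_mul_diagPerm _ _ (simple_mul_self _), one_mul]
    have := diagNormal_absorb (β := β) (g := 1) (simple_mul_self (m := m) i) rfl fun v hv => hv
    rwa [mul_one] at this
  | t_inv i =>
    rw [map_mul, genMap_t, genMap_tInv, map_one, map_mul_inv]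
  | inv_t i =>
    rw [map_mul, genMap_t, genMap_tInv, map_one, map_inv_mul]
  | tau_inv =>
    rw [map_mul, genMap_tau, genMap_tauInv, map_one, map_mul_inv]
  | inv_tau =>
    rw [map_mul, genMap_tau, genMap_tauInv, map_one, map_inv_mul]
  | tau_eq j h =>
    rw [map_mul, genMap_tau, genMap_t, map_list_prod, List.map_ofFn, translation_one_eq, map_mul,
      map_list_prod, List.map_ofFn, h]
    congr 3
    funext i
    exact (genMap_s i).symm
  | s_t_comm i j h =>
    rw [map_mul, map_mul, genMap_s, genMap_t, ← map_mul, ← map_mul]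
    exact perm (R.s_t_commute (by omega) j.2 (by omega) (by omega)).eq
  | e_t_comm i j h =>
    rw [map_mul, map_mul, genMap_e, genMap_t]
    refine (diagSimple_comm ?_ ?_).symm
    · refine shift_smul_of_not ?_ 1
      rw [natCast_modEq_iff (by omega) j.2]
      omega
    · refine shift_smul_of_not ?_ 1
      rw [succ_modEq_iff (by omega) j.2]
      omega
  | t_comm i j =>
    rw [map_mul, map_mul, genMap_t, genMap_t, ← map_mul, ← map_mul]
    exact perm (R.t_comm i j i.2 j.2).eq
  | s_t i =>
    rw [map_mul, map_mul, genMap_s, genMap_t, genMap_t, ← map_mul, ← map_mul]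
    exact perm (R.s_t i (by omega))
  | e_t_t i =>
    have hi : (i : ℕ) + 1 < m := by omega
    obtain ⟨h1, h2⟩ := wind2 i hi
    rw [map_mul, map_mul, genMap_e, genMap_t, genMap_t, mul_assoc, ← map_mul,
      diagNormal_mul_diagPerm _ _ (simple_mul_self _), one_mul]
    have := diagNormal_absorb (β := β) (g := 1) (simple_mul_self i) h1 h2
    rwa [mul_one] at this
  | t_t_e i =>
    have hi : (i : ℕ) + 1 < m := by omega
    obtain ⟨h1, h2⟩ := wind2 i hi
    rw [map_mul, map_mul, genMap_e, genMap_t, genMap_t, ← map_mul,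
      diagPerm_mul_diagNormal _ _ (simple_mul_self _)]
    have := diagNormal_absorb (β := β) (g := 1) (simple_mul_self i) h1 h2
    rw [← this]
    congr 1
    exact mul_inv_eq_of_eq_mul h1
  | e_t_e i a =>
    have hi : (i : ℕ) + 1 < m := by omega
    have hne := not_modEq_succ hi
    -- the product of the winding and the arc is a parallel arc times the winding
    have e1 : diagPerm m β (shift (i : ℕ) a) * diagNormal m β (simple m i) 1 =
        diagNormal m β (refl ((i : ℕ) + a * m) ((i : ℕ) + 1)) 1 *
          diagPerm m β (shift (i : ℕ) a) := by
      rw [diagPerm_mul_diagNormal _ _ (simple_mul_self _), diagNormal_mul_diagPerm _ _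
        (refl_mul_self _ _), simple_mul, shift_smul_self, shift_smul_of_not fun h => hne h.symm,
        mul_inv_cancel_right, mul_one, one_mul]
    have e2 := diagArc_mul_diagArc_add (β := β) hne a
    rw [map_mul, map_mul, map_smul, genMap_e, genMap_tPow, mul_assoc]
    change diagNormal m β _ 1 * (diagPerm m β (shift (i : ℕ) a) * _) = _
    rw [e1, ← mul_assoc]
    refine (congrArg (· * _) e2).trans ?_
    rw [smul_mul_assoc, diagNormal_mul_diagPerm _ _ (refl_mul_self _ _), shift_neg, inv_mul_cancel]
    rfl

end DiagramAlgebra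

/-! ### Components of Brauer diagrams -/

section Brauer

variable {m : ℕ}

lemma Diagram.part_add_mul (D : Diagram m) {u v : ℤ} {b c : Bool} (h : D.part (u, b) (v, c))
    (n : ℤ) : D.part (u + n * m, b) (v + n * m, c) :=
  (translate_iff D.invariant n (u, b) (v, c)).2 h

namespace Diagram.IsBrauer

variable {D D' : Diagram m}

lemma exists_partner (hD : D.IsBrauer) (p : ℤ × Bool) :
    ∃ q, q ≠ p ∧ D.part q p ∧ ∀ r, D.part r p → r = p ∨ r = q := by
  obtain ⟨x, y, hxy, h⟩ := Set.ncard_eq_two.1 (hD p)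
  have key : ∀ r, D.part r p ↔ r = x ∨ r = y := fun r => Set.ext_iff.1 h r
  rcases (key p).1 (D.part.refl' p) with rfl | rfl
  · exact ⟨y, hxy.symm, (key y).2 (Or.inr rfl), fun r hr => (key r).1 hr⟩
  · exact ⟨x, hxy, (key x).2 (Or.inl rfl), fun r hr => ((key r).1 hr).symm⟩

lemma eq_of_part (hD : D.IsBrauer) {p q r : ℤ × Bool} (hq : D.part q p) (hr : D.part r p)
    (hqp : q ≠ p) (hrp : r ≠ p) : q = r := by
  obtain ⟨s, -, -, h⟩ := hD.exists_partner p
  exact ((h q hq).resolve_left hqp).trans ((h r hr).resolve_left hrp).symm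

lemma eq_of_part_le (hD : D.IsBrauer) (hD' : D'.IsBrauer) (h : D.part ≤ D'.part) : D = D' := by
  refine Diagram.ext (le_antisymm h fun {p q} hpq => ?_)
  have hfin : {r | D'.part r q}.Finite :=
    Set.finite_of_ncard_ne_zero (by rw [hD' q]; exact two_ne_zero)
  have := Set.eq_of_subset_of_ncard_le (s := {r | D.part r q}) (t := {r | D'.part r q})
    (fun r hr => h hr) (by rw [hD q, hD' q]) hfin
  exact (Set.ext_iff.1 this p).2 hpq

/-- Two vertices of a component of a Brauer diagram are not translates of each other: the component
would be infinite. -/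
lemma not_modEq_of_part (hD : D.IsBrauer) {u v : ℤ} {b : Bool} (h : D.part (u, b) (v, b))
    (huv : u ≠ v) : ¬ u ≡ v [ZMOD m] := by
  intro hm
  obtain ⟨n, rfl⟩ := modEq_iff_exists_add_mul.1 hm
  have hn : n * m ≠ 0 := fun h0 => huv (by rw [h0, add_zero])
  have h1 := D.part.symm' (D.part_add_mul h n)
  have h2 := congrArg Prod.fst (hD.eq_of_part h h1 (by simpa using huv)
    (by simpa using hn))
  simp only at h2
  omega

end Diagram.IsBrauer

lemma isBrauer_of_partner {D : Diagram m}
    (h : ∀ p, ∃ q, p ≠ q ∧ ∀ r, D.part p r ↔ r = p ∨ r = q) : D.IsBrauer := by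
  intro p
  obtain ⟨q, hpq, hq⟩ := h p
  exact Set.ncard_eq_two.2 ⟨p, q, hpq, Set.ext fun r => D.part.comm'.trans (hq r)⟩

lemma isBrauer_normalDiagram {w : AffinePerm m} (hw : w * w = 1) (g : AffinePerm m) :
    (normalDiagram w g).IsBrauer := by
  have hbt : ∀ u v : ℤ, (normalDiagram w g).part (u, false) (v, true) ↔ w • v = v ∧ g • u = v :=
    fun u v => (normalDiagram w g).part.comm'.trans (normalDiagram_top_bottom hw)
  refine isBrauer_of_partner ?_
  rintro ⟨v, _ | _⟩
  · by_cases hv : w • g • v = g • v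
    · refine ⟨(g • v, true), by simp, ?_⟩
      rintro ⟨u, _ | _⟩
      · simp [normalDiagram_bottom_bottom hw, hv]
      · simp only [hbt, Prod.mk.injEq, Bool.true_eq_false, and_false, and_true, false_or]
        exact ⟨fun h => h.2.symm, fun h => by rw [h]; exact ⟨hv, rfl⟩⟩
    · refine ⟨(g⁻¹ • w • g • v, false), ?_, ?_⟩
      · rw [Ne, Prod.mk.injEq, eq_inv_smul_iff]
        exact fun h => hv h.1.symm
      · rintro ⟨u, _ | _⟩
        · simp [normalDiagram_bottom_bottom hw, eq_inv_smul_iff]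
        · simp only [hbt, Prod.mk.injEq, Bool.true_eq_false, and_false, or_self, iff_false, not_and]
          rintro h rfl
          exact hv h
  · by_cases hv : w • v = v
    · refine ⟨(g⁻¹ • v, false), by simp, ?_⟩
      rintro ⟨u, _ | _⟩
      · simp [normalDiagram_top_bottom hw, hv, eq_inv_smul_iff]
      · simp [normalDiagram_top_top hw, hv]
    · refine ⟨(w • v, true), ?_, ?_⟩
      · rw [Ne, Prod.mk.injEq]
        exact fun h => hv h.1.symm
      · rintro ⟨u, _ | _⟩
        · simp [normalDiagram_top_bottom hw, hv]
        · simp [normalDiagram_top_top hw]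

variable [NeZero m]

/-- An injective map which commutes with the translations is bijective, since it is injective on the
finitely many residue classes. -/
lemma exists_affinePerm_of_injective {f : ℤ → ℤ} (hf : ∀ x n : ℤ, f (x + n * m) = f x + n * m)
    (hinj : Function.Injective f) : ∃ g : AffinePerm m, ∀ x : ℤ, g • x = f x := by
  have hres : ∀ x y : ℤ, f x ≡ f y [ZMOD m] → x ≡ y [ZMOD m] := by
    intro x y h
    obtain ⟨n, hn⟩ := modEq_iff_exists_add_mul.1 h
    rw [← hf] at hn
    exact modEq_iff_exists_add_mul.2 ⟨n, hinj hn⟩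
  have hsurj : Function.Surjective fun z : ZMod m => ((f z.val : ℤ) : ZMod m) := by
    refine Finite.injective_iff_surjective.1 fun z z' h => ?_
    have h1 := hres _ _ ((ZMod.intCast_eq_intCast_iff _ _ _).1 h)
    have h2 := (ZMod.intCast_eq_intCast_iff _ _ _).2 h1
    simpa using h2
  refine ⟨⟨Equiv.ofBijective f ⟨hinj, fun y => ?_⟩, fun x => ?_⟩, fun x => rfl⟩
  · obtain ⟨z, hz⟩ := hsurj y
    obtain ⟨n, hn⟩ := modEq_iff_exists_add_mul.1 ((ZMod.intCast_eq_intCast_iff _ _ _).1 hz)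
    exact ⟨z.val + n * m, by rw [hf, hn]⟩
  · have := hf x 1
    rwa [one_mul] at this

/-- If a row of a Brauer diagram has no arcs, then its vertices are joined to all vertices of the
other row. -/
lemma Diagram.IsBrauer.exists_affinePerm {D : Diagram m} (hD : D.IsBrauer) {b : Bool}
    (hb : ∀ u v : ℤ, D.part (u, b) (v, b) → u = v) :
    ∃ g : AffinePerm m, ∀ u : ℤ, D.part (g • u, !b) (u, b) := by
  have h1 : ∀ u : ℤ, ∃ v : ℤ, D.part (v, !b) (u, b) := by
    intro u
    obtain ⟨⟨v, c⟩, hne, h, -⟩ := hD.exists_partner (u, b)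
    obtain rfl | hc := eq_or_ne c b
    · exact absurd (by rw [hb v u h]) hne
    · rw [Bool.eq_not.2 hc] at h
      exact ⟨v, h⟩
  choose f hf using h1
  have hne : ∀ x y : ℤ, (x, !b) ≠ (y, b) := by
    intro x y h
    simp at h
  obtain ⟨g, hg⟩ := exists_affinePerm_of_injective (m := m) (f := f)
    (fun x n => congrArg Prod.fst
      (hD.eq_of_part (hf (x + n * m)) (D.part_add_mul (hf x) n) (hne _ _) (hne _ _)))
    (fun x y hxy => hb x y (D.part.trans' (D.part.symm' (hf x)) (hxy ▸ hf y)))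
  exact ⟨g, fun u => by rw [hg]; exact hf u⟩

end Brauer

/-! ### Normal forms of Brauer diagrams -/

section Cut

variable {m : ℕ}

open Classical in
/-- The exchange of the translates of the top vertex `y` and of the bottom vertex `u`. -/
noncomputable def exchange (m : ℕ) (y u : ℤ) (p : ℤ × Bool) : ℤ × Bool :=
  if p.2 then if p.1 ≡ y [ZMOD m] then (p.1 - y + u, false) else p
  else if p.1 ≡ u [ZMOD m] then (p.1 - u + y, true) else p

lemma exchange_top (y u n : ℤ) : exchange m y u (y + n * m, true) = (u + n * m, false) := by
  rw [exchange, if_pos rfl, if_pos (add_mul_modEq y n)]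
  exact Prod.ext (by ring) rfl

lemma exchange_bottom (y u n : ℤ) : exchange m y u (u + n * m, false) = (y + n * m, true) := by
  rw [exchange, if_neg Bool.false_ne_true, if_pos (add_mul_modEq u n)]
  exact Prod.ext (by ring) rfl

lemma exchange_top_of_not {y v : ℤ} (h : ¬ v ≡ y [ZMOD m]) (u : ℤ) :
    exchange m y u (v, true) = (v, true) := by
  rw [exchange, if_pos rfl, if_neg h]

lemma exchange_bottom_of_not {u v : ℤ} (h : ¬ v ≡ u [ZMOD m]) (y : ℤ) :
    exchange m y u (v, false) = (v, false) := by
  rw [exchange, if_neg Bool.false_ne_true, if_neg h]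

lemma exchange_involutive (m : ℕ) (y u : ℤ) : Function.Involutive (exchange m y u) := by
  rintro ⟨v, _ | _⟩
  · by_cases h : v ≡ u [ZMOD m]
    · obtain ⟨n, rfl⟩ := modEq_iff_exists_add_mul.1 h.symm
      rw [exchange_bottom, exchange_top]
    · rw [exchange_bottom_of_not h, exchange_bottom_of_not h]
  · by_cases h : v ≡ y [ZMOD m]
    · obtain ⟨n, rfl⟩ := modEq_iff_exists_add_mul.1 h.symm
      rw [exchange_top, exchange_bottom]
    · rw [exchange_top_of_not h, exchange_top_of_not h]

lemma exchange_translate (y u : ℤ) (p : ℤ × Bool) :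
    exchange m y u (translate m p) = translate m (exchange m y u p) := by
  obtain ⟨v, b⟩ := p
  have e : ∀ z, v + m ≡ z [ZMOD m] ↔ v ≡ z [ZMOD m] := fun z => by simp [Int.ModEq]
  cases b
  · by_cases h : v ≡ u [ZMOD m]
    · simp only [exchange, translate, e, h, if_true, Bool.false_eq_true, if_false]
      exact Prod.ext (by ring) rfl
    · simp only [exchange, translate, e, h, Bool.false_eq_true, if_false]
  · by_cases h : v ≡ y [ZMOD m]
    · simp only [exchange, translate, e, h, if_true]
      exact Prod.ext (by ring) rfl
    · simp only [exchange, translate, e, h, if_true, if_false]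

/-- The diagram with the top vertex `y` and the bottom vertex `u` exchanged.  It replaces a top arc
at `y` and a bottom arc at `u` by two through strands. -/
noncomputable def Diagram.cut (D : Diagram m) (y u : ℤ) : Diagram m where
  part := D.part.comap (exchange m y u)
  invariant p q := by
    simp only [Setoid.comap_rel, exchange_translate]
    exact D.invariant _ _

lemma Diagram.cut_part (D : Diagram m) (y u : ℤ) (p q : ℤ × Bool) :
    (D.cut y u).part p q ↔ D.part (exchange m y u p) (exchange m y u q) := Iff.rfl

lemma Diagram.IsBrauer.cut {D : Diagram m} (hD : D.IsBrauer) (y u : ℤ) :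
    (D.cut y u).IsBrauer := by
  intro p
  have := (exchange_involutive m y u).injective
  have e : {q | (D.cut y u).part q p} =
      exchange m y u '' {q | D.part q (exchange m y u p)} := by
    rw [(exchange_involutive m y u).image_eq_preimage_symm]
    rfl
  rw [e, Set.ncard_image_of_injective _ this, hD]

/-- The residue classes of the top vertices on the top arcs. -/
def Diagram.topArcs (D : Diagram m) : Set (Fin m) :=
  {i | ∃ v : ℤ, v ≠ (i : ℕ) ∧ D.part (v, true) ((i : ℕ), true)}

/-- Cutting a top arc and a bottom arc reduces the number of top arcs. -/
lemma Diagram.IsBrauer.ncard_topArcs_cut_lt [NeZero m] {D : Diagram m} (hD : D.IsBrauer)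
    {x y u v : ℤ} (hxy : x ≠ y) (huv : u ≠ v) (hD1 : D.part (x, true) (y, true))
    (hD2 : D.part (u, false) (v, false)) : (D.cut y u).topArcs.ncard < D.topArcs.ncard := by
  have hC := hD.cut y u
  have hxy' := hD.not_modEq_of_part hD1 hxy
  have huv' := hD.not_modEq_of_part hD2 huv
  have c1 : ∀ n : ℤ, (D.cut y u).part (u + n * m, false) (x + n * m, true) := by
    refine fun n => Diagram.part_add_mul _ ?_ n
    rw [Diagram.cut_part, exchange_top_of_not hxy']
    have := exchange_bottom (m := m) y u 0
    rw [zero_mul, add_zero, add_zero] at this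
    rw [this]
    exact D.part.symm' hD1
  have c2 : ∀ n : ℤ, (D.cut y u).part (v + n * m, false) (y + n * m, true) := by
    refine fun n => Diagram.part_add_mul _ ?_ n
    rw [Diagram.cut_part, exchange_bottom_of_not fun h => huv' h.symm]
    have := exchange_top (m := m) y u 0
    rw [zero_mul, add_zero, add_zero] at this
    rw [this]
    exact D.part.symm' hD2
  have hnot : ∀ {z z' : ℤ}, z ≠ z' → (D.cut y u).part (z, true) (z', true) →
      ¬ z' ≡ x [ZMOD m] ∧ ¬ z' ≡ y [ZMOD m] := by
    refine fun hz h => ⟨fun h' => ?_, fun h' => ?_⟩ <;>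
      obtain ⟨n, rfl⟩ := modEq_iff_exists_add_mul.1 h'.symm
    · simpa using hC.eq_of_part h (c1 n) (by simpa using hz) (by simp)
    · simpa using hC.eq_of_part h (c2 n) (by simpa using hz) (by simp)
  refine Set.ncard_lt_ncard (Set.ssubset_iff_of_subset ?_ |>.2 ?_) (Set.toFinite _)
  · rintro i ⟨z, hz, h⟩
    refine ⟨z, hz, ?_⟩
    have h1 := (hnot hz h).2
    have h2 := (hnot hz.symm ((D.cut y u).part.symm' h)).2
    rwa [Diagram.cut_part, exchange_top_of_not h1, exchange_top_of_not h2] at h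
  · have hm : (0 : ℤ) < m := by exact_mod_cast Nat.pos_of_ne_zero (NeZero.ne m)
    have hlt := Int.emod_lt_of_pos x hm
    have hnn := Int.emod_nonneg x hm.ne'
    have hx : (((x % m).toNat : ℕ) : ℤ) = x + -(x / m) * m := by
      rw [Int.toNat_of_nonneg hnn, Int.emod_def]
      ring
    refine ⟨⟨(x % m).toNat, by omega⟩, ⟨y + -(x / m) * m, ?_, ?_⟩, ?_⟩
    · change _ ≠ (((x % m).toNat : ℕ) : ℤ)
      rw [hx]
      intro h
      exact hxy (add_right_cancel h).symm
    · change D.part _ ((((x % m).toNat : ℕ) : ℤ), true)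
      rw [hx]
      exact D.part_add_mul (D.part.symm' hD1) _
    · rintro ⟨z, hz, h⟩
      refine (hnot hz h).1 ?_
      change (((x % m).toNat : ℕ) : ℤ) ≡ x [ZMOD m]
      rw [hx]
      exact add_mul_modEq _ _

/-- If the diagram with a top arc and a bottom arc cut is normal, then so is the diagram. -/
lemma Diagram.IsBrauer.eq_normalDiagram_of_cut {D : Diagram m} (hD : D.IsBrauer)
    {x y u v : ℤ} (hxy : x ≠ y) (huv : u ≠ v) (hD1 : D.part (x, true) (y, true))
    (hD2 : D.part (u, false) (v, false)) {w g : AffinePerm m} (hw : w * w = 1)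
    (h : D.cut y u = normalDiagram w g) :
    w • x = x ∧ w • y = y ∧ D = normalDiagram (refl x y * w) g := by
  have hxy' := hD.not_modEq_of_part hD1 hxy
  have huv' := hD.not_modEq_of_part hD2 huv
  have e1 := exchange_bottom (m := m) y u 0
  have e2 := exchange_top (m := m) y u 0
  rw [zero_mul, add_zero, add_zero] at e1 e2
  obtain ⟨hwx, hgu⟩ : w • x = x ∧ g • u = x := by
    rw [← normalDiagram_top_bottom hw, ← h, Diagram.cut_part, exchange_top_of_not hxy', e1]
    exact hD1
  obtain ⟨hwy, hgv⟩ : w • y = y ∧ g • v = y := by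
    rw [← normalDiagram_top_bottom hw, ← h, Diagram.cut_part,
      exchange_bottom_of_not fun h => huv' h.symm, e2]
    exact hD2
  have hcomm := commute_refl_of_smul hwx hwy
  have hw' : refl x y * w * (refl x y * w) = 1 := by
    rw [mul_assoc, ← mul_assoc w, hcomm, mul_assoc, hw, mul_one, refl_mul_self]
  -- the vertices which do not lie on the cut arcs
  have far : ∀ z : ℤ, ¬ z ≡ x [ZMOD m] → ¬ z ≡ y [ZMOD m] →
      (refl x y * w) • z = w • z ∧ exchange m y u (z, true) = (z, true) ∧
        exchange m y u (w • z, true) = (w • z, true) ∧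
        exchange m y u (g⁻¹ • z, false) = (g⁻¹ • z, false) ∧
        exchange m y u (g⁻¹ • w • z, false) = (g⁻¹ • w • z, false) := by
    intro z h1 h2
    have h3 : ¬ w • z ≡ x [ZMOD m] := by rwa [← hwx, smul_modEq_smul]
    have h4 : ¬ w • z ≡ y [ZMOD m] := by rwa [← hwy, smul_modEq_smul]
    have hg : ∀ z : ℤ, ¬ z ≡ x [ZMOD m] → ¬ g⁻¹ • z ≡ u [ZMOD m] := fun z hz => by
      rwa [← smul_modEq_smul g, smul_inv_smul, hgu]
    exact ⟨by rw [mul_smul, refl_smul_of_not h3 h4], exchange_top_of_not h2 u,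
      exchange_top_of_not h4 u, exchange_bottom_of_not (hg z h1) y,
      exchange_bottom_of_not (hg _ h3) y⟩
  have near : ∀ n : ℤ, (refl x y * w) • (x + n * m) = y + n * m ∧
      (refl x y * w) • (y + n * m) = x + n * m ∧
      g⁻¹ • (x + n * m) = u + n * m ∧ g⁻¹ • (y + n * m) = v + n * m := by
    refine fun n => ⟨?_, ?_, ?_, ?_⟩
    · rw [mul_smul, smul_add_mul_eq_self hwx, refl_smul_left_add hxy']
    · rw [mul_smul, smul_add_mul_eq_self hwy, refl_smul_right_add hxy']
    · rw [inv_smul_eq_iff, smul_add_mul, hgu]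
    · rw [inv_smul_eq_iff, smul_add_mul, hgv]
  refine ⟨hwx, hwy, ((isBrauer_normalDiagram hw' g).eq_of_part_le hD ?_).symm⟩
  refine normalDiagram_part_le hw' (fun z hz => ?_) (fun z hz => ?_) (fun z hz => ?_) <;>
    obtain ⟨n, rfl⟩ | ⟨n, rfl⟩ | ⟨h1, h2⟩ := modEq_cases m x y z
  · rw [(near n).1]
    exact D.part_add_mul hD1 n
  · rw [(near n).2.1]
    exact D.part_add_mul (D.part.symm' hD1) n
  · obtain ⟨f1, f2, f3, f4, f5⟩ := far z h1 h2
    rw [f1, ← f2, ← f3, ← Diagram.cut_part, h, normalDiagram_top_top hw]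
    exact Or.inr rfl
  · rw [(near n).1, (near n).2.2.1, (near n).2.2.2]
    exact D.part_add_mul hD2 n
  · rw [(near n).2.1, (near n).2.2.1, (near n).2.2.2]
    exact D.part_add_mul (D.part.symm' hD2) n
  · obtain ⟨f1, f2, f3, f4, f5⟩ := far z h1 h2
    rw [f1, ← f4, ← f5, ← Diagram.cut_part, h, normalDiagram_bottom_bottom hw, smul_inv_smul,
      smul_inv_smul]
    exact Or.inr rfl
  · rw [(near n).1] at hz
    exact absurd (add_right_cancel hz).symm hxy
  · rw [(near n).2.1] at hz
    exact absurd (add_right_cancel hz) hxy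
  · obtain ⟨f1, f2, f3, f4, f5⟩ := far z h1 h2
    rw [f1] at hz
    rw [← f2, ← f4, ← Diagram.cut_part, h, normalDiagram_top_bottom hw]
    exact ⟨hz, smul_inv_smul _ _⟩

/-- Every Brauer diagram is the diagram of a normal form. -/
lemma Diagram.IsBrauer.exists_eq_normalDiagram [NeZero m] {A : Type*} [Ring A]
    (ρ : AffinePerm m →* A) (e : A) {D : Diagram m} (hD : D.IsBrauer) :
    ∃ w a g, ArcProduct ρ e w a ∧ D = normalDiagram w g := by
  induction hn : D.topArcs.ncard using Nat.strong_induction_on generalizing D with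
  | _ n ih =>
  subst hn
  by_cases htop : ∀ x y : ℤ, D.part (x, true) (y, true) → x = y
  · obtain ⟨g, hg⟩ := hD.exists_affinePerm htop
    refine ⟨1, 1, g⁻¹, ArcProduct.one, ?_⟩
    refine ((isBrauer_normalDiagram (mul_one 1) g⁻¹).eq_of_part_le hD ?_).symm
    refine normalDiagram_part_le (mul_one 1) (fun v hv => absurd (one_smul _ v) hv)
      (fun v hv => absurd (one_smul _ v) hv) fun v _ => ?_
    rw [inv_inv]
    exact D.part.symm' (hg v)
  · push Not at htop
    obtain ⟨x, y, hD1, hxy⟩ := htop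
    -- otherwise the vertices of the bottom row are joined to all top vertices
    obtain ⟨u, v, hD2, huv⟩ : ∃ u v : ℤ, D.part (u, false) (v, false) ∧ u ≠ v := by
      by_contra! hbot
      obtain ⟨g, hg⟩ := hD.exists_affinePerm hbot
      have h1 := hg (g⁻¹ • x)
      rw [smul_inv_smul] at h1
      simpa using hD.eq_of_part (D.part.symm' h1) (D.part.symm' hD1) (by simp)
        (by simpa using hxy.symm)
    obtain ⟨w, a, g, hw, h⟩ := ih _ (hD.ncard_topArcs_cut_lt hxy huv hD1 hD2) (hD.cut y u) rfl
    obtain ⟨hwx, hwy, h'⟩ := hD.eq_normalDiagram_of_cut hxy huv hD1 hD2 hw.mul_self h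
    exact ⟨_, _, g, hw.mul (hD.not_modEq_of_part hD1 hxy) hwx hwy, h'⟩

end Cut

/-! ### The isomorphism -/

section Isomorphism

variable {m : ℕ}

/-- The simple reflections and the windings generate the affine permutations. -/
lemma tail_zero_eq_top [NeZero m] : AffineRelations.tail m (simple m) (wind m) 0 = ⊤ := by
  refine (Subgroup.eq_top_iff' _).2 fun g => ?_
  have key : AffineRelations.graph m (simple m) (wind m) 0 ≤
      (AffineRelations.tail m (simple m) (wind m) 0).comap
        (MonoidHom.snd (AffinePerm m) (AffinePerm m)) := by
    rw [AffineRelations.graph, AffineRelations.tail, Subgroup.closure_le]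
    rintro _ (⟨i, h1, h2, rfl⟩ | ⟨i, h1, h2, rfl⟩)
    · exact Subgroup.subset_closure (Or.inl ⟨i, h1, h2, rfl⟩)
    · exact Subgroup.subset_closure (Or.inr ⟨i, h1, h2, rfl⟩)
  obtain ⟨x, hx, rfl⟩ := AffineRelations.exists_mem_graph (s := simple m) (t := wind m) m 0
    (by omega) g (by simp)
  exact key hx

lemma isBrauer_diagram (g : Gen m) : g.diagram.IsBrauer := by
  cases g with
  | tau => rw [Gen.diagram, twist_eq]; exact isBrauer_normalDiagram (mul_one 1) _
  | tauInv => rw [Gen.diagram, twist_eq]; exact isBrauer_normalDiagram (mul_one 1) _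
  | e i => rw [Gen.diagram, cupCap_eq]; exact isBrauer_normalDiagram (refl_mul_self _ _) _
  | s i => rw [Gen.diagram, crossing_eq]; exact isBrauer_normalDiagram (mul_one 1) _
  | t i => rw [Gen.diagram, winding_eq]; exact isBrauer_normalDiagram (mul_one 1) _
  | tInv i => rw [Gen.diagram, winding_eq]; exact isBrauer_normalDiagram (mul_one 1) _

variable {k : Type*} [CommRing k] [NeZero m] {β : k}

variable (m β) in
/-- The homomorphism from the presented algebra to the partition algebra. -/
noncomputable def toDiagrams : Presented m β →ₐ[k] PartitionAlgebra k m β :=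
  RingQuot.liftAlgHom k ⟨genMap m β, fun _ _ h => genMap_rel h⟩

lemma toDiagrams_toPresented (x : FreeAlgebra k (Gen m)) :
    toDiagrams m β (toPresented β x) = genMap m β x :=
  RingQuot.liftAlgHom_mkAlgHom_apply _ _ _ _

lemma toDiagrams_presPerm (g : AffinePerm m) :
    toDiagrams m β (presPerm m β g) = diagPerm m β g := by
  have key : AffineRelations.tail m (simple m) (wind m) 0 ≤
      (((toDiagrams m β : Presented m β →* PartitionAlgebra k m β).comp
        (presPerm m β)).eqLocus (diagPerm m β)) := by
    rw [AffineRelations.tail, Subgroup.closure_le]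
    rintro _ (⟨i, -, hi, rfl⟩ | ⟨i, -, hi, rfl⟩)
    · change toDiagrams m β (presPerm m β (simple m i)) = _
      rw [presPerm_simple hi, toDiagrams_toPresented, genMap_s]
    · change toDiagrams m β (presPerm m β (wind m i)) = _
      rw [presPerm_wind hi, toDiagrams_toPresented, genMap_t]
  exact key (tail_zero_eq_top (m := m) ▸ Subgroup.mem_top g)

lemma toDiagrams_arc {x y : ℤ} (hxy : ¬ x ≡ y [ZMOD m]) :
    toDiagrams m β (arc (presPerm m β) (presE β m 0) x y) = diagNormal m β (refl x y) 1 := by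
  have hm := two_le_of_not_modEq hxy
  obtain ⟨g, rfl, rfl⟩ := exists_smul_two hm hxy
  rw [(presented_cupCapRelations m β).arc_eq, conj, map_mul, map_mul, toDiagrams_presPerm,
    toDiagrams_presPerm, presE_eq (by omega), toDiagrams_toPresented, genMap_e,
    diagPerm_mul_diagNormal _ _ (simple_mul_self _), mul_one,
    diagNormal_mul_diagPerm, mul_inv_cancel]
  · congr 1
    rw [← mul_inv_eq_iff_eq_mul.2 (mul_refl g 0 1)]
    simp [simple]
  · have h0 := simple_mul_self (m := m) 0
    calc g * simple m 0 * g⁻¹ * (g * simple m 0 * g⁻¹)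
        = g * (simple m 0 * simple m 0) * g⁻¹ := by group
      _ = 1 := by rw [h0]; group

/-- A normal form is sent to its diagram. -/
lemma toDiagrams_arcProduct {w : AffinePerm m} {a : Presented m β}
    (h : ArcProduct (presPerm m β) (presE β m 0) w a) (g : AffinePerm m) :
    toDiagrams m β (a * presPerm m β g) = diagNormal m β w g := by
  induction h with
  | one =>
    rw [one_mul, toDiagrams_presPerm]
    rfl
  | mul hxy hx hy h ih =>
    rw [mul_assoc, map_mul, ih, toDiagrams_arc hxy, diagArc_mul_diagNormal hxy g h.mul_self hx hy]

/-- Distinct normal forms have distinct diagrams, and hence linearly independent images. -/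
lemma toDiagrams_injective : Function.Injective (toDiagrams m β) := by
  classical
  -- `x` is a normal form with the diagram `D`
  let IsNormal (D : Diagram m) (x : Presented m β) : Prop := ∃ w a g,
    ArcProduct (presPerm m β) (presE β m 0) w a ∧ x = a * presPerm m β g ∧ D = normalDiagram w g
  have unique : ∀ {D : Diagram m} {x y : Presented m β}, IsNormal D x → IsNormal D y → x = y := by
    rintro D _ _ ⟨w, a, g, h, rfl, rfl⟩ ⟨w', a', g', h', rfl, hD⟩
    obtain ⟨rfl, h1, h2⟩ := eq_of_normalDiagram_eq h.mul_self h'.mul_self hD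
    rw [← h.mul_map_eq (presented_cupCapRelations m β) h' h1 h2, mul_assoc, ← map_mul,
      inv_mul_cancel_right]
  -- a left inverse, which sends a diagram to its normal form if there is one
  let inv : PartitionAlgebra k m β →ₗ[k] Presented m β :=
    extend β fun D => if h : ∃ x, IsNormal D x then h.choose else 0
  have hinv : ∀ x, inv (toDiagrams m β x) = x := by
    intro x
    have hx : x ∈ normalSpan k (presPerm m β) (presE β m 0) := by
      rw [normalSpan_eq_top (presented_cupCapRelations m β) presented_adjoin]
      exact Submodule.mem_top
    induction hx using Submodule.span_induction with
    | mem x hx =>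
      obtain ⟨w, a, g, h, rfl⟩ := hx
      have hN : IsNormal (normalDiagram w g) (a * presPerm m β g) := ⟨w, a, g, h, rfl, rfl⟩
      have hE : ∃ x, IsNormal (normalDiagram w g) x := ⟨_, hN⟩
      rw [toDiagrams_arcProduct h, diagNormal, extend_ofDiagram, dif_pos hE]
      exact unique hE.choose_spec hN
    | zero => rw [map_zero, map_zero]
    | add x y _ _ hx hy => rw [map_add, map_add, hx, hy]
    | smul r x _ hx => rw [map_smul, map_smul, hx]
  exact Function.LeftInverse.injective hinv

lemma range_toDiagrams_eq_adjoin : (toDiagrams m β).range =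
    Algebra.adjoin k (Set.range fun g : Gen m => ofDiagram β g.diagram) := by
  have h : (toDiagrams m β).comp (toPresented β) = genMap m β :=
    AlgHom.ext toDiagrams_toPresented
  have hr : (toDiagrams m β).range = (genMap m β).range := by
    have hs : (toPresented β).range = (⊤ : Subalgebra k (Presented m β)) :=
      (AlgHom.range_eq_top _).2 (RingQuot.mkAlgHom_surjective k _)
    rw [← h, AlgHom.range_comp, hs, Algebra.map_top]
  rw [hr, genMap, ← Algebra.adjoin_range_eq_range_freeAlgebra_lift]

lemma range_toDiagrams : (toDiagrams m β).range = brauerAlgebra k m β := by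
  refine le_antisymm ?_ (Algebra.adjoin_le ?_)
  · rw [range_toDiagrams_eq_adjoin]
    refine Algebra.adjoin_mono ?_
    rintro _ ⟨g, rfl⟩
    exact ⟨g.diagram, isBrauer_diagram g, rfl⟩
  · rintro _ ⟨D, hD, rfl⟩
    obtain ⟨w, a, g, h, rfl⟩ := hD.exists_eq_normalDiagram (presPerm m β) (presE β m 0)
    exact ⟨_, toDiagrams_arcProduct h g⟩

end Isomorphism

end AffineDiagram

theorem mainTheorem7 {k : Type*} [CommRing k] (β : k) (m : ℕ) [NeZero m] :
    Algebra.adjoin k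
        (Set.range fun g : AffineDiagram.Gen m => AffineDiagram.ofDiagram β g.diagram) =
      AffineDiagram.brauerAlgebra k m β ∧
    ∃ φ : AffineDiagram.Presented m β ≃ₐ[k] AffineDiagram.brauerAlgebra k m β,
      ∀ g : AffineDiagram.Gen m,
        (φ (RingQuot.mkAlgHom k (AffineDiagram.Rel β) (AffineDiagram.gen k g)) :
            AffineDiagram.PartitionAlgebra k m β) =
          AffineDiagram.ofDiagram β g.diagram := by
  refine ⟨AffineDiagram.range_toDiagrams_eq_adjoin.symm.trans AffineDiagram.range_toDiagrams,
    (AlgEquiv.ofInjective _ AffineDiagram.toDiagrams_injective).trans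
      (Subalgebra.equivOfEq _ _ AffineDiagram.range_toDiagrams), fun g => ?_⟩
  exact (AffineDiagram.toDiagrams_toPresented _).trans (AffineDiagram.genMap_gen g)
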